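/- Setting. Let $F$ be a non-archimedean local field with residue field $\mathbb{F}_q$ of characteristic $p$, $\overline F$ a separable closure with the unique valuation extending that of $F$, $\mathcal O$ its valuation ring, $\mathfrak p$ the maximal ideal, $\mathbb{F}=\mathcal O/\mathfrak p$ the residue field (an algebraic closure of $\mathbb{F}_q$), and $x\mapsto\bar x$ the reduction map. Let $R(x)=\sum_{i=0}^e a_ix^{p^i}\in\mathbb{F}_q[x]$ with $a_e\neq 0$ and $(p,e)\neq(2,0)$, and put $$E_R(x)=R(x)^{p^e}+\sum_{i=0}^e(a_ix)^{p^{e-i}},\qquad d_R=\gcd\{p^i+1: a_i\ne 0\},$$ $$f_R(x,y)=-\sum_{i=0}^{e-1}\Big(\sum_{j=0}^{e-i-1}(a_ix^{p^i}y)^{p^j}+(xR(y))^{p^i}\Big).$$ Let $Q_R$ be the group of triples $(\alpha,\beta,\gamma)\in\mathbb{F}^3$ with $\alpha^{d_R}=1$, $E_R(\beta)=0$, $\gamma^p-\gamma=\beta R(\beta)$, with product $$(\alpha_1,\beta_1,\gamma_1)(\alpha_2,\beta_2,\gamma_2)=(\alpha_1\alpha_2,\ \beta_1+\alpha_1\beta_2,\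 \gamma_1+\gamma_2+f_R(\beta_1,\alpha_1\beta_2)).$$ For an integer $m>0$ prime to $p$ put $d_{R,m}=d_R/\gcd(d_R,m)$ and let $Q_{R,m}\subset Q_R$ be the subgroup of triples with $\alpha^{d_{R,m}}=1$. Let $1\in\mathbb{Z}$ act on $Q_{R,m}$ by $(\alpha,\beta,\gamma)\mapsto(\alpha^{q^{-1}},\beta^{q^{-1}},\gamma^{q^{-1}})$. Let $\widetilde a_i$ be the Teichmüller lift of $a_i$, and let $\widetilde R,\widetilde E_R,\widetilde f$ be given by the formulas for $R,E_R,f_R$ with $\widetilde a_i$ in place of $a_i$. Let $\varpi$ be a uniformizer of $F$ and let $\alpha_R,\beta_{R,m},\gamma_{R,m}\in\overline F$ satisfy $$\alpha_R^{d_R}=\varpi,\qquad \widetilde E_R(\beta_{R,m})=\alpha_R^{-m},\qquad \gamma_{R,m}^p-\gamma_{R,m}=\beta_{R,m}\widetilde R(\beta_{R,m}).$$ Write $\beta=\beta_{R,m}$, $\gamma=\gamma_{R,m}$. Assume (this is automatic if $F$ has characteristic $p$) that the polynomials $$\beta^{p^e}(\widetilde E_R(\beta+x)-\widetilde E_R(\beta)-\widetilde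 E_R(x)),\quad \beta(\widetilde R(\beta+x)-\widetilde R(\beta)-\widetilde R(x)),$$ $$\widetilde f(\beta,x)^p-\widetilde f(\beta,x)+\beta^{p^e}\widetilde E_R(x)-x\widetilde R(\beta)-\beta\widetilde R(x),\quad (x+\beta)^{p^i}-x^{p^i}-\beta^{p^i}\ (1\le i\le e-1)$$ have all their coefficients in $\mathfrak p$, and that so do the polynomials in two variables $$(\gamma+\widetilde f(\beta,y)+x)^p-\gamma^p-\widetilde f(\beta,y)^p-x^p,\qquad \widetilde f(\beta,x+y)-\widetilde f(\beta,x)-\widetilde f(\beta,y).$$ Let $F^{\rm ur}\subset\overline F$ be the maximal unramified extension of $F$ and $L=F^{\rm ur}(\alpha_R^m,\beta_{R,m},\gamma_{R,m})$. Let $W(L/F)$ be the group of automorphisms of $L/F$ that act on residue classes as an integral power of the $q$-th power Frobenius. For an automorphism $\sigma$ of $\overline F/F$ put $$a_\sigma=\sigma(\alpha_R)/\alpha_R,\qquad b_\sigma=a_\sigma^m\sigma(\beta_{R,m})-\beta_{R,m},\qquad c_\sigma=\sigma(\gamma_{R,m})-\gamma_{R,m}-\widetilde f(\beta_{R,m},b_\sigma),$$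 and let $n_\sigma\in\mathbb{Z}$ be the integer, if there is one, with $\overline{\sigma(x)}=\bar x^{\,q^{-n_\sigma}}$ for all $x\in\mathcal O$. Lemma 3.8. The extension $L/F$ is Galois. For every automorphism $\sigma$ of $\overline F/F$ whose restriction to $L$ lies in $W(L/F)$, the integer $n_\sigma$ exists, $a_\sigma,b_\sigma,c_\sigma\in\mathcal O$, and $((\bar a_\sigma^m,\bar b_\sigma,\bar c_\sigma),n_\sigma)$ lies in $Q_{R,m}\rtimes\mathbb{Z}$ and depends only on $\sigma|_L$; and $$W(L/F)\longrightarrow Q_{R,m}\rtimes\mathbb{Z},\qquad \sigma|_L\mapsto((\bar a_\sigma^m,\bar b_\sigma,\bar c_\sigma),n_\sigma)$$ is an isomorphism of groups. The extension $L/F^{\rm ur}$ is totally ramified of degree $d_{R,m}p^{2e+1}$. -/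

import Mathlib

open ValuativeRel

/-! ### Additive polynomials, and the forms `R`, `E_R`, `f_R` -/

section AdditiveForms

variable {A B : Type*} [CommRing A] [CommRing B]

/-- `R(x) = ∑_{i=0}^e a_i x^{p^i}`, evaluated in any commutative ring containing the
coefficients. -/
def evalR (p e : ℕ) (a : ℕ → A) (x : A) : A :=
  ∑ i ∈ Finset.range (e + 1), a i * x ^ p ^ i

/-- `E_R(x) = R(x)^{p^e} + ∑_{i=0}^e (a_i x)^{p^{e-i}}`. -/
def evalE (p e : ℕ) (a : ℕ → A) (x : A) : A :=
  evalR p e a x ^ p ^ e + ∑ i ∈ Finset.range (e + 1), (a i * x) ^ p ^ (e - i)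

/-- `f_R(x,y) = -∑_{i=0}^{e-1} (∑_{j=0}^{e-i-1} (a_i x^{p^i} y)^{p^j} + (x R(y))^{p^i})`. -/
def evalF (p e : ℕ) (a : ℕ → A) (x y : A) : A :=
  -∑ i ∈ Finset.range e,
    ((∑ j ∈ Finset.range (e - i), (a i * x ^ p ^ i * y) ^ p ^ j) + (x * evalR p e a y) ^ p ^ i)

theorem map_evalR (φ : A →+* B) (p e : ℕ) (a : ℕ → A) (x : A) :
    φ (evalR p e a x) = evalR p e (fun i => φ (a i)) (φ x) := by
  simp [evalR]

theorem map_evalE (φ : A →+* B) (p e : ℕ) (a : ℕ → A) (x : A) :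
    φ (evalE p e a x) = evalE p e (fun i => φ (a i)) (φ x) := by
  simp [evalE, map_evalR]

theorem map_evalF (φ : A →+* B) (p e : ℕ) (a : ℕ → A) (x y : A) :
    φ (evalF p e a x y) = evalF p e (fun i => φ (a i)) (φ x) (φ y) := by
  simp [evalF, map_evalR]

theorem evalR_add {p : ℕ} [Fact p.Prime] [CharP A p] (e : ℕ) (a : ℕ → A) (x y : A) :
    evalR p e a (x + y) = evalR p e a x + evalR p e a y := by
  simp [evalR, add_pow_char_pow, mul_add, Finset.sum_add_distrib]

theorem evalE_add {p : ℕ} [Fact p.Prime] [CharP A p] (e : ℕ) (a : ℕ → A) (x y : A) :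
    evalE p e a (x + y) = evalE p e a x + evalE p e a y := by
  simp only [evalE, evalR_add, add_pow_char_pow, mul_add, Finset.sum_add_distrib]
  ring

theorem evalF_add_left {p : ℕ} [Fact p.Prime] [CharP A p] (e : ℕ) (a : ℕ → A) (x x' y : A) :
    evalF p e a (x + x') y = evalF p e a x y + evalF p e a x' y := by
  simp only [evalF, add_pow_char_pow, mul_add, add_mul, Finset.sum_add_distrib]
  ring

theorem evalF_add_right {p : ℕ} [Fact p.Prime] [CharP A p] (e : ℕ) (a : ℕ → A) (x y y' : A) :
    evalF p e a x (y + y') = evalF p e a x y + evalF p e a x y' := by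
  simp only [evalF, evalR_add, add_pow_char_pow, mul_add, Finset.sum_add_distrib]
  ring

/-- `f_R(x,y)^p - f_R(x,y) = -x^{p^e} E_R(y) + x R(y) + y R(x)` in characteristic `p`. -/
theorem evalF_pow_sub {p : ℕ} [Fact p.Prime] [CharP A p] (e : ℕ) (a : ℕ → A) (x y : A) :
    evalF p e a x y ^ p - evalF p e a x y =
      -x ^ p ^ e * evalE p e a y + x * evalR p e a y + y * evalR p e a x := by
  have hneg : ∀ z : A, (-z) ^ p = -z ^ p := fun z => by
    have := sub_pow_char (p := p) (0 : A) z
    simpa [zero_pow (Fact.out : p.Prime).ne_zero] using this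
  have htel : ∀ (z : A) (n : ℕ),
      (∑ j ∈ Finset.range n, z ^ p ^ j) ^ p - ∑ j ∈ Finset.range n, z ^ p ^ j
        = z ^ p ^ n - z := by
    intro z n
    rw [sum_pow_char, ← Finset.sum_sub_distrib]
    have : ∀ j ∈ Finset.range n, (z ^ p ^ j) ^ p - z ^ p ^ j = z ^ p ^ (j + 1) - z ^ p ^ j := by
      intro j _
      rw [← pow_mul, ← pow_succ]
    rw [Finset.sum_congr rfl this, Finset.sum_range_sub (fun j => z ^ p ^ j)]
    simp
  have h1 : evalF p e a x y ^ p - evalF p e a x y =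
      -((∑ i ∈ Finset.range e,
          ((a i * x ^ p ^ i * y) ^ p ^ (e - i) - a i * x ^ p ^ i * y)) +
        ((x * evalR p e a y) ^ p ^ e - x * evalR p e a y)) := by
    rw [evalF, hneg, ← htel (x * evalR p e a y) e, Finset.sum_add_distrib, add_pow_char,
      sum_pow_char (p := p) (s := Finset.range e)
        (f := fun i => ∑ j ∈ Finset.range (e - i), (a i * x ^ p ^ i * y) ^ p ^ j)]
    simp only [← htel (_ * _ * y), Finset.sum_sub_distrib]
    ring
  have h2 : ∀ i ∈ Finset.range e, (a i * x ^ p ^ i * y) ^ p ^ (e - i) =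
      x ^ p ^ e * (a i * y) ^ p ^ (e - i) := by
    intro i hi
    have hi' : i + (e - i) = e := by have := Finset.mem_range.mp hi; omega
    have : x ^ p ^ e = (x ^ p ^ i) ^ p ^ (e - i) := by rw [← pow_mul, ← pow_add, hi']
    rw [this]
    ring
  rw [h1, Finset.sum_sub_distrib, Finset.sum_congr rfl h2, ← Finset.mul_sum, evalE, mul_pow]
  have h3 : y * evalR p e a x = (∑ i ∈ Finset.range e, a i * x ^ p ^ i * y) + a e * x ^ p ^ e * y := by
    rw [evalR, Finset.sum_range_succ, mul_add, Finset.mul_sum]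
    congr 1
    · exact Finset.sum_congr rfl fun i _ => by ring
    · ring
  rw [h3, Finset.sum_range_succ (fun i => (a i * y) ^ p ^ (e - i))]
  simp only [Nat.sub_self, pow_zero, pow_one]
  ring

end AdditiveForms

/-- An additive polynomial `R(x) = ∑_{i=0}^e a_i x^{p^i}` with `a_e ≠ 0` over a field `k`, given
by its coefficients (the values of `a` beyond `e` play no role). -/
structure AddPoly (k : Type*) [Field k] where
  /-- the exponent `e` of the degree `p^e` -/
  e : ℕ
  /-- the coefficients -/
  a : ℕ → k
  lead_ne_zero : a e ≠ 0

namespace AddPoly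

variable {k : Type*} [Field k]

/-- `d_R = gcd {p^i + 1 | a_i ≠ 0}`. -/
noncomputable def d (R : AddPoly k) (p : ℕ) : ℕ :=
  letI := Classical.decEq k
  ((Finset.range (R.e + 1)).filter (fun i => R.a i ≠ 0)).gcd fun i => p ^ i + 1

/-- `d_{R,m} = d_R / gcd(d_R, m)`. -/
noncomputable def dm (R : AddPoly k) (p m : ℕ) : ℕ := R.d p / Nat.gcd (R.d p) m

theorem d_dvd (R : AddPoly k) (p : ℕ) {i : ℕ} (hi : i ≤ R.e) (h : R.a i ≠ 0) :
    R.d p ∣ p ^ i + 1 := by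
  let := Classical.decEq k
  unfold d
  refine Finset.gcd_dvd (f := fun i => p ^ i + 1) ?_
  rw [Finset.mem_filter, Finset.mem_range]
  exact ⟨by omega, h⟩

theorem d_ne_zero (R : AddPoly k) (p : ℕ) : R.d p ≠ 0 := fun h => by
  have := R.d_dvd p le_rfl R.lead_ne_zero
  rw [h] at this
  simp at this

variable (𝔽 : Type*) [Field 𝔽] [Algebra k 𝔽]

/-- The coefficients of `R` viewed in an extension `𝔽` of `k`. -/
def coeffs (R : AddPoly k) (i : ℕ) : 𝔽 := algebraMap k 𝔽 (R.a i)

variable {𝔽}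

theorem map_coeffs (R : AddPoly k) (s : 𝔽 ≃ₐ[k] 𝔽) :
    (fun i => (s : 𝔽 →+* 𝔽) (R.coeffs 𝔽 i)) = R.coeffs 𝔽 :=
  funext fun i => s.commutes (R.a i)

theorem coeffs_mul_pow (R : AddPoly k) {p : ℕ} {α : 𝔽} (hα : α ^ R.d p = 1) {i : ℕ}
    (hi : i ≤ R.e) : R.coeffs 𝔽 i * α ^ (p ^ i + 1) = R.coeffs 𝔽 i := by
  by_cases h : R.a i = 0
  · simp [coeffs, h]
  · obtain ⟨c, hc⟩ := R.d_dvd p hi h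
    rw [hc, pow_mul, hα, one_pow, mul_one]

theorem mul_evalR (R : AddPoly k) {p : ℕ} {α : 𝔽} (hα : α ^ R.d p = 1) (x : 𝔽) :
    α * evalR p R.e (R.coeffs 𝔽) (α * x) = evalR p R.e (R.coeffs 𝔽) x := by
  rw [evalR, evalR, Finset.mul_sum]
  refine Finset.sum_congr rfl fun i hi => ?_
  have hi' : i ≤ R.e := by have := Finset.mem_range.mp hi; omega
  conv_rhs => rw [← R.coeffs_mul_pow hα hi']
  ring

theorem evalF_mul (R : AddPoly k) {p : ℕ} {α : 𝔽} (hα : α ^ R.d p = 1) (x y : 𝔽) :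
    evalF p R.e (R.coeffs 𝔽) (α * x) (α * y) = evalF p R.e (R.coeffs 𝔽) x y := by
  rw [evalF, evalF]
  congr 1
  refine Finset.sum_congr rfl fun i hi => ?_
  have hi' : i ≤ R.e := by have := Finset.mem_range.mp hi; omega
  have h1 : R.coeffs 𝔽 i * (α * x) ^ p ^ i * (α * y) = R.coeffs 𝔽 i * x ^ p ^ i * y := by
    conv_rhs => rw [← R.coeffs_mul_pow hα hi']
    ring
  have h2 : α * x * evalR p R.e (R.coeffs 𝔽) (α * y) = x * evalR p R.e (R.coeffs 𝔽) y := by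
    rw [← R.mul_evalR hα y]
    ring
  rw [h1, h2]

theorem evalE_mul (R : AddPoly k) {p : ℕ} {α : 𝔽} (hα : α ^ R.d p = 1) (x : 𝔽) :
    evalE p R.e (R.coeffs 𝔽) (α * x) = α * evalE p R.e (R.coeffs 𝔽) x := by
  have hα0 : α ≠ 0 := by
    rintro rfl
    rw [zero_pow (R.d_ne_zero p)] at hα
    exact zero_ne_one hα
  have he : α ^ p ^ R.e * α = 1 := by
    obtain ⟨c, hc⟩ := R.d_dvd p le_rfl R.lead_ne_zero
    rw [← pow_succ, hc, pow_mul, hα, one_pow]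
  have h1 : evalR p R.e (R.coeffs 𝔽) (α * x) ^ p ^ R.e =
      α * evalR p R.e (R.coeffs 𝔽) x ^ p ^ R.e := by
    rw [← R.mul_evalR hα x, mul_pow, ← mul_assoc, mul_comm α (α ^ p ^ R.e), he, one_mul]
  rw [evalE, evalE, h1, mul_add, Finset.mul_sum]
  congr 1
  refine Finset.sum_congr rfl fun i hi => ?_
  have hi' : i ≤ R.e := by have := Finset.mem_range.mp hi; omega
  by_cases h : R.a i = 0
  · have hp : (0 : 𝔽) ^ p ^ (R.e - i) = 0 ∨ (0 : 𝔽) ^ p ^ (R.e - i) = 1 := by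
      rcases Nat.eq_zero_or_pos (p ^ (R.e - i)) with h0 | h0
      · right; rw [h0, pow_zero]
      · left; exact zero_pow h0.ne'
    rcases Nat.eq_zero_or_pos p with rfl | hp0
    · rcases Nat.eq_or_lt_of_le hi' with rfl | hlt
      · exact absurd h R.lead_ne_zero
      · have h0 : R.e ≠ 0 := by omega
        have : α = 1 := by simpa [zero_pow h0] using he
        simp [this]
    · simp [coeffs, h, zero_pow (Nat.pow_pos hp0 : 0 < p ^ (R.e - i)).ne']
  · obtain ⟨c, hc⟩ := R.d_dvd p hi' h
    have hi1 : α ^ p ^ i = α⁻¹ := by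
      apply eq_inv_of_mul_eq_one_left; rw [← pow_succ, hc, pow_mul, hα, one_pow]
    have he1 : α ^ p ^ R.e = α⁻¹ := eq_inv_of_mul_eq_one_left he
    have hdef : α ^ p ^ (R.e - i) = α := by
      have : (α ^ p ^ i) ^ p ^ (R.e - i) = α ^ p ^ R.e := by
        rw [← pow_mul, ← pow_add, Nat.add_sub_cancel' hi']
      rw [hi1, he1, inv_pow] at this
      exact inv_injective this
    rw [mul_left_comm, mul_pow, hdef]

end AddPoly

/-! ### The group `Q_R` -/

/-- The set `Q_R = {(α,β,γ) ∈ 𝔽³ | α ∈ μ_{d_R}, E_R(β) = 0, γ^p - γ = β R(β)}`. -/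
@[ext]
structure QR {k : Type*} [Field k] (p : ℕ) (R : AddPoly k) (𝔽 : Type*) [Field 𝔽]
    [Algebra k 𝔽] where
  /-- first coordinate -/
  α : 𝔽
  /-- second coordinate -/
  β : 𝔽
  /-- third coordinate -/
  γ : 𝔽
  α_pow : α ^ R.d p = 1
  E_β : evalE p R.e (R.coeffs 𝔽) β = 0
  γ_eq : γ ^ p - γ = β * evalR p R.e (R.coeffs 𝔽) β

namespace QR

variable {k : Type*} [Field k] {p : ℕ} [Fact p.Prime] [CharP k p] {R : AddPoly k}
  {𝔽 : Type*} [Field 𝔽] [Algebra k 𝔽]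

/-- The group law
`(α₁,β₁,γ₁)(α₂,β₂,γ₂) = (α₁α₂, β₁ + α₁β₂, γ₁ + γ₂ + f_R(β₁, α₁β₂))`. -/
instance : Mul (QR p R 𝔽) where
  mul g h :=
    { α := g.α * h.α
      β := g.β + g.α * h.β
      γ := g.γ + h.γ + evalF p R.e (R.coeffs 𝔽) g.β (g.α * h.β)
      α_pow := by rw [mul_pow, g.α_pow, h.α_pow, one_mul]
      E_β := by
        have : CharP 𝔽 p := charP_of_injective_algebraMap (algebraMap k 𝔽).injective p
        rw [evalE_add, R.evalE_mul g.α_pow, g.E_β, h.E_β, mul_zero, add_zero]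
      γ_eq := by
        have : CharP 𝔽 p := charP_of_injective_algebraMap (algebraMap k 𝔽).injective p
        have hF := evalF_pow_sub (p := p) R.e (R.coeffs 𝔽) g.β (g.α * h.β)
        rw [R.evalE_mul g.α_pow, h.E_β, mul_zero, mul_zero, zero_add] at hF
        have h1 := g.γ_eq
        have h2 := h.γ_eq
        rw [← R.mul_evalR g.α_pow h.β] at h2
        rw [add_pow_char, add_pow_char, evalR_add]
        linear_combination h1 + h2 + hF }

instance : One (QR p R 𝔽) where
  one :=
    { α := 1
      β := 0
      γ := 0
      α_pow := one_pow _
      E_β := by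
        have : CharP 𝔽 p := charP_of_injective_algebraMap (algebraMap k 𝔽).injective p
        simpa using evalE_add (p := p) R.e (R.coeffs 𝔽) 0 0
      γ_eq := by simp [zero_pow (Fact.out : p.Prime).ne_zero] }

instance : Inv (QR p R 𝔽) where
  inv g :=
    { α := g.α⁻¹
      β := g.α⁻¹ * -g.β
      γ := -g.γ + evalF p R.e (R.coeffs 𝔽) g.β g.β
      α_pow := by rw [inv_pow, g.α_pow, inv_one]
      E_β := by
        have : CharP 𝔽 p := charP_of_injective_algebraMap (algebraMap k 𝔽).injective p
        have h1 : g.α⁻¹ ^ R.d p = 1 := by rw [inv_pow, g.α_pow, inv_one]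
        have h2 := evalE_add (p := p) R.e (R.coeffs 𝔽) g.β (-g.β)
        have h0 := evalE_add (p := p) R.e (R.coeffs 𝔽) 0 0
        rw [add_neg_cancel, g.E_β, zero_add] at h2
        rw [add_zero] at h0
        rw [R.evalE_mul h1, ← h2]
        simp at h0
        rw [h0, mul_zero]
      γ_eq := by
        have : CharP 𝔽 p := charP_of_injective_algebraMap (algebraMap k 𝔽).injective p
        have h1 : g.α⁻¹ ^ R.d p = 1 := by rw [inv_pow, g.α_pow, inv_one]
        have hF := evalF_pow_sub (p := p) R.e (R.coeffs 𝔽) g.β g.β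
        rw [g.E_β, mul_zero, zero_add] at hF
        have hneg : (-g.γ) ^ p = -g.γ ^ p := by
          have := sub_pow_char (p := p) (0 : 𝔽) g.γ
          simpa [zero_pow (Fact.out : p.Prime).ne_zero] using this
        have h0 : evalR p R.e (R.coeffs 𝔽) 0 = 0 := by
          simpa using evalR_add (p := p) R.e (R.coeffs 𝔽) 0 0
        have h2 := evalR_add (p := p) R.e (R.coeffs 𝔽) g.β (-g.β)
        rw [add_neg_cancel, h0] at h2
        have h3 := R.mul_evalR h1 (-g.β)
        have h4 := g.γ_eq
        rw [add_pow_char, hneg]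
        linear_combination -h4 + hF + g.β * h3 - g.β * h2 }

theorem mul_α (g h : QR p R 𝔽) : (g * h).α = g.α * h.α := rfl
theorem mul_β (g h : QR p R 𝔽) : (g * h).β = g.β + g.α * h.β := rfl
theorem mul_γ (g h : QR p R 𝔽) :
    (g * h).γ = g.γ + h.γ + evalF p R.e (R.coeffs 𝔽) g.β (g.α * h.β) := rfl
theorem one_α : (1 : QR p R 𝔽).α = 1 := rfl
theorem one_β : (1 : QR p R 𝔽).β = 0 := rfl
theorem one_γ : (1 : QR p R 𝔽).γ = 0 := rfl
theorem inv_α (g : QR p R 𝔽) : g⁻¹.α = g.α⁻¹ := rfl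
theorem inv_β (g : QR p R 𝔽) : g⁻¹.β = g.α⁻¹ * -g.β := rfl
theorem inv_γ (g : QR p R 𝔽) : g⁻¹.γ = -g.γ + evalF p R.e (R.coeffs 𝔽) g.β g.β := rfl

theorem α_ne_zero {k : Type*} [Field k] {p : ℕ} {R : AddPoly k} {𝔽 : Type*} [Field 𝔽]
    [Algebra k 𝔽] (g : QR p R 𝔽) : g.α ≠ 0 := by
  intro h
  have := g.α_pow
  rw [h, zero_pow (R.d_ne_zero p)] at this
  exact zero_ne_one this

instance : Group (QR p R 𝔽) :=
  haveI : CharP 𝔽 p := charP_of_injective_algebraMap (algebraMap k 𝔽).injective p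
  Group.ofLeftAxioms
    (by
      intro g h l
      ext
      · simp only [mul_α]; ring
      · simp only [mul_α, mul_β]; ring
      · simp only [mul_α, mul_β, mul_γ, mul_add, evalF_add_left, evalF_add_right, mul_assoc,
          R.evalF_mul g.α_pow]
        ring)
    (by
      intro g
      have h0 : evalF p R.e (R.coeffs 𝔽) 0 g.β = 0 := by
        simpa using evalF_add_left (p := p) R.e (R.coeffs 𝔽) 0 0 g.β
      ext
      · simp [mul_α, one_α]
      · simp [mul_β, one_α, one_β]
      · simp [mul_γ, one_α, one_β, one_γ, h0])
    (by
      intro g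
      have h1 : g.α⁻¹ ^ R.d p = 1 := by rw [inv_pow, g.α_pow, inv_one]
      have h0 : evalF p R.e (R.coeffs 𝔽) 0 g.β = 0 := by
        simpa using evalF_add_left (p := p) R.e (R.coeffs 𝔽) 0 0 g.β
      have h2 := evalF_add_left (p := p) R.e (R.coeffs 𝔽) g.β (-g.β) g.β
      rw [add_neg_cancel, h0] at h2
      ext
      · simp [mul_α, inv_α, one_α, g.α_ne_zero]
      · simp only [mul_β, inv_α, inv_β, one_β]; ring
      · rw [mul_γ, inv_β, inv_α, inv_γ, R.evalF_mul h1, one_γ]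
        linear_combination -h2)

/-- A `k`-automorphism of `𝔽` acts on `Q_R` coordinatewise. -/
def galMap (s : 𝔽 ≃ₐ[k] 𝔽) (g : QR p R 𝔽) : QR p R 𝔽 where
  α := s g.α
  β := s g.β
  γ := s g.γ
  α_pow := by rw [← map_pow, g.α_pow, map_one]
  E_β := by
    have h := map_evalE (s : 𝔽 →+* 𝔽) p R.e (R.coeffs 𝔽) g.β
    rw [g.E_β, map_zero] at h
    rw [R.map_coeffs] at h
    exact h.symm
  γ_eq := by
    have h := map_evalR (s : 𝔽 →+* 𝔽) p R.e (R.coeffs 𝔽) g.β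
    have h' := congrArg s g.γ_eq
    rw [map_sub, map_pow, map_mul] at h'
    rw [h']
    congr 1
    rw [R.map_coeffs] at h
    exact h

theorem galMap_mul (s : 𝔽 ≃ₐ[k] 𝔽) (g h : QR p R 𝔽) :
    galMap s (g * h) = galMap s g * galMap s h := by
  have hF := map_evalF (s : 𝔽 →+* 𝔽) p R.e (R.coeffs 𝔽) g.β (g.α * h.β)
  ext
  · simp [galMap, mul_α]
  · simp [galMap, mul_α, mul_β]
  · rw [R.map_coeffs] at hF
    simpa [galMap, mul_γ] using hF

variable (p R 𝔽) in
/-- `Q_{R,m} = {(α,β,γ) ∈ Q_R | α ∈ μ_{d_{R,m}}}`, as a subgroup of `Q_R`. -/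
noncomputable def sub (m : ℕ) : Subgroup (QR p R 𝔽) where
  carrier := {g | g.α ^ R.dm p m = 1}
  mul_mem' := by
    intro g h hg hh
    simp only [Set.mem_ofPred_eq, mul_α, mul_pow] at *
    rw [hg, hh, one_mul]
  one_mem' := by simp [one_α]
  inv_mem' := by
    intro g hg
    simp only [Set.mem_ofPred_eq, inv_α, inv_pow] at *
    rw [hg, inv_one]

/-- The coordinatewise action of the `k`-automorphisms of `𝔽` on the group `Q_{R,m}`. -/
noncomputable def galAction (m : ℕ) : (𝔽 ≃ₐ[k] 𝔽) →* MulAut (sub p R 𝔽 m) where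
  toFun s :=
    { toFun := fun g => ⟨galMap s g.1, by
        have hg : g.1.α ^ R.dm p m = 1 := g.2
        change (s g.1.α) ^ R.dm p m = 1
        rw [← map_pow, hg, map_one]⟩
      invFun := fun g => ⟨galMap s⁻¹ g.1, by
        have hg : g.1.α ^ R.dm p m = 1 := g.2
        change (s⁻¹ g.1.α) ^ R.dm p m = 1
        rw [← map_pow, hg, map_one]⟩
      left_inv := fun g => by
        apply Subtype.ext
        ext
        · exact s.symm_apply_apply _
        · exact s.symm_apply_apply _
        · exact s.symm_apply_apply _
      right_inv := fun g => by
        apply Subtype.ext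
        ext
        · exact s.apply_symm_apply _
        · exact s.apply_symm_apply _
        · exact s.apply_symm_apply _
      map_mul' := fun g h => Subtype.ext (galMap_mul s g.1 h.1) }
  map_one' := rfl
  map_mul' _ _ := rfl

end QR

/-! ### Frobenius and the action of `ℤ` -/

section Frobenius

variable (k 𝔽 : Type*) [Field k] [Finite k] [Field 𝔽] [Algebra k 𝔽] [Algebra.IsAlgebraic k 𝔽]

/-- The `q`-power Frobenius automorphism of an algebraic extension `𝔽` of the finite field `k`
with `q` elements. -/
noncomputable def frob : 𝔽 ≃ₐ[k] 𝔽 :=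
  letI := Fintype.ofFinite k
  FiniteField.frobeniusAlgEquivOfAlgebraic k 𝔽

theorem frob_apply (x : 𝔽) : frob k 𝔽 x = x ^ Nat.card k := by
  let := Fintype.ofFinite k
  rw [Nat.card_eq_fintype_card]
  rfl

variable {k} in
/-- The action of `ℤ` on `Q_{R,m}` for which `1` acts by
`(α,β,γ) ↦ (α^{q⁻¹}, β^{q⁻¹}, γ^{q⁻¹})`. -/
noncomputable def QR.intAction (p : ℕ) [Fact p.Prime] [CharP k p] (R : AddPoly k) (m : ℕ) :
    Multiplicative ℤ →* MulAut (QR.sub p R 𝔽 m) :=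
  (QR.galAction m).comp (zpowersHom (𝔽 ≃ₐ[k] 𝔽) (frob k 𝔽)⁻¹)

end Frobenius

/-! ### Local fields -/

section LocalField

variable (F : Type*) [Field F] [ValuativeRel F]
  (Fbar : Type*) [Field Fbar] [Algebra F Fbar] [ValuativeRel Fbar] [ValuativeExtension F Fbar]

instance hasExtension_valuation : (valuation F).HasExtension (valuation Fbar) where
  val_isEquiv_comap := by
    intro a b
    rw [Valuation.comap_apply, Valuation.comap_apply, ← Valuation.Compatible.vle_iff_le,
      ← Valuation.Compatible.vle_iff_le, ValuativeExtension.vle_iff_vle]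

/-- The residue field of an algebraic extension of `F` is algebraic over the residue field
of `F`. -/
instance residue_isAlgebraic [Algebra.IsAlgebraic F Fbar] :
    Algebra.IsAlgebraic 𝓀[F] 𝓀[Fbar] where
  isAlgebraic := by
    intro z
    obtain ⟨x, rfl⟩ := IsLocalRing.residue_surjective z
    obtain ⟨P, hP0, hP⟩ := Algebra.IsAlgebraic.isAlgebraic (R := F) (x : Fbar)
    obtain ⟨n, hn, hmax⟩ := P.support.exists_max_image (fun i => valuation F (P.coeff i))
      (Polynomial.support_nonempty.mpr hP0)
    have hc : P.coeff n ≠ 0 := Polynomial.mem_support_iff.mp hn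
    set Q : Polynomial F := Polynomial.C (P.coeff n)⁻¹ * P with hQ
    have hQc : ∀ i, Q.coeff i ∈ 𝒪[F] := by
      intro i
      rw [hQ, Polynomial.coeff_C_mul, Valuation.mem_integer_iff, map_mul, map_inv₀]
      have hv : valuation F (P.coeff n) ≠ 0 := by simpa using hc
      have hle : valuation F (P.coeff i) ≤ valuation F (P.coeff n) := by
        by_cases hi : P.coeff i = 0
        · simp [hi]
        · exact hmax i (Polynomial.mem_support_iff.mpr hi)
      calc (valuation F (P.coeff n))⁻¹ * valuation F (P.coeff i)
          ≤ (valuation F (P.coeff n))⁻¹ * valuation F (P.coeff n) := by gcongr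
        _ = 1 := inv_mul_cancel₀ hv
    have hQlift : ∃ Q' : Polynomial 𝒪[F], Q'.map (algebraMap 𝒪[F] F) = Q := by
      have : Q ∈ Polynomial.lifts (algebraMap 𝒪[F] F) := by
        rw [Polynomial.lifts_iff_coeff_lifts]
        exact fun i => ⟨⟨_, hQc i⟩, rfl⟩
      simpa [Polynomial.mem_lifts] using this
    obtain ⟨Q', hQ'⟩ := hQlift
    refine ⟨Q'.map (IsLocalRing.residue 𝒪[F]), ?_, ?_⟩
    · intro h0
      have h1 : Q'.coeff n = 1 := by
        apply Subtype.ext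
        have := congrArg (fun T => Polynomial.coeff T n) hQ'
        simp only [Polynomial.coeff_map] at this
        refine this.trans ?_
        rw [hQ, Polynomial.coeff_C_mul, inv_mul_cancel₀ hc]
        rfl
      have := congrArg (fun T => Polynomial.coeff T n) h0
      simp [h1] at this
    · have h2 : Polynomial.aeval x Q' = 0 := by
        apply Subtype.ext
        have h3 : Polynomial.aeval (x : Fbar) Q = 0 := by
          rw [hQ, map_mul, hP, mul_zero]
        rw [← hQ', Polynomial.aeval_map_algebraMap] at h3
        have := (Polynomial.aeval_algebraMap_apply Fbar x Q').symm.trans h3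
        exact this
      have h4 := congrArg (IsLocalRing.residue 𝒪[Fbar]) h2
      rw [map_zero, Polynomial.aeval_def, Polynomial.hom_eval₂] at h4
      rw [Polynomial.aeval_def, Polynomial.eval₂_map]
      exact h4

/-- The Teichmüller lift exists and is unique. -/
theorem existsUnique_teichmuller [TopologicalSpace F] [IsNonarchimedeanLocalField F] (a : 𝓀[F]) :
    ∃! t : 𝒪[F], t ^ Nat.card 𝓀[F] = t ∧ IsLocalRing.residue 𝒪[F] t = a := by
  let := IsTopologicalAddGroup.rightUniformSpace F
  have := isUniformAddGroup_of_addCommGroup (G := F)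
  have hH : HenselianRing 𝒪[F] 𝓂[F] := inferInstance
  let := Fintype.ofFinite 𝓀[F]
  have hq : Nat.card 𝓀[F] ≠ 0 := Nat.card_pos.ne'
  have hq1 : 1 < Nat.card 𝓀[F] := Finite.one_lt_card
  have hqa : ∀ b : 𝓀[F], b ^ Nat.card 𝓀[F] = b := fun b => by
    rw [Nat.card_eq_fintype_card, FiniteField.pow_card]
  have hq0 : ((Nat.card 𝓀[F] : ℕ) : 𝓀[F]) = 0 := by
    rw [Nat.card_eq_fintype_card, Nat.cast_card_eq_zero]
  obtain ⟨x, rfl⟩ := IsLocalRing.residue_surjective a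
  obtain ⟨t, ht, htx⟩ := hH.is_henselian
    ((Polynomial.X : Polynomial 𝒪[F]) ^ Nat.card 𝓀[F] - Polynomial.X)
    (Polynomial.monic_X_pow_sub (by simpa using hq1)) x
    (by
      rw [← Ideal.Quotient.eq_zero_iff_mem]
      change IsLocalRing.residue 𝒪[F] _ = 0
      simp only [Polynomial.eval_sub, Polynomial.eval_pow, Polynomial.eval_X, map_sub, map_pow,
        hqa, sub_self])
    (by
      change IsUnit (IsLocalRing.residue 𝒪[F] _)
      have hd : (Polynomial.derivative
          ((Polynomial.X : Polynomial 𝒪[F]) ^ Nat.card 𝓀[F] - Polynomial.X)).eval x =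
          (Nat.card 𝓀[F] : 𝒪[F]) * x ^ (Nat.card 𝓀[F] - 1) - 1 := by
        rw [Polynomial.derivative_sub, Polynomial.derivative_X_pow, Polynomial.derivative_X]
        simp only [Polynomial.eval_sub, Polynomial.eval_mul, Polynomial.eval_pow,
          Polynomial.eval_X, Polynomial.eval_one, Polynomial.eval_natCast, map_natCast]
      rw [hd, map_sub, map_mul, map_natCast, hq0, zero_mul, zero_sub, map_one]
      exact isUnit_one.neg)
  have ht' : t ^ Nat.card 𝓀[F] = t := by
    simpa [Polynomial.IsRoot, sub_eq_zero] using ht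
  have htr : IsLocalRing.residue 𝒪[F] t = IsLocalRing.residue 𝒪[F] x := by
    rw [← sub_eq_zero, ← map_sub, IsLocalRing.residue_eq_zero_iff]
    exact htx
  refine ⟨t, ⟨ht', htr⟩, ?_⟩
  rintro s ⟨hs, hsr⟩
  have hg := (Commute.all s t).geom_sum₂_mul (Nat.card 𝓀[F])
  rw [hs, ht'] at hg
  have hu : IsUnit (1 - ∑ i ∈ Finset.range (Nat.card 𝓀[F]),
      s ^ i * t ^ (Nat.card 𝓀[F] - 1 - i)) := by
    rw [← isUnit_map_iff (IsLocalRing.residue 𝒪[F])]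
    have : ∀ i ∈ Finset.range (Nat.card 𝓀[F]),
        IsLocalRing.residue 𝒪[F] x ^ i * IsLocalRing.residue 𝒪[F] x ^ (Nat.card 𝓀[F] - 1 - i) =
          IsLocalRing.residue 𝒪[F] x ^ (Nat.card 𝓀[F] - 1) := by
      intro i hi
      have := Finset.mem_range.mp hi
      rw [← pow_add]
      congr 1
      omega
    simp only [map_sub, map_one, map_sum, map_mul, map_pow, hsr, htr]
    rw [Finset.sum_congr rfl this, Finset.sum_const, Finset.card_range, nsmul_eq_mul, hq0,
      zero_mul, sub_zero]
    exact isUnit_one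
  have h0 : (1 - ∑ i ∈ Finset.range (Nat.card 𝓀[F]),
      s ^ i * t ^ (Nat.card 𝓀[F] - 1 - i)) * (s - t) = 0 := by
    rw [sub_mul, hg]; ring
  exact sub_eq_zero.mp ((hu.mul_right_eq_zero).mp h0)

variable {F} in
/-- The Teichmüller lift `ã ∈ μ(F) ∪ {0}` of an element `a` of the residue field: the unique
lift with `ã^q = ã`. -/
noncomputable def teichmullerLift [TopologicalSpace F] [IsNonarchimedeanLocalField F]
    (a : 𝓀[F]) : 𝒪[F] :=
  (existsUnique_teichmuller F a).choose

/-- The coefficients `ã_i` of `R̃`, in `F̄`. -/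
noncomputable def liftCoeffs [TopologicalSpace F] [IsNonarchimedeanLocalField F]
    (R : AddPoly 𝓀[F]) (i : ℕ) : Fbar :=
  algebraMap F Fbar (teichmullerLift (R.a i) : F)

/-! ### Unramified and totally ramified extensions -/

variable {F Fbar} in
/-- A finite extension `K/F` inside `F̄` is unramified if its value group is that of `F`.
(The residue field of `F` being finite, the residue field extension is separable.) -/
def IsUnramifiedExt (K : IntermediateField F Fbar) : Prop :=
  FiniteDimensional F K ∧
    ∀ x : K, ∃ y : F, valuation Fbar (x : Fbar) = valuation Fbar (algebraMap F Fbar y)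

/-- The maximal unramified extension `F^ur` of `F` in `F̄`: the compositum of all finite
unramified extensions. -/
noncomputable def maxUnramified : IntermediateField F Fbar :=
  sSup {K | IsUnramifiedExt K}

variable {F Fbar} in
/-- The value group `v(K^×)` of a field `K` between `F` and `F̄`. -/
noncomputable def valueGroup (K : IntermediateField F Fbar) :
    Subgroup (ValueGroupWithZero Fbar)ˣ :=
  (Units.map ((valuation Fbar : Fbar →* ValueGroupWithZero Fbar).comp
    (algebraMap K Fbar : K →* Fbar))).range

variable {F Fbar} in
/-- `L/K` is a finite, totally ramified extension: the ramification index `[v(L^×) : v(K^×)]`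
equals the degree `[L : K]`. -/
def IsTotallyRamifiedExt (K L : IntermediateField F Fbar) : Prop :=
  K ≤ L ∧ IntermediateField.relfinrank K L ≠ 0 ∧
    (valueGroup K).relIndex (valueGroup L) = IntermediateField.relfinrank K L

/-! ### Weil groups -/

section Weil

variable [TopologicalSpace F] [IsNonarchimedeanLocalField F] [Algebra.IsAlgebraic F Fbar]
  {K : Type*} [Field K] [Algebra F K] [Algebra K Fbar]

variable {F} in
/-- `τ(x) ≡ x^{q^{-n}}` modulo the maximal ideal for all integral `x ∈ K`, where `K` is a
subextension of `F̄` (possibly `F̄` itself): `n_τ = n`. -/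
def ActsAsFrob (τ : K ≃ₐ[F] K) (n : ℤ) : Prop :=
  ∀ (x : K) (hx : algebraMap K Fbar x ∈ 𝒪[Fbar]),
    ∃ h : algebraMap K Fbar (τ x) ∈ 𝒪[Fbar],
      IsLocalRing.residue 𝒪[Fbar] ⟨_, h⟩ =
        ((frob 𝓀[F] 𝓀[Fbar]) ^ (-n)) (IsLocalRing.residue 𝒪[Fbar] ⟨_, hx⟩)

variable (K) in
/-- The Weil group `W(K/F)`: the automorphisms of `K/F` which act on residue classes as an
integral power of Frobenius. -/
def weilGroup : Subgroup (K ≃ₐ[F] K) where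
  carrier := {τ | ∃ n : ℤ, ActsAsFrob Fbar τ n}
  mul_mem' := by
    rintro σ τ ⟨n, hn⟩ ⟨m, hm⟩
    refine ⟨n + m, fun x hx => ?_⟩
    obtain ⟨h1, e1⟩ := hm x hx
    obtain ⟨h2, e2⟩ := hn (τ x) h1
    refine ⟨h2, ?_⟩
    have e3 : IsLocalRing.residue 𝒪[Fbar] ⟨algebraMap K Fbar ((σ * τ) x), h2⟩ =
      ((frob 𝓀[F] 𝓀[Fbar]) ^ (-n)) (IsLocalRing.residue 𝒪[Fbar] ⟨_, h1⟩) := e2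
    rw [e3, e1, neg_add, zpow_add]
    rfl
  one_mem' := ⟨0, fun x hx => ⟨hx, by simp⟩⟩
  inv_mem' := by
    rintro τ ⟨n, hn⟩
    refine ⟨-n, fun x hx => ?_⟩
    have hτ : τ (τ⁻¹ x) = x := τ.apply_symm_apply x
    have hmem : algebraMap K Fbar (τ⁻¹ x) ∈ 𝒪[Fbar] := by
      by_contra hcon
      rw [Valuation.mem_integer_iff, not_le] at hcon
      set y := τ⁻¹ x with hy
      have hlt : valuation Fbar (algebraMap K Fbar y⁻¹) < 1 := by
        rw [map_inv₀, map_inv₀]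
        exact inv_lt_one_of_one_lt₀ hcon
      obtain ⟨h, e⟩ := hn y⁻¹ hlt.le
      have hz : IsLocalRing.residue 𝒪[Fbar] ⟨algebraMap K Fbar y⁻¹, hlt.le⟩ = 0 := by
        rw [IsLocalRing.residue_eq_zero_iff, IsLocalRing.mem_maximalIdeal, mem_nonunits_iff]
        intro hu
        have := (Valuation.integer.integers (valuation Fbar)).one_of_isUnit hu
        exact hlt.ne this
      rw [hz, map_zero, IsLocalRing.residue_eq_zero_iff, IsLocalRing.mem_maximalIdeal,
        mem_nonunits_iff] at e
      have hxi : algebraMap K Fbar (τ y⁻¹) = (algebraMap K Fbar x)⁻¹ := by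
        rw [map_inv₀, hτ, map_inv₀]
      have hx0 : algebraMap K Fbar x ≠ 0 := by
        intro h0
        have hx0 : x = 0 := by simpa using h0
        rw [hy, hx0, map_zero, map_zero, map_zero] at hcon
        exact absurd hcon (by simp)
      apply e
      apply (Valuation.integer.integers (valuation Fbar)).isUnit_of_one
      · rw [isUnit_iff_ne_zero]
        change algebraMap K Fbar (τ y⁻¹) ≠ 0
        rw [hxi]
        exact inv_ne_zero hx0
      · apply le_antisymm h
        change 1 ≤ valuation Fbar (algebraMap K Fbar (τ y⁻¹))
        rw [hxi, map_inv₀]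
        exact (one_le_inv₀ (zero_lt_iff.mpr (by simpa using hx0))).mpr hx
    obtain ⟨h, e⟩ := hn _ hmem
    refine ⟨hmem, ?_⟩
    have e' : IsLocalRing.residue 𝒪[Fbar] ⟨_, hx⟩ =
        ((frob 𝓀[F] 𝓀[Fbar]) ^ (-n)) (IsLocalRing.residue 𝒪[Fbar] ⟨_, hmem⟩) := by
      rw [← e]
      congr 1
      exact Subtype.ext (congrArg (algebraMap K Fbar) hτ.symm)
    rw [e', ← AlgEquiv.mul_apply, ← zpow_add]
    simp

end Weil

/-! ### The elements `a_σ, b_σ, c_σ` and the standing conditions -/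

section Galois

variable {F Fbar}

/-- `a_σ = σ(α)/α`. -/
noncomputable def aSigma (α : Fbar) (σ : Fbar ≃ₐ[F] Fbar) : Fbar := σ α / α

/-- `b_σ = a_σ^m σ(β) - β`. -/
noncomputable def bSigma (m : ℕ) (α β : Fbar) (σ : Fbar ≃ₐ[F] Fbar) : Fbar :=
  aSigma α σ ^ m * σ β - β

/-- `c_σ = σ(γ) - γ - f̃(β, b_σ)`. -/
noncomputable def cSigma [TopologicalSpace F] [IsNonarchimedeanLocalField F] (p : ℕ)
    (R : AddPoly 𝓀[F]) (m : ℕ) (α β γ : Fbar) (σ : Fbar ≃ₐ[F] Fbar) : Fbar :=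
  σ γ - γ - evalF p R.e (liftCoeffs F Fbar R) β (bSigma m α β σ)

end Galois

variable {Fbar} in
/-- `P ∈ 𝔭[x]`. -/
def CoeffsInMax (P : Polynomial Fbar) : Prop := ∀ n, valuation Fbar (P.coeff n) < 1

variable {Fbar} in
/-- `P ∈ 𝔭[x,y]`. -/
def CoeffsInMax₂ (P : MvPolynomial (Fin 2) Fbar) : Prop := ∀ s, valuation Fbar (P.coeff s) < 1

section Conditions

variable {F Fbar} [TopologicalSpace F] [IsNonarchimedeanLocalField F]

open Polynomial in
/-- The first set of congruence conditions on `β` and `γ`. All of them hold automatically if `F`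
has characteristic `p`. -/
structure CongruenceConditions₁ (p : ℕ) (R : AddPoly 𝓀[F]) (β γ : Fbar) : Prop where
  /-- `β^{p^e} (Ẽ(β + x) - Ẽ(β) - Ẽ(x)) ∈ 𝔭[x]` -/
  E_add : CoeffsInMax (C β ^ p ^ R.e *
    (evalE p R.e (fun i => C (liftCoeffs F Fbar R i)) (C β + X)
      - evalE p R.e (fun i => C (liftCoeffs F Fbar R i)) (C β)
      - evalE p R.e (fun i => C (liftCoeffs F Fbar R i)) X))
  /-- `β (R̃(β + x) - R̃(β) - R̃(x)) ∈ 𝔭[x]` -/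
  R_add : CoeffsInMax (C β *
    (evalR p R.e (fun i => C (liftCoeffs F Fbar R i)) (C β + X)
      - evalR p R.e (fun i => C (liftCoeffs F Fbar R i)) (C β)
      - evalR p R.e (fun i => C (liftCoeffs F Fbar R i)) X))
  /-- `f̃(β, x)^p - f̃(β, x) + β^{p^e} Ẽ(x) - x R̃(β) - β R̃(x) ∈ 𝔭[x]` -/
  f_pow : CoeffsInMax
    (evalF p R.e (fun i => C (liftCoeffs F Fbar R i)) (C β) X ^ p
      - evalF p R.e (fun i => C (liftCoeffs F Fbar R i)) (C β) X
      + C β ^ p ^ R.e * evalE p R.e (fun i => C (liftCoeffs F Fbar R i)) X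
      - X * evalR p R.e (fun i => C (liftCoeffs F Fbar R i)) (C β)
      - C β * evalR p R.e (fun i => C (liftCoeffs F Fbar R i)) X)
  /-- `(γ + f̃(β, y) + x)^p - γ^p - f̃(β, y)^p - x^p ∈ 𝔭[x,y]` (with `x = X 0`, `y = X 1`) -/
  γ_pow : CoeffsInMax₂
    ((MvPolynomial.C γ
        + evalF p R.e (fun i => MvPolynomial.C (liftCoeffs F Fbar R i)) (MvPolynomial.C β)
            (MvPolynomial.X 1)
        + MvPolynomial.X 0) ^ p
      - MvPolynomial.C γ ^ p
      - evalF p R.e (fun i => MvPolynomial.C (liftCoeffs F Fbar R i)) (MvPolynomial.C β)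
            (MvPolynomial.X 1) ^ p
      - MvPolynomial.X 0 ^ p)

open Polynomial in
/-- The second set of congruence conditions on `β`. All of them hold automatically if `F` has
characteristic `p`. -/
structure CongruenceConditions₂ (p : ℕ) (R : AddPoly 𝓀[F]) (β : Fbar) : Prop where
  /-- `(x + β)^{p^i} - x^{p^i} - β^{p^i} ∈ 𝔭[x]` for `1 ≤ i ≤ e - 1` -/
  pow_add : ∀ i, 1 ≤ i → i < R.e → CoeffsInMax ((X + C β) ^ p ^ i - X ^ p ^ i - C β ^ p ^ i)
  /-- `f̃(β, x + y) - f̃(β, x) - f̃(β, y) ∈ 𝔭[x,y]` -/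
  f_add : CoeffsInMax₂
    (evalF p R.e (fun i => MvPolynomial.C (liftCoeffs F Fbar R i)) (MvPolynomial.C β)
        (MvPolynomial.X 0 + MvPolynomial.X 1)
      - evalF p R.e (fun i => MvPolynomial.C (liftCoeffs F Fbar R i)) (MvPolynomial.C β)
        (MvPolynomial.X 0)
      - evalF p R.e (fun i => MvPolynomial.C (liftCoeffs F Fbar R i)) (MvPolynomial.C β)
        (MvPolynomial.X 1))

end Conditions

/-- The field `F^ur(α^m, β, γ)`. -/
noncomputable def fieldL (m : ℕ) (α β γ : Fbar) : IntermediateField F Fbar :=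
  maxUnramified F Fbar ⊔ IntermediateField.adjoin F {α ^ m, β, γ}

end LocalField

/-!
Why the theorem holds. Let `v` be the valuation of `F̄` and `N = d_{R,m} p^{2e+1}`.

*Cocycle.* Since `F` is complete, `v` is invariant under `Gal(F̄/F)`: it is equivalent to the
spectral norm (`valuation_algEquiv`). For `σ` in `Gal(F̄/F)`, applying `σ` to the equations defining
`α`, `β`, `γ` shows that `a_σ^m` is a root of unity of order dividing `d_{R,m}`, that
`Ẽ(β + b_σ) = Ẽ(β)`, and that `γ + f̃(β, b_σ) + c_σ` solves the Artin–Schreier equation attached to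
`β + b_σ`. By the congruence conditions these are, up to elements of the maximal ideal, the equations
defining `Q_{R,m}`, and `σ ↦ (ā_σ^m, b̄_σ, c̄_σ)` is a cocycle. Together with the action on the residue
field `𝔽` it defines a homomorphism `galHom` from `Gal(F̄/F)` to `Q_{R,m} ⋊ Gal(𝔽/𝔽_q)`.

*Kernel.* The same congruences, applied to elements of the maximal ideal, show that `b_σ ≡ 0` forces
`b_σ = 0`, and then `c_σ ≡ 0` forces `c_σ = 0`. An automorphism acts trivially on `𝔽` exactly if it
fixes `F^ur`, as `F^ur` is generated by the roots of unity of order prime to `p`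
(`maxUnramified_eq`). Hence the kernel of `galHom` is `Gal(F̄/L)` (`ker_galHom`). It is normal, so
`L/F` is Galois; and `Gal(L/F^ur)` embeds into `Q_{R,m}`, which has at most `N` elements as its
coordinates are roots of polynomials (`finite_sub_and_card_le`).

*Degree.* The equations give `v(α)`, `v(β)` and `v(γ)` as rational powers of `v(ϖ)`; products of powers
of `α^m`, `γ` and `ϖ` include an element `π` of `L` with `v(π)^N = v(ϖ)`
(`exists_uniformizer_fieldL`). The values on `F^ur` being powers of `v(ϖ)`, the elements
`1, π, …, π^{N-1}` are linearly independent over `F^ur`. So `[L : F^ur] = N`, the extension is totally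
ramified, and `Gal(L/F^ur)` is all of `Q_{R,m}` (`exists_toQR_eq`).

*Weil group.* Every automorphism of `𝔽` lifts to `F̄` (`residueAut_surjective`) and Frobenius has
infinite order (`frob_zpow_injective`), so restricting to the automorphisms that act on `𝔽` as an
integral power of Frobenius yields the isomorphism (`exists_weilGroup_mulEquiv`).
-/

set_option linter.unusedSectionVars false

/-! ### The valuation of the separable closure -/

namespace LocalFieldExt

section ValuativeExtension

variable (F : Type*) [Field F] [ValuativeRel F]
  {Fbar : Type*} [Field Fbar] [Algebra F Fbar] [ValuativeRel Fbar] [ValuativeExtension F Fbar]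

theorem valuation_algebraMap_le_iff (x y : F) :
    valuation Fbar (algebraMap F Fbar x) ≤ valuation Fbar (algebraMap F Fbar y) ↔
      valuation F x ≤ valuation F y := by
  rw [← Valuation.Compatible.vle_iff_le, ← Valuation.Compatible.vle_iff_le,
    ValuativeExtension.vle_iff_vle]

theorem valuation_algebraMap_lt_iff (x y : F) :
    valuation Fbar (algebraMap F Fbar x) < valuation Fbar (algebraMap F Fbar y) ↔
      valuation F x < valuation F y := by
  rw [← not_le, ← not_le, valuation_algebraMap_le_iff]

theorem valuation_algebraMap_le_one_iff (x : F) :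
    valuation Fbar (algebraMap F Fbar x) ≤ 1 ↔ valuation F x ≤ 1 := by
  simpa using valuation_algebraMap_le_iff F (Fbar := Fbar) x 1

theorem valuation_algebraMap_lt_one_iff (x : F) :
    valuation Fbar (algebraMap F Fbar x) < 1 ↔ valuation F x < 1 := by
  simpa using valuation_algebraMap_lt_iff F (Fbar := Fbar) x 1

theorem valuation_le_one_of_isIntegral {x : Fbar} {P : Polynomial F} (hP : P.Monic)
    (hc : ∀ i, valuation F (P.coeff i) ≤ 1) (hx : Polynomial.aeval x P = 0) :
    valuation Fbar x ≤ 1 := by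
  by_contra! h
  have hlt : valuation Fbar (∑ i ∈ Finset.range P.natDegree, P.coeff i • x ^ i) <
      valuation Fbar x ^ P.natDegree := by
    refine Valuation.map_sum_lt _ (pow_ne_zero _ (zero_lt_one.trans h).ne') fun i hi => ?_
    rw [Algebra.smul_def, map_mul, map_pow]
    calc _ ≤ 1 * valuation Fbar x ^ i := by
          gcongr
          exact (valuation_algebraMap_le_one_iff F _).mpr (hc i)
      _ < _ := by
          rw [one_mul]
          exact pow_lt_pow_right₀ h (Finset.mem_range.mp hi)
  rw [Polynomial.aeval_eq_sum_range, Finset.sum_range_succ, hP.coeff_natDegree, one_smul,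
    add_eq_zero_iff_eq_neg] at hx
  rw [hx, Valuation.map_neg, map_pow] at hlt
  exact lt_irrefl _ hlt

end ValuativeExtension

section Invariance

variable (F : Type*) [Field F] [ValuativeRel F] [TopologicalSpace F] [IsNonarchimedeanLocalField F]
  {Fbar : Type*} [Field Fbar] [Algebra F Fbar] [ValuativeRel Fbar] [ValuativeExtension F Fbar]
  [Algebra.IsAlgebraic F Fbar]

open scoped Valued in
/-- The valuation of `F̄` is equivalent to a real absolute value which is invariant under the
automorphisms of `F̄/F`: the spectral norm, `F` being complete. The valuation ring of `F̄` contains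
that of the spectral norm, which is the integral closure of `𝒪[F]`; the latter has rank one, so the
two coincide. -/
theorem exists_absoluteValue :
    ∃ N : Fbar → ℝ, (∀ x y, N (x * y) = N x * N y) ∧ (∀ x, x ≠ 0 → 0 < N x) ∧
      (∀ (σ : Fbar ≃ₐ[F] Fbar) x, N (σ x) = N x) ∧
      ∀ x y, N x ≤ N y ↔ valuation Fbar x ≤ valuation Fbar y := by
  let := IsTopologicalAddGroup.rightUniformSpace F
  have := isUniformAddGroup_of_addCommGroup (G := F)
  let : (Valued.v (R := F) (Γ₀ := ValueGroupWithZero F)).RankOne :=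
  { hom' := IsRankLeOne.nonempty.some.emb (R := F).comp MonoidWithZeroHom.ValueGroup₀.embedding
    strictMono' := IsRankLeOne.nonempty.some.strictMono.comp
        MonoidWithZeroHom.ValueGroup₀.embedding_strictMono }
  have hc : CompleteSpace F := inferInstance
  let nn : NontriviallyNormedField F := inferInstance
  have hle : ∀ x : F, ‖x‖ ≤ 1 ↔ valuation F x ≤ 1 := fun x => by
    rw [Valued.toNormedField.norm_le_one_iff]
    rfl
  have : IsUltrametricDist F := inferInstance
  have : CompleteSpace F := hc
  let S := spectralMulAlgNorm F Fbar
  have h1 : ∀ x : Fbar, S x ≤ 1 → valuation Fbar x ≤ 1 := by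
    intro x hx
    have hint : IsIntegral F x := Algebra.IsIntegral.isIntegral x
    refine valuation_le_one_of_isIntegral F (minpoly.monic hint) (fun i => ?_) (minpoly.aeval F x)
    rw [← hle]
    exact (spectralValue_le_one_iff (minpoly.monic hint)).mp hx i
  obtain ⟨t, ht0, ht1⟩ := Valuation.IsNontrivial.exists_lt_one (v := valuation F)
  have ht0' : t ≠ 0 := by simpa using ht0
  have hS0 : ∀ x : Fbar, x ≠ 0 → 0 < S x := fun x hx =>
    spectralNorm_zero_lt hx (Algebra.IsAlgebraic.isAlgebraic x)
  have htv : valuation Fbar (algebraMap F Fbar t) < 1 :=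
    (valuation_algebraMap_lt_one_iff F t).mpr ht1
  have htb : algebraMap F Fbar t ≠ 0 := by simpa using ht0'
  have h2 : ∀ x : Fbar, valuation Fbar x ≤ 1 → S x ≤ 1 := by
    intro x hx
    by_contra! hcon
    have hx0 : x ≠ 0 := by
      rintro rfl
      rw [map_zero] at hcon
      exact absurd hcon (by norm_num)
    obtain ⟨n, hn⟩ := exists_pow_lt_of_lt_one (hS0 _ htb) (inv_lt_one_of_one_lt₀ hcon)
    have h3 : S (x⁻¹ ^ n * (algebraMap F Fbar t)⁻¹) ≤ 1 := by
      rw [map_mul, map_pow, map_inv₀, map_inv₀]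
      rw [← div_eq_mul_inv, div_le_one (hS0 _ htb)]
      exact hn.le
    have h4 := h1 _ h3
    rw [map_mul, map_pow, map_inv₀, map_inv₀, ← div_eq_mul_inv,
      div_le_one₀ (zero_lt_iff.mpr (by simpa using htb))] at h4
    have h5 : valuation Fbar x ≠ 0 := by simpa using hx0
    have h6 : (1 : ValueGroupWithZero Fbar) ≤ (valuation Fbar x)⁻¹ :=
      (one_le_inv₀ (zero_lt_iff.mpr h5)).mpr hx
    exact absurd (lt_of_le_of_lt (one_le_pow_of_one_le' h6 n |>.trans h4) htv) (lt_irrefl _)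
  refine ⟨S, map_mul S, hS0, fun σ x => (spectralNorm_eq_of_equiv σ x).symm, fun x y => ?_⟩
  rcases eq_or_ne y 0 with rfl | hy
  · rw [(valuation Fbar).map_zero, le_zero_iff, (valuation Fbar).zero_iff]
    constructor
    · intro h
      by_contra hx
      exact absurd (hS0 x hx) (not_lt.mpr (h.trans_eq (map_zero S)))
    · rintro rfl
      exact le_rfl
  · rw [← div_le_one (hS0 y hy), ← map_div₀,
      ← div_le_one₀ (zero_lt_iff.mpr ((valuation Fbar).ne_zero_iff.mpr hy)), ← map_div₀]
    exact ⟨h1 _, h2 _⟩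

variable {F}

theorem valuation_algEquiv (σ : Fbar ≃ₐ[F] Fbar) (x : Fbar) :
    valuation Fbar (σ x) = valuation Fbar x := by
  obtain ⟨N, -, -, hσ, hN⟩ := exists_absoluteValue F (Fbar := Fbar)
  exact le_antisymm ((hN _ _).mp (hσ σ x).le) ((hN _ _).mp (hσ σ x).ge)

end Invariance

/-- The valuation of `F̄` has rank one. -/
theorem exists_pow_valuation_lt (F : Type*) [Field F] [ValuativeRel F] [TopologicalSpace F]
    [IsNonarchimedeanLocalField F] {Fbar : Type*} [Field Fbar] [Algebra F Fbar] [ValuativeRel Fbar]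
    [ValuativeExtension F Fbar] [Algebra.IsAlgebraic F Fbar] {t x : Fbar}
    (ht : valuation Fbar t < 1) (hx : x ≠ 0) :
    ∃ n : ℕ, valuation Fbar t ^ n < valuation Fbar x := by
  obtain ⟨N, hmul, hpos, -, hN⟩ := exists_absoluteValue F (Fbar := Fbar)
  have h1 : N 1 = 1 := by
    have := hmul 1 1
    rw [mul_one] at this
    exact (mul_eq_left₀ (hpos 1 one_ne_zero).ne').mp this.symm
  have hpow : ∀ n, N (t ^ n) = N t ^ n := by
    intro n
    induction n with
    | zero => simp [h1]
    | succ n ih => rw [pow_succ, hmul, ih, pow_succ]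
  have hlt : N t < 1 := by
    rw [← h1]
    by_contra! h
    rw [hN, map_one] at h
    exact absurd ht (not_lt.mpr h)
  obtain ⟨n, hn⟩ := exists_pow_lt_of_lt_one (hpos x hx) hlt
  refine ⟨n, ?_⟩
  rw [← map_pow]
  by_contra! h
  rw [← hN, hpow] at h
  exact absurd hn (not_lt.mpr h)

/-! ### The action on the residue field -/

section Residue

variable {K : Type*} [Field K] [ValuativeRel K]

theorem residue_eq_iff (x y : 𝒪[K]) :
    IsLocalRing.residue 𝒪[K] x = IsLocalRing.residue 𝒪[K] y ↔ valuation K (x - y : K) < 1 := by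
  rw [← sub_eq_zero, ← map_sub, IsLocalRing.residue_eq_zero_iff, IsLocalRing.mem_maximalIdeal,
    mem_nonunits_iff, Valuation.Integers.isUnit_iff_valuation_eq_one
      (Valuation.integer.integers (valuation K))]
  exact ⟨fun h => lt_of_le_of_ne (x - y).2 h, ne_of_lt⟩

theorem residue_eq_zero_iff (x : 𝒪[K]) :
    IsLocalRing.residue 𝒪[K] x = 0 ↔ valuation K (x : K) < 1 := by
  simpa using residue_eq_iff x 0

end Residue

section Action

variable {F : Type*} [Field F] [ValuativeRel F] [TopologicalSpace F] [IsNonarchimedeanLocalField F]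
  {Fbar : Type*} [Field Fbar] [Algebra F Fbar] [ValuativeRel Fbar] [ValuativeExtension F Fbar]
  [Algebra.IsAlgebraic F Fbar]

theorem algEquiv_mem_integer (σ : Fbar ≃ₐ[F] Fbar) {x : Fbar} (hx : x ∈ 𝒪[Fbar]) :
    σ x ∈ 𝒪[Fbar] := by
  rw [Valuation.mem_integer_iff, valuation_algEquiv]
  exact hx

/-- The automorphism of `𝒪[F̄]` induced by an automorphism of `F̄/F`. -/
def integerAut (σ : Fbar ≃ₐ[F] Fbar) : 𝒪[Fbar] ≃ₐ[𝒪[F]] 𝒪[Fbar] where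
  toFun x := ⟨σ x, algEquiv_mem_integer σ x.2⟩
  invFun x := ⟨σ.symm x, algEquiv_mem_integer σ.symm x.2⟩
  left_inv _ := Subtype.ext (σ.symm_apply_apply _)
  right_inv _ := Subtype.ext (σ.apply_symm_apply _)
  map_mul' _ _ := Subtype.ext (map_mul σ _ _)
  map_add' _ _ := Subtype.ext (map_add σ _ _)
  commutes' x := Subtype.ext (σ.commutes x.1)

/-- The action of the automorphisms of `F̄/F` on the residue field of `F̄`. -/
noncomputable def residueAut : (Fbar ≃ₐ[F] Fbar) →* (𝓀[Fbar] ≃ₐ[𝓀[F]] 𝓀[Fbar]) where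
  toFun σ := IsLocalRing.ResidueField.mapAlgEquiv' (integerAut σ)
  map_one' := by
    ext z
    obtain ⟨x, rfl⟩ := IsLocalRing.residue_surjective z
    rfl
  map_mul' σ τ := by
    ext z
    obtain ⟨x, rfl⟩ := IsLocalRing.residue_surjective z
    rfl

theorem residueAut_residue (σ : Fbar ≃ₐ[F] Fbar) (x : Fbar) (hx : x ∈ 𝒪[Fbar]) :
    residueAut σ (IsLocalRing.residue 𝒪[Fbar] ⟨x, hx⟩) =
      IsLocalRing.residue 𝒪[Fbar] ⟨σ x, algEquiv_mem_integer σ hx⟩ := rfl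

instance : IsInvariantSubring (Fbar ≃ₐ[F] Fbar) 𝒪[Fbar] where
  smul_mem σ _ hx := algEquiv_mem_integer σ hx

instance : SMulCommClass (Fbar ≃ₐ[F] Fbar) 𝒪[F] 𝒪[Fbar] where
  smul_comm σ a x := Subtype.ext (by
    rw [Algebra.smul_def, Algebra.smul_def]
    change σ ((algebraMap 𝒪[F] 𝒪[Fbar] a : Fbar) * x) = (algebraMap 𝒪[F] 𝒪[Fbar] a : Fbar) * σ x
    rw [map_mul]
    congr 1
    exact σ.commutes a.1)

/-- Every automorphism of the residue field lifts to `F̄`, since `𝒪[F]` is the ring of invariants of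
the profinite group `Gal(F̄/F)` acting on `𝒪[F̄]`. -/
theorem residueAut_surjective [IsGalois F Fbar] :
    Function.Surjective (residueAut : (Fbar ≃ₐ[F] Fbar) →* _) := by
  let : TopologicalSpace 𝒪[Fbar] := ⊥
  have : DiscreteTopology 𝒪[Fbar] := ⟨rfl⟩
  have : ContinuousSMul (Fbar ≃ₐ[F] Fbar) 𝒪[Fbar] := by
    rw [continuousSMul_iff_stabilizer_isOpen]
    intro x
    convert stabilizer_isOpen_of_isIntegral (K := F) (x : Fbar) using 2
    ext σ
    exact Subtype.ext_iff
  have : Algebra.IsInvariant 𝒪[F] 𝒪[Fbar] (Fbar ≃ₐ[F] Fbar) := by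
    constructor
    intro b hb
    have hb' : (b : Fbar) ∈ (⊥ : IntermediateField F Fbar) := by
      rw [InfiniteGalois.mem_bot_iff_fixed]
      exact fun σ => congrArg Subtype.val (hb σ)
    obtain ⟨a, ha⟩ := IntermediateField.mem_bot.mp hb'
    refine ⟨⟨a, ?_⟩, Subtype.ext ha⟩
    rw [Valuation.mem_integer_iff, ← valuation_algebraMap_le_one_iff F (Fbar := Fbar), ha]
    exact b.2
  intro s
  obtain ⟨σ, hσ⟩ := Ideal.Quotient.stabilizerHom_surjective_of_profinite
    (G := Fbar ≃ₐ[F] Fbar) 𝓂[F] 𝓂[Fbar] s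
  refine ⟨σ.1, ?_⟩
  rw [← hσ]
  ext z
  obtain ⟨x, rfl⟩ := IsLocalRing.residue_surjective z
  rfl

end Action

end LocalFieldExt

/-! ### Roots of unity of order prime to the residue characteristic -/

namespace LocalFieldExt

section RootsOfUnity

variable {K : Type*} [Field K] [ValuativeRel K] {p : ℕ}

/-- The roots of unity of order prime to `p` in `K`. -/
def tameRoots (p : ℕ) (K : Type*) [Field K] : Set K := {ζ | ∃ N, 0 < N ∧ N.Coprime p ∧ ζ ^ N = 1}

theorem valuation_eq_one_of_mem_tameRoots {ζ : K} (hζ : ζ ∈ tameRoots p K) :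
    valuation K ζ = 1 := by
  obtain ⟨N, hN, -, h⟩ := hζ
  have := congrArg (valuation K) h
  rw [map_pow, map_one] at this
  exact (pow_eq_one_iff_of_nonneg zero_le hN.ne').mp this

theorem valuation_natCast_eq_one [Fact p.Prime] [CharP 𝓀[K] p] {N : ℕ} (hN : N.Coprime p) :
    valuation K (N : K) = 1 := by
  have h1 : ((N : 𝒪[K]) : K) = (N : K) := by simp
  have hle : valuation K (N : K) ≤ 1 := by rw [← h1]; exact (N : 𝒪[K]).2
  refine le_antisymm hle (not_lt.mp fun h => ?_)
  rw [← h1, ← residue_eq_zero_iff, map_natCast, CharP.cast_eq_zero_iff 𝓀[K] p] at h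
  have := Nat.eq_one_of_dvd_coprimes hN h dvd_rfl
  exact (Fact.out : p.Prime).ne_one this

/-- Reduction is injective on the roots of unity of order prime to `p`. -/
theorem tameRoots_eq_of_valuation_sub_lt_one [Fact p.Prime] [CharP 𝓀[K] p] {ζ ξ : K}
    (hζ : ζ ∈ tameRoots p K) (hξ : ξ ∈ tameRoots p K) (h : valuation K (ζ - ξ) < 1) : ζ = ξ := by
  have hvζ := valuation_eq_one_of_mem_tameRoots hζ
  have hvξ := valuation_eq_one_of_mem_tameRoots hξ
  obtain ⟨N, hN0, hN, hN1⟩ := hζ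
  obtain ⟨M, hM0, hM, hM1⟩ := hξ
  have hNM : (N * M).Coprime p := Nat.Coprime.mul_left hN hM
  have h1 : ζ ^ (N * M) = 1 := by rw [pow_mul, hN1, one_pow]
  have h2 : ξ ^ (N * M) = 1 := by rw [mul_comm, pow_mul, hM1, one_pow]
  have h3 := (Commute.all ζ ξ).geom_sum₂_mul (N * M)
  rw [h1, h2, sub_self] at h3
  rcases mul_eq_zero.mp h3 with h4 | h4
  · exfalso
    -- modulo the maximal ideal the geometric sum is `(N * M) ζ ^ (N * M - 1)`
    have hi : ∀ i ∈ Finset.range (N * M),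
        IsLocalRing.residue 𝒪[K] (⟨ζ, hvζ.le⟩ ^ i * ⟨ξ, hvξ.le⟩ ^ (N * M - 1 - i)) =
          IsLocalRing.residue 𝒪[K] ⟨ζ, hvζ.le⟩ ^ (N * M - 1) := by
      intro i hi
      have := Finset.mem_range.mp hi
      rw [map_mul, map_pow, map_pow, ← (residue_eq_iff ⟨ζ, hvζ.le⟩ ⟨ξ, hvξ.le⟩).mpr h, ← pow_add]
      congr 1
      omega
    have h5 : (∑ i ∈ Finset.range (N * M),
        (⟨ζ, hvζ.le⟩ : 𝒪[K]) ^ i * ⟨ξ, hvξ.le⟩ ^ (N * M - 1 - i)) = 0 := by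
      apply Subtype.ext
      simpa using h4
    have h6 := congrArg (IsLocalRing.residue 𝒪[K]) h5
    rw [map_sum, Finset.sum_congr rfl hi, Finset.sum_const, Finset.card_range, nsmul_eq_mul,
      map_zero] at h6
    rcases mul_eq_zero.mp h6 with h7 | h7
    · rw [← map_natCast (IsLocalRing.residue 𝒪[K]), residue_eq_zero_iff] at h7
      have h8 := valuation_natCast_eq_one (K := K) hNM
      simp only [SubringClass.coe_natCast] at h7
      exact h7.ne h8
    · have h8 := eq_zero_of_pow_eq_zero h7
      rw [residue_eq_zero_iff] at h8
      exact h8.ne hvζ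
  · exact sub_eq_zero.mp h4

theorem exists_pow_eq_one_of_isAlgebraic {k 𝔽 : Type*} [Field k] [Finite k] [Field 𝔽]
    [Algebra k 𝔽] [Algebra.IsAlgebraic k 𝔽] (p : ℕ) [Fact p.Prime] [CharP 𝔽 p] {z : 𝔽}
    (hz : z ≠ 0) : ∃ N, 0 < N ∧ N.Coprime p ∧ z ^ N = 1 := by
  let E := IntermediateField.adjoin k {z}
  have : FiniteDimensional k E :=
    IntermediateField.adjoin.finiteDimensional (Algebra.IsIntegral.isIntegral z)
  have : Finite E := Module.finite_of_finite k
  let := Fintype.ofFinite E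
  have : CharP E p := (algebraMap E 𝔽).charP (algebraMap E 𝔽).injective p
  obtain ⟨n, hp, hn⟩ := FiniteField.card E p
  have h1 : 1 < p ^ (n : ℕ) := Nat.one_lt_pow n.2.ne' hp.one_lt
  refine ⟨p ^ (n : ℕ) - 1, by omega, ?_, ?_⟩
  · refine Nat.Coprime.symm ((Nat.Prime.coprime_iff_not_dvd hp).mpr fun h => ?_)
    have h2 : p ∣ p ^ (n : ℕ) := dvd_pow_self p n.2.ne'
    have h3 := (Nat.dvd_sub h2 h)
    rw [Nat.sub_sub_self h1.le] at h3
    exact hp.one_lt.ne' (Nat.dvd_one.mp h3)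
  · have hz' : (⟨z, IntermediateField.mem_adjoin_simple_self k z⟩ : E) ≠ 0 := fun h =>
      hz (congrArg Subtype.val h)
    have h2 := FiniteField.pow_card_sub_one_eq_one _ hz'
    rw [hn] at h2
    exact congrArg Subtype.val h2

/-- Every nonzero residue class is the reduction of a root of unity of order prime to `p`. -/
theorem exists_tameRoots_residue_eq [Fact p.Prime] [CharP 𝓀[K] p] [IsSepClosed K]
    {z : 𝓀[K]} (hz : ∃ N, 0 < N ∧ N.Coprime p ∧ z ^ N = 1) :
    ∃ (ζ : K) (hζ : ζ ∈ 𝒪[K]), ζ ∈ tameRoots p K ∧ IsLocalRing.residue 𝒪[K] ⟨ζ, hζ⟩ = z := by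
  obtain ⟨N, hN0, hN, hz⟩ := hz
  have hNK : NeZero (N : K) := ⟨fun h => by
    have := valuation_natCast_eq_one (K := K) hN
    rw [h, map_zero] at this
    exact zero_ne_one this⟩
  obtain ⟨ζ, hζ⟩ := HasEnoughRootsOfUnity.exists_primitiveRoot K N
  have hmem : ∀ i, ζ ^ i ∈ tameRoots p K := fun i =>
    ⟨N, hN0, hN, by rw [← pow_mul, mul_comm, pow_mul, hζ.pow_eq_one, one_pow]⟩
  have hv : ζ ∈ 𝒪[K] := by
    rw [Valuation.mem_integer_iff, valuation_eq_one_of_mem_tameRoots (by simpa using hmem 1)]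
  have hprim : IsPrimitiveRoot (IsLocalRing.residue 𝒪[K] ⟨ζ, hv⟩) N := by
    refine ⟨?_, fun l hl => hζ.dvd_of_pow_eq_one l ?_⟩
    · rw [← map_pow, ← map_one (IsLocalRing.residue 𝒪[K])]
      congr 1
      exact Subtype.ext hζ.pow_eq_one
    · rw [← map_pow, ← map_one (IsLocalRing.residue 𝒪[K]), residue_eq_iff] at hl
      exact tameRoots_eq_of_valuation_sub_lt_one (p := p) (hmem l) (by simpa using hmem 0)
        (by simpa using hl)
  have : NeZero N := ⟨hN0.ne'⟩
  obtain ⟨i, -, hi⟩ := hprim.eq_pow_of_pow_eq_one hz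
  refine ⟨ζ ^ i, 𝒪[K].pow_mem hv i, hmem i, ?_⟩
  rw [← hi, ← map_pow]
  rfl

end RootsOfUnity

theorem algEquiv_mem_tameRoots {K : Type*} [Field K] {p : ℕ} {k : Type*} [Field k] [Algebra k K]
    (σ : K ≃ₐ[k] K) {ζ : K}
    (h : ζ ∈ tameRoots p K) : σ ζ ∈ tameRoots p K := by
  obtain ⟨N, h0, h1, h2⟩ := h
  exact ⟨N, h0, h1, by rw [← map_pow, h2, map_one]⟩

/-! ### The maximal unramified extension -/

theorem mem_fixingSubgroup_adjoin_iff {k K : Type*} [Field k] [Field K] [Algebra k K] (S : Set K)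
    (σ : K ≃ₐ[k] K) :
    σ ∈ (IntermediateField.adjoin k S).fixingSubgroup ↔ ∀ x ∈ S, σ x = x := by
  rw [IntermediateField.mem_fixingSubgroup_iff]
  refine ⟨fun h x hx => h x (IntermediateField.subset_adjoin k S hx), fun h => ?_⟩
  have h1 : IntermediateField.adjoin k S ≤ IntermediateField.fixedField (Subgroup.zpowers σ) := by
    rw [IntermediateField.adjoin_le_iff]
    rintro x hx ⟨τ, hτ⟩
    exact (Subgroup.zpowers_le (H := MulAction.stabilizer (K ≃ₐ[k] K) x)).mpr (h x hx) hτ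
  exact fun x hx => h1 hx ⟨σ, Subgroup.mem_zpowers σ⟩

section Unramified

variable {Fbar : Type*} [Field Fbar] [ValuativeRel Fbar] {p : ℕ} [Fact p.Prime] [CharP 𝓀[Fbar] p]

/-- Adjoining a root of unity `ζ` of order prime to `p` does not change the value group. The
conjugates of `ζ` have distinct reductions, so a nonzero polynomial of degree smaller than the
degree of `ζ` cannot vanish at all of these: the value at `ζ` of a polynomial of small degree is
attained by one of its coefficients. -/
theorem exists_valuation_eq_of_mem_adjoin_simple {K : Type*} [Field K] [Algebra K Fbar]
    [IsGalois K Fbar] (hinv : ∀ (σ : Fbar ≃ₐ[K] Fbar) x, valuation Fbar (σ x) = valuation Fbar x)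
    {ζ : Fbar} (hζ : ζ ∈ tameRoots p Fbar) {x : Fbar}
    (hx : x ∈ IntermediateField.adjoin K {ζ}) :
    ∃ y : K, valuation Fbar x = valuation Fbar (algebraMap K Fbar y) := by
  have hint : IsIntegral K ζ := Algebra.IsIntegral.isIntegral ζ
  rw [← IntermediateField.mem_toSubalgebra,
    IntermediateField.adjoin_simple_toSubalgebra_of_isAlgebraic hint.isAlgebraic,
    Algebra.adjoin_singleton_eq_range_aeval] at hx
  obtain ⟨g, rfl⟩ := hx
  set h := g %ₘ minpoly K ζ with hh
  have hg : Polynomial.aeval ζ g = Polynomial.aeval ζ h :=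
    (Polynomial.aeval_modByMonic_eq_self_of_root (minpoly.aeval K ζ)).symm
  change ∃ y : K, valuation Fbar (Polynomial.aeval ζ g) = _
  rw [hg]
  rcases eq_or_ne h 0 with h0 | h0
  · exact ⟨0, by simp [h0]⟩
  obtain ⟨n, hn, hmax⟩ := h.support.exists_max_image
    (fun i => valuation Fbar (algebraMap K Fbar (h.coeff i))) (Polynomial.support_nonempty.mpr h0)
  set c := h.coeff n with hc
  have hc0 : c ≠ 0 := Polynomial.mem_support_iff.mp hn
  have hvc : valuation Fbar (algebraMap K Fbar c) ≠ 0 := by simpa using hc0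
  refine ⟨c, ?_⟩
  have hcoef : ∀ i, algebraMap K Fbar (c⁻¹ * h.coeff i) ∈ 𝒪[Fbar] := by
    intro i
    rw [Valuation.mem_integer_iff, map_mul, map_mul, map_inv₀, map_inv₀]
    by_cases hi : h.coeff i = 0
    · simp [hi]
    · rw [inv_mul_le_one₀ (zero_lt_iff.mpr hvc)]
      exact hmax i (Polynomial.mem_support_iff.mpr hi)
  obtain ⟨T, hT⟩ : ∃ T : Polynomial 𝒪[Fbar], T.map (algebraMap 𝒪[Fbar] Fbar) =
      (Polynomial.C c⁻¹ * h).map (algebraMap K Fbar) := by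
    have : (Polynomial.C c⁻¹ * h).map (algebraMap K Fbar) ∈
        Polynomial.lifts (algebraMap 𝒪[Fbar] Fbar) := by
      rw [Polynomial.lifts_iff_coeff_lifts]
      intro i
      refine ⟨⟨_, hcoef i⟩, ?_⟩
      rw [Polynomial.coeff_map, Polynomial.coeff_C_mul]
      rfl
    simpa [Polynomial.mem_lifts] using this
  have hev : ∀ y : 𝒪[Fbar], ((T.eval y : 𝒪[Fbar]) : Fbar) =
      algebraMap K Fbar c⁻¹ * Polynomial.aeval (y : Fbar) h := by
    intro y
    have h1 := Polynomial.eval_map_algebraMap (B := Fbar) T (y : Fbar)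
    rw [hT, Polynomial.eval_map_algebraMap, map_mul, Polynomial.aeval_C] at h1
    rw [h1]
    exact (Polynomial.aeval_algebraMap_apply_eq_algebraMap_eval y T).symm
  have hvζ : ζ ∈ 𝒪[Fbar] := (valuation_eq_one_of_mem_tameRoots hζ).le
  suffices hsuf : valuation Fbar ((T.eval ⟨ζ, hvζ⟩ : 𝒪[Fbar]) : Fbar) = 1 by
    rw [hev, map_mul, map_inv₀, map_inv₀, inv_mul_eq_one₀ hvc] at hsuf
    exact hsuf.symm
  refine le_antisymm (T.eval ⟨ζ, hvζ⟩ : 𝒪[Fbar]).2 (not_lt.mp fun hlt => ?_)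
  have hroot : ∀ y ∈ (minpoly K ζ).rootSet Fbar, ∃ σ : Fbar ≃ₐ[K] Fbar, y = σ ζ := by
    intro y hy
    obtain ⟨σ, hσ⟩ := minpoly.exists_algEquiv_of_root' hint.isAlgebraic
      (Polynomial.aeval_eq_zero_of_mem_rootSet hy)
    exact ⟨σ, hσ.symm⟩
  have htame : ∀ y ∈ (minpoly K ζ).rootSet Fbar, y ∈ tameRoots p Fbar := by
    intro y hy
    obtain ⟨σ, rfl⟩ := hroot y hy
    exact algEquiv_mem_tameRoots σ hζ
  -- the reduction of `T` vanishes at the distinct reductions of all the conjugates of `ζ`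
  have hz : T.map (IsLocalRing.residue 𝒪[Fbar]) = 0 := by
    refine Polynomial.eq_zero_of_natDegree_lt_card_of_eval_eq_zero _
      (ι := (minpoly K ζ).rootSet Fbar)
      (f := fun y => IsLocalRing.residue 𝒪[Fbar]
        ⟨y.1, (valuation_eq_one_of_mem_tameRoots (htame _ y.2)).le⟩) ?_ ?_ ?_
    · intro y z hyz
      rw [residue_eq_iff] at hyz
      exact Subtype.ext (tameRoots_eq_of_valuation_sub_lt_one (htame _ y.2) (htame _ z.2) hyz)
    · rintro ⟨y, hy⟩
      rw [Polynomial.eval_map, Polynomial.eval₂_at_apply, residue_eq_zero_iff]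
      obtain ⟨σ, rfl⟩ := hroot y hy
      rw [hev] at hlt ⊢
      rw [← hinv σ, map_mul σ, ← Polynomial.aeval_algHom_apply, AlgEquiv.commutes] at hlt
      exact hlt
    · rw [Polynomial.card_rootSet_eq_natDegree (Algebra.IsSeparable.isSeparable K ζ)
        (Normal.splits inferInstance ζ)]
      refine lt_of_le_of_lt Polynomial.natDegree_map_le ?_
      have h1 : T.natDegree = h.natDegree := by
        rw [← Polynomial.natDegree_map_eq_of_injective
          (f := algebraMap 𝒪[Fbar] Fbar) Subtype.val_injective, hT,
          Polynomial.natDegree_map, Polynomial.natDegree_C_mul (inv_ne_zero hc0)]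
      rw [h1]
      exact Polynomial.natDegree_modByMonic_lt _ (minpoly.monic hint) (minpoly.ne_one K ζ)
  have h1 : T.coeff n = 1 := by
    apply Subtype.ext
    have := congrArg (fun P => Polynomial.coeff P n) hT
    simp only [Polynomial.coeff_map, Polynomial.coeff_C_mul] at this
    refine this.trans ?_
    rw [← hc, inv_mul_cancel₀ hc0, map_one]
    rfl
  have h2 := congrArg (fun P => Polynomial.coeff P n) hz
  simp [Polynomial.coeff_map, h1] at h2

theorem exists_valuation_eq_of_mem_adjoin {K : Type*} [Field K] [Algebra K Fbar]
    [IsGalois K Fbar] (hinv : ∀ (σ : Fbar ≃ₐ[K] Fbar) x, valuation Fbar (σ x) = valuation Fbar x)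
    {x : Fbar} (hx : x ∈ IntermediateField.adjoin K (tameRoots p Fbar)) :
    ∃ y : K, valuation Fbar x = valuation Fbar (algebraMap K Fbar y) := by
  classical
  obtain ⟨S, hS, hxS⟩ := IntermediateField.exists_finset_of_mem_adjoin hx
  clear hx
  induction S using Finset.induction_on generalizing x with
  | empty =>
    rw [Finset.coe_empty, IntermediateField.adjoin_empty] at hxS
    obtain ⟨y, rfl⟩ := IntermediateField.mem_bot.mp hxS
    exact ⟨y, rfl⟩
  | insert ζ S _ ih =>
    rw [Finset.coe_insert, Set.insert_subset_iff] at hS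
    rw [Finset.coe_insert, Set.insert_eq, Set.union_comm,
      ← IntermediateField.adjoin_adjoin_left, IntermediateField.mem_restrictScalars] at hxS
    obtain ⟨y, hy⟩ := exists_valuation_eq_of_mem_adjoin_simple
      (K := IntermediateField.adjoin K (S : Set Fbar)) (p := p)
      (fun σ z => hinv (σ.restrictScalars K) z) hS.1 hxS
    obtain ⟨z, hz⟩ := ih hS.2 y.2
    exact ⟨z, hy.trans hz⟩

end Unramified

section LocalField

theorem charP_residueField (F : Type*) [Field F] [ValuativeRel F] {Fbar : Type*} [Field Fbar]
    [Algebra F Fbar] [ValuativeRel Fbar] [ValuativeExtension F Fbar] {p : ℕ} [CharP 𝓀[F] p] :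
    CharP 𝓀[Fbar] p :=
  charP_of_injective_algebraMap (algebraMap 𝓀[F] 𝓀[Fbar]).injective p

theorem uniformizer_lt_one {F : Type*} [Field F] [ValuativeRel F] {ϖ : 𝒪[F]} (hϖ : Irreducible ϖ) :
    valuation F (ϖ : F) < 1 := by
  rw [← residue_eq_zero_iff, IsLocalRing.residue_eq_zero_iff]
  exact hϖ.not_isUnit

variable {F : Type*} [Field F] [ValuativeRel F] [TopologicalSpace F] [IsNonarchimedeanLocalField F]
  {Fbar : Type*} [Field Fbar] [Algebra F Fbar] [ValuativeRel Fbar] [ValuativeExtension F Fbar]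

theorem valuation_le_uniformizer {ϖ : 𝒪[F]} (hϖ : Irreducible ϖ) {y : F}
    (hy : valuation F y < 1) : valuation F y ≤ valuation F (ϖ : F) := by
  have h : (⟨y, hy.le⟩ : 𝒪[F]) ∈ 𝓂[F] := by
    rw [← IsLocalRing.residue_eq_zero_iff, residue_eq_zero_iff]
    exact hy
  rw [hϖ.maximalIdeal_eq, Ideal.mem_span_singleton] at h
  obtain ⟨c, hc⟩ := h
  have hc' : y = ϖ * c := congrArg Subtype.val hc
  rw [hc', map_mul]
  exact mul_le_of_le_one_right' c.2

variable [IsGalois F Fbar] [IsSepClosed Fbar] {p : ℕ} [Fact p.Prime] [CharP 𝓀[F] p]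

/-- The maximal unramified extension is generated by the roots of unity of order prime to `p`.
If the value group of `K` is that of `F`, then so is the value group of the extension of `K` by
these roots of unity; hence the elements of `K` are limits of elements of `F(ζ : ζ tame)`, and
they are fixed by the automorphisms fixing this field. -/
theorem maxUnramified_eq :
    maxUnramified F Fbar = IntermediateField.adjoin F (tameRoots p Fbar) := by
  have hchar : CharP 𝓀[Fbar] p := charP_residueField F
  apply le_antisymm
  · refine sSup_le fun K hK x hx => ?_
    obtain ⟨-, hK⟩ := hK
    set F' := IntermediateField.adjoin F (tameRoots p Fbar) with hF'
    set M := IntermediateField.adjoin K (tameRoots p Fbar) with hM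
    obtain ⟨ϖ, hϖ⟩ := IsDiscreteValuationRing.exists_irreducible 𝒪[F]
    set t := algebraMap F Fbar (ϖ : F) with ht
    have hMv : ∀ y ∈ M, ∃ f : F, valuation Fbar y = valuation Fbar (algebraMap F Fbar f) := by
      intro y hy
      obtain ⟨z, hz⟩ := exists_valuation_eq_of_mem_adjoin (K := K) (p := p)
        (fun σ x => valuation_algEquiv (σ.restrictScalars F) x) hy
      obtain ⟨f, hf⟩ := hK z
      exact ⟨f, hz.trans hf⟩
    have hFM : ∀ f : F, algebraMap F Fbar f ∈ M := fun f =>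
      M.algebraMap_mem (algebraMap F K f)
    -- successive approximation: `x` is congruent to `f ζ` with `f` in `F` and `ζ` a root of unity,
    -- and the error is again in `M`
    have happrox : ∀ n : ℕ, ∀ x ∈ M, ∃ z ∈ F',
        valuation Fbar (x - z) ≤ valuation Fbar t ^ n * valuation Fbar x := by
      intro n
      induction n with
      | zero => exact fun x _ => ⟨0, zero_mem _, by simp⟩
      | succ n ih =>
        intro x hx
        rcases eq_or_ne x 0 with rfl | hx0
        · exact ⟨0, zero_mem _, by simp⟩
        obtain ⟨f, hf⟩ := hMv x hx
        set f' := algebraMap F Fbar f with hf'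
        have hvx : valuation Fbar x ≠ 0 := by simpa using hx0
        have hf0 : f' ≠ 0 := by
          intro h
          rw [h, map_zero] at hf
          exact hvx hf
        have hu : valuation Fbar (x / f') = 1 := by
          rw [map_div₀, ← hf, div_self hvx]
        obtain ⟨ζ, hζ, hζt, hζx⟩ := exists_tameRoots_residue_eq
          (exists_pow_eq_one_of_isAlgebraic (k := 𝓀[F]) p
            (z := IsLocalRing.residue 𝒪[Fbar] ⟨x / f', hu.le⟩) (fun h => by
              rw [residue_eq_zero_iff] at h
              exact h.ne hu))
        rw [eq_comm, residue_eq_iff] at hζx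
        have hyM : x / f' - ζ ∈ M :=
          sub_mem (div_mem hx (hFM f)) (IntermediateField.subset_adjoin _ _ hζt)
        have hy : valuation Fbar (x / f' - ζ) ≤ valuation Fbar t := by
          obtain ⟨g, hg⟩ := hMv _ hyM
          simp only at hζx
          rw [hg, valuation_algebraMap_le_iff]
          rw [hg, valuation_algebraMap_lt_one_iff] at hζx
          exact valuation_le_uniformizer hϖ hζx
        obtain ⟨z, hz, hxz⟩ := ih (f' * (x / f' - ζ)) (mul_mem (hFM f) hyM)
        refine ⟨f' * ζ + z, add_mem (mul_mem (F'.algebraMap_mem f)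
          (IntermediateField.subset_adjoin _ _ hζt)) hz, ?_⟩
        have h1 : x - (f' * ζ + z) = f' * (x / f' - ζ) - z := by field_simp; ring
        rw [h1]
        refine hxz.trans ?_
        rw [map_mul, ← hf, pow_succ, mul_assoc, mul_comm (valuation Fbar x)]
        gcongr
    have hxM : x ∈ M := M.algebraMap_mem ⟨x, hx⟩
    rw [← InfiniteGalois.fixedField_fixingSubgroup F']
    rintro ⟨σ, hσ⟩
    change σ x = x
    rw [IntermediateField.mem_fixingSubgroup_iff] at hσ
    -- `σ` fixes the approximations of `x`, so `σ x - x` is arbitrarily small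
    by_contra hne
    have hx0 : x ≠ 0 := by rintro rfl; exact hne (map_zero σ)
    obtain ⟨n, hn⟩ := exists_pow_valuation_lt F
      ((valuation_algebraMap_lt_one_iff F (Fbar := Fbar) _).mpr (uniformizer_lt_one hϖ))
      (div_ne_zero (sub_ne_zero.mpr hne) hx0)
    obtain ⟨z, hz, hxz⟩ := happrox n x hxM
    rw [map_div₀, lt_div_iff₀ (zero_lt_iff.mpr (by simpa using hx0))] at hn
    have h1 : valuation Fbar (σ x - x) ≤ valuation Fbar (x - z) := by
      have h2 : σ x - x = σ (x - z) - (x - z) := by rw [map_sub, hσ z hz]; ring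
      rw [h2]
      refine (Valuation.map_sub _ _ _).trans ?_
      rw [valuation_algEquiv, max_self]
    exact absurd (hn.trans_le (h1.trans hxz)) (lt_irrefl _)
  · rw [IntermediateField.adjoin_le_iff]
    intro ζ hζ
    refine (le_sSup (a := IntermediateField.adjoin F {ζ}) ⟨?_, fun x => ?_⟩ :
      IntermediateField.adjoin F {ζ} ≤ maxUnramified F Fbar)
      (IntermediateField.mem_adjoin_simple_self F ζ)
    · exact IntermediateField.adjoin.finiteDimensional (Algebra.IsIntegral.isIntegral ζ)
    · exact exists_valuation_eq_of_mem_adjoin_simple valuation_algEquiv hζ x.2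

theorem exists_valuation_eq_of_mem_maxUnramified {x : Fbar} (hx : x ∈ maxUnramified F Fbar) :
    ∃ y : F, valuation Fbar x = valuation Fbar (algebraMap F Fbar y) := by
  obtain ⟨p, hp⟩ := CharP.exists 𝓀[F]
  have : Fact p.Prime := ⟨CharP.char_is_prime 𝓀[F] p⟩
  have hchar : CharP 𝓀[Fbar] p := charP_residueField F
  rw [maxUnramified_eq (p := p)] at hx
  exact exists_valuation_eq_of_mem_adjoin valuation_algEquiv hx

/-- Every integral element of `F̄` is congruent to an integral element of `F^ur`. -/
theorem exists_mem_maxUnramified_residue_eq (z : 𝓀[Fbar]) :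
    ∃ (ζ : Fbar) (hζ : ζ ∈ 𝒪[Fbar]), ζ ∈ maxUnramified F Fbar ∧
      IsLocalRing.residue 𝒪[Fbar] ⟨ζ, hζ⟩ = z := by
  obtain ⟨p, hp⟩ := CharP.exists 𝓀[F]
  have : Fact p.Prime := ⟨CharP.char_is_prime 𝓀[F] p⟩
  have hchar : CharP 𝓀[Fbar] p := charP_residueField F
  rcases eq_or_ne z 0 with rfl | hz
  · exact ⟨0, zero_mem _, zero_mem _, map_zero _⟩
  obtain ⟨ζ, hζ, hζt, h⟩ := exists_tameRoots_residue_eq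
    (exists_pow_eq_one_of_isAlgebraic (k := 𝓀[F]) p hz)
  refine ⟨ζ, hζ, ?_, h⟩
  rw [maxUnramified_eq (p := p)]
  exact IntermediateField.subset_adjoin _ _ hζt

/-- The automorphisms acting trivially on the residue field are those fixing `F^ur`. -/
theorem residueAut_eq_one_iff (σ : Fbar ≃ₐ[F] Fbar) :
    residueAut σ = 1 ↔ σ ∈ (maxUnramified F Fbar).fixingSubgroup := by
  obtain ⟨p, hp⟩ := CharP.exists 𝓀[F]
  have : Fact p.Prime := ⟨CharP.char_is_prime 𝓀[F] p⟩
  have hchar : CharP 𝓀[Fbar] p := charP_residueField F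
  constructor
  · intro h
    rw [maxUnramified_eq (p := p), mem_fixingSubgroup_adjoin_iff]
    intro ζ hζ
    refine tameRoots_eq_of_valuation_sub_lt_one (algEquiv_mem_tameRoots σ hζ) hζ ?_
    have hv : ζ ∈ 𝒪[Fbar] := (valuation_eq_one_of_mem_tameRoots hζ).le
    refine (residue_eq_iff ⟨σ ζ, algEquiv_mem_integer σ hv⟩ ⟨ζ, hv⟩).mp ?_
    rw [← residueAut_residue, h]
    rfl
  · intro h
    rw [IntermediateField.mem_fixingSubgroup_iff] at h
    ext z
    obtain ⟨ζ, hv, hζ, rfl⟩ := exists_mem_maxUnramified_residue_eq (F := F) z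
    rw [residueAut_residue]
    change _ = IsLocalRing.residue 𝒪[Fbar] ⟨ζ, hv⟩
    congr 1
    exact Subtype.ext (h ζ hζ)

end LocalField

end LocalFieldExt

/-! ### Homogeneity of the forms, and polynomials with coefficients in the maximal ideal -/

section Homogeneity

variable {K : Type*} [Field K] {p e : ℕ} {a : ℕ → K} {α : K}

theorem mul_evalR_mul (hα : ∀ i ≤ e, a i ≠ 0 → α ^ (p ^ i + 1) = 1) (x : K) :
    α * evalR p e a (α * x) = evalR p e a x := by
  rw [evalR, evalR, Finset.mul_sum]
  refine Finset.sum_congr rfl fun i hi => ?_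
  by_cases h : a i = 0
  · simp [h]
  · linear_combination a i * x ^ p ^ i * hα i (Finset.mem_range_succ_iff.mp hi) h

theorem evalF_mul_mul (hα : ∀ i ≤ e, a i ≠ 0 → α ^ (p ^ i + 1) = 1) (x y : K) :
    evalF p e a (α * x) (α * y) = evalF p e a x y := by
  rw [evalF, evalF]
  congr 1
  refine Finset.sum_congr rfl fun i hi => ?_
  have h1 : a i * (α * x) ^ p ^ i * (α * y) = a i * x ^ p ^ i * y := by
    by_cases h : a i = 0
    · simp [h]
    · linear_combination a i * x ^ p ^ i * y * hα i (Finset.mem_range.mp hi).le h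
  have h2 : α * x * evalR p e a (α * y) = x * evalR p e a y := by
    rw [← mul_evalR_mul hα y]
    ring
  rw [h1, h2]

theorem evalE_mul_eq (hp : p ≠ 0) (he : a e ≠ 0) (hα : ∀ i ≤ e, a i ≠ 0 → α ^ (p ^ i + 1) = 1)
    (x : K) : evalE p e a (α * x) = α * evalE p e a x := by
  have hinv : ∀ i ≤ e, a i ≠ 0 → α ^ p ^ i = α⁻¹ := fun i hi h =>
    eq_inv_of_mul_eq_one_left (by rw [← pow_succ, hα i hi h])
  have h1 : evalR p e a (α * x) ^ p ^ e = α * evalR p e a x ^ p ^ e := by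
    rw [← mul_evalR_mul hα x, mul_pow, ← mul_assoc, mul_comm α (α ^ p ^ e), ← pow_succ,
      hα e le_rfl he, one_mul]
  rw [evalE, evalE, h1, mul_add, Finset.mul_sum]
  congr 1
  refine Finset.sum_congr rfl fun i hi => ?_
  have hi' := Finset.mem_range_succ_iff.mp hi
  by_cases h : a i = 0
  · simp [h, hp]
  · have h2 : α ^ p ^ (e - i) = α := by
      have h3 : (α ^ p ^ i) ^ p ^ (e - i) = α ^ p ^ e := by
        rw [← pow_mul, ← pow_add, Nat.add_sub_cancel' hi']
      rw [hinv i hi' h, hinv e le_rfl he, inv_pow] at h3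
      exact inv_injective h3
    rw [mul_left_comm, mul_pow, h2]

end Homogeneity

section Degree

open Polynomial

variable {K : Type*} [Field K]

theorem natDegree_evalR_le (p e : ℕ) (hp : 0 < p) (a : ℕ → K) {Q : K[X]} (hQ : Q.natDegree ≤ 1) :
    (evalR p e (fun i => C (a i)) Q).natDegree ≤ p ^ e := by
  refine natDegree_sum_le_of_forall_le _ _ fun i hi => ?_
  refine (natDegree_C_mul_le _ _).trans ((natDegree_pow_le_of_le _ hQ).trans ?_)
  rw [mul_one]
  exact Nat.pow_le_pow_right hp (Finset.mem_range_succ_iff.mp hi)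

theorem natDegree_evalE_le (p e : ℕ) (hp : 0 < p) (a : ℕ → K) {Q : K[X]} (hQ : Q.natDegree ≤ 1) :
    (evalE p e (fun i => C (a i)) Q).natDegree ≤ p ^ (2 * e) := by
  refine natDegree_add_le_of_degree_le ?_ ?_
  · refine (natDegree_pow_le_of_le _ (natDegree_evalR_le p e hp a hQ)).trans ?_
    rw [← pow_add, two_mul]
  · refine natDegree_sum_le_of_forall_le _ _ fun i hi => ?_
    refine (natDegree_pow_le_of_le _ ((natDegree_C_mul_le _ _).trans hQ)).trans ?_
    rw [mul_one]
    exact Nat.pow_le_pow_right hp (by omega)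

end Degree

namespace LocalFieldExt

section CoeffsInMax

variable {K : Type*} [Field K] [ValuativeRel K]

open Polynomial

theorem valuation_eval_lt_one {P : K[X]} (hP : CoeffsInMax P) {x : K} (hx : valuation K x ≤ 1) :
    valuation K (P.eval x) < 1 := by
  rw [eval_eq_sum_range]
  refine Valuation.map_sum_lt _ one_ne_zero fun i _ => ?_
  rw [map_mul, map_pow]
  exact mul_lt_one_of_lt_of_le (hP i) (pow_le_one' hx i)

theorem valuation_eval_lt_pow {P : K[X]} (hP : CoeffsInMax P) {n : ℕ} (hn : P.natDegree ≤ n)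
    {x : K} (hx : 1 < valuation K x) : valuation K (P.eval x) < valuation K x ^ n := by
  have h0 : 0 < valuation K x := zero_lt_one.trans hx
  rw [eval_eq_sum_range]
  refine Valuation.map_sum_lt _ (pow_ne_zero _ h0.ne') fun i hi => ?_
  rw [map_mul, map_pow]
  calc _ < 1 * valuation K x ^ i := by
        exact mul_lt_mul_of_pos_right (hP i) (pow_pos h0 i)
    _ ≤ _ := by
        rw [one_mul]
        exact pow_le_pow_right₀ hx.le ((Finset.mem_range_succ_iff.mp hi).trans hn)

theorem valuation_eval_lt_self {P : K[X]} (hP : CoeffsInMax P) (h0 : P.eval 0 = 0) {x : K}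
    (hx : valuation K x ≤ 1) (hx0 : x ≠ 0) : valuation K (P.eval x) < valuation K x := by
  have hv : valuation K x ≠ 0 := by simpa using hx0
  rw [eval_eq_sum_range]
  refine Valuation.map_sum_lt _ hv fun i _ => ?_
  rcases i with _ | i
  · rw [coeff_zero_eq_eval_zero, h0, zero_mul, map_zero]
    exact zero_lt_iff.mpr hv
  · rw [map_mul, map_pow, pow_succ, ← mul_assoc]
    exact mul_lt_of_lt_one_left (zero_lt_iff.mpr hv)
      (mul_lt_one_of_lt_of_le (hP _) (pow_le_one' hx i))

/-- Specialising the second variable to an integral element. -/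
theorem CoeffsInMax₂.aeval {P : MvPolynomial (Fin 2) K} (hP : CoeffsInMax₂ P) {y : K}
    (hy : valuation K y ≤ 1) : CoeffsInMax (MvPolynomial.aeval ![(X : K[X]), C y] P) := by
  intro n
  rw [MvPolynomial.aeval_def, MvPolynomial.eval₂_eq', finsetSum_coeff]
  refine Valuation.map_sum_lt _ one_ne_zero fun s _ => ?_
  rw [Fin.prod_univ_two]
  simp only [Matrix.cons_val_zero, Matrix.cons_val_one, algebraMap_eq, coeff_C_mul]
  rw [← C_pow, coeff_mul_C, coeff_X_pow, map_mul, map_mul, map_pow]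
  refine mul_lt_one_of_lt_of_le (hP s) (mul_le_one' ?_ (pow_le_one' hy _))
  split_ifs <;> simp

theorem valuation_mvEval_lt_one {P : MvPolynomial (Fin 2) K} (hP : CoeffsInMax₂ P) {x y : K}
    (hx : valuation K x ≤ 1) (hy : valuation K y ≤ 1) :
    valuation K (MvPolynomial.eval ![x, y] P) < 1 := by
  have h := valuation_eval_lt_one (CoeffsInMax₂.aeval hP hy) hx
  convert h using 2
  rw [← coe_evalRingHom, MvPolynomial.aeval_def, MvPolynomial.hom_eval₂,
    ← MvPolynomial.coe_eval₂Hom]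
  change MvPolynomial.eval₂Hom _ _ P = _
  congr 2
  · ext; simp
  · funext i
    fin_cases i <;> simp

end CoeffsInMax

/-! ### The lifted forms -/

section Lift

theorem liftCoeffs_eq_zero {F Fbar : Type*} [Field F] [ValuativeRel F] [TopologicalSpace F]
    [IsNonarchimedeanLocalField F] [Field Fbar] [Algebra F Fbar] {R : AddPoly 𝓀[F]} {i : ℕ}
    (h : R.a i = 0) :
    liftCoeffs F Fbar R i = 0 := by
  have h0 : teichmullerLift (R.a i) = 0 := by
    refine ((existsUnique_teichmuller F (R.a i)).choose_spec.2 0 ⟨?_, ?_⟩).symm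
    · exact zero_pow Nat.card_pos.ne'
    · rw [h, map_zero]
  rw [liftCoeffs, h0]
  exact map_zero _

theorem pow_eq_one_of_liftCoeffs_ne_zero {F Fbar : Type*} [Field F] [ValuativeRel F]
    [TopologicalSpace F] [IsNonarchimedeanLocalField F] [Field Fbar] [Algebra F Fbar]
    {R : AddPoly 𝓀[F]} {p : ℕ} {α : Fbar}
    (hα : α ^ R.d p = 1) : ∀ i ≤ R.e, liftCoeffs F Fbar R i ≠ 0 → α ^ (p ^ i + 1) = 1 := by
  intro i hi h
  obtain ⟨c, hc⟩ := R.d_dvd p hi fun h0 => h (liftCoeffs_eq_zero h0)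
  rw [hc, pow_mul, hα, one_pow]

variable {F : Type*} [Field F] [ValuativeRel F] [TopologicalSpace F] [IsNonarchimedeanLocalField F]
  {Fbar : Type*} [Field Fbar] [Algebra F Fbar] [ValuativeRel Fbar] [ValuativeExtension F Fbar]

variable (Fbar) in
/-- The coefficients of `R̃`, in the valuation ring of `F̄`. -/
noncomputable def integerCoeffs (R : AddPoly 𝓀[F]) (i : ℕ) : 𝒪[Fbar] :=
  algebraMap 𝒪[F] 𝒪[Fbar] (teichmullerLift (R.a i))

theorem coe_integerCoeffs (R : AddPoly 𝓀[F]) :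
    (fun i => (𝒪[Fbar].subtype (integerCoeffs Fbar R i))) = liftCoeffs F Fbar R := rfl

theorem residue_teichmullerLift (a : 𝓀[F]) :
    IsLocalRing.residue 𝒪[F] (teichmullerLift a) = a :=
  (existsUnique_teichmuller F a).choose_spec.1.2

theorem residue_integerCoeffs (R : AddPoly 𝓀[F]) :
    (fun i => IsLocalRing.residue 𝒪[Fbar] (integerCoeffs Fbar R i)) = R.coeffs 𝓀[Fbar] := by
  funext i
  rw [integerCoeffs, ← IsLocalRing.ResidueField.algebraMap_residue, residue_teichmullerLift]
  rfl

theorem valuation_liftCoeffs_le_one (R : AddPoly 𝓀[F]) (i : ℕ) :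
    valuation Fbar (liftCoeffs F Fbar R i) ≤ 1 := (integerCoeffs Fbar R i).2

theorem valuation_liftCoeffs_lead (R : AddPoly 𝓀[F]) :
    valuation Fbar (liftCoeffs F Fbar R R.e) = 1 := by
  refine le_antisymm (valuation_liftCoeffs_le_one R _) (not_lt.mp fun h => ?_)
  have h1 := (residue_eq_zero_iff (integerCoeffs Fbar R R.e)).mpr h
  have h2 := congrFun (residue_integerCoeffs (Fbar := Fbar) R) R.e
  rw [h1] at h2
  exact R.lead_ne_zero ((map_eq_zero_iff _ (algebraMap 𝓀[F] 𝓀[Fbar]).injective).mp h2.symm)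

theorem liftCoeffs_lead_ne_zero (R : AddPoly 𝓀[F]) : liftCoeffs F Fbar R R.e ≠ 0 := fun h => by
  have := valuation_liftCoeffs_lead (Fbar := Fbar) R
  rw [h, map_zero] at this
  exact zero_ne_one this

theorem evalR_mem_integer (p : ℕ) (R : AddPoly 𝓀[F]) {x : Fbar} (hx : x ∈ 𝒪[Fbar]) :
    evalR p R.e (liftCoeffs F Fbar R) x ∈ 𝒪[Fbar] := by
  have h := map_evalR 𝒪[Fbar].subtype p R.e (integerCoeffs Fbar R) ⟨x, hx⟩
  rw [coe_integerCoeffs] at h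
  exact (congrArg (· ∈ 𝒪[Fbar]) h).mp (Subtype.property _)

theorem residue_evalR (p : ℕ) (R : AddPoly 𝓀[F]) {x : Fbar} (hx : x ∈ 𝒪[Fbar]) :
    IsLocalRing.residue 𝒪[Fbar] ⟨_, evalR_mem_integer p R hx⟩ =
      evalR p R.e (R.coeffs 𝓀[Fbar]) (IsLocalRing.residue 𝒪[Fbar] ⟨x, hx⟩) := by
  have h := map_evalR (IsLocalRing.residue 𝒪[Fbar]) p R.e (integerCoeffs Fbar R) ⟨x, hx⟩
  rw [residue_integerCoeffs] at h
  rw [← h]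
  congr 1
  exact Subtype.ext (map_evalR 𝒪[Fbar].subtype p R.e (integerCoeffs Fbar R) ⟨x, hx⟩).symm

theorem evalE_mem_integer (p : ℕ) (R : AddPoly 𝓀[F]) {x : Fbar} (hx : x ∈ 𝒪[Fbar]) :
    evalE p R.e (liftCoeffs F Fbar R) x ∈ 𝒪[Fbar] := by
  have h := map_evalE 𝒪[Fbar].subtype p R.e (integerCoeffs Fbar R) ⟨x, hx⟩
  rw [coe_integerCoeffs] at h
  exact (congrArg (· ∈ 𝒪[Fbar]) h).mp (Subtype.property _)

theorem residue_evalE (p : ℕ) (R : AddPoly 𝓀[F]) {x : Fbar} (hx : x ∈ 𝒪[Fbar]) :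
    IsLocalRing.residue 𝒪[Fbar] ⟨_, evalE_mem_integer p R hx⟩ =
      evalE p R.e (R.coeffs 𝓀[Fbar]) (IsLocalRing.residue 𝒪[Fbar] ⟨x, hx⟩) := by
  have h := map_evalE (IsLocalRing.residue 𝒪[Fbar]) p R.e (integerCoeffs Fbar R) ⟨x, hx⟩
  rw [residue_integerCoeffs] at h
  rw [← h]
  congr 1
  exact Subtype.ext (map_evalE 𝒪[Fbar].subtype p R.e (integerCoeffs Fbar R) ⟨x, hx⟩).symm

theorem evalF_mem_integer (p : ℕ) (R : AddPoly 𝓀[F]) {x y : Fbar} (hx : x ∈ 𝒪[Fbar])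
    (hy : y ∈ 𝒪[Fbar]) : evalF p R.e (liftCoeffs F Fbar R) x y ∈ 𝒪[Fbar] := by
  have h := map_evalF 𝒪[Fbar].subtype p R.e (integerCoeffs Fbar R) ⟨x, hx⟩ ⟨y, hy⟩
  rw [coe_integerCoeffs] at h
  exact (congrArg (· ∈ 𝒪[Fbar]) h).mp (Subtype.property _)

theorem residue_evalF (p : ℕ) (R : AddPoly 𝓀[F]) {x y : Fbar} (hx : x ∈ 𝒪[Fbar])
    (hy : y ∈ 𝒪[Fbar]) :
    IsLocalRing.residue 𝒪[Fbar] ⟨_, evalF_mem_integer p R hx hy⟩ =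
      evalF p R.e (R.coeffs 𝓀[Fbar]) (IsLocalRing.residue 𝒪[Fbar] ⟨x, hx⟩)
        (IsLocalRing.residue 𝒪[Fbar] ⟨y, hy⟩) := by
  have h := map_evalF (IsLocalRing.residue 𝒪[Fbar]) p R.e (integerCoeffs Fbar R) ⟨x, hx⟩ ⟨y, hy⟩
  rw [residue_integerCoeffs] at h
  rw [← h]
  congr 1
  exact Subtype.ext (map_evalF 𝒪[Fbar].subtype p R.e (integerCoeffs Fbar R) ⟨x, hx⟩ ⟨y, hy⟩).symm

variable {p : ℕ} [Fact p.Prime] (R : AddPoly 𝓀[F])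

theorem valuation_evalR_of_one_lt {x : Fbar} (hx : 1 < valuation Fbar x) :
    valuation Fbar (evalR p R.e (liftCoeffs F Fbar R) x) = valuation Fbar x ^ p ^ R.e := by
  have hp := (Fact.out : p.Prime).one_lt
  have hlead : valuation Fbar (liftCoeffs F Fbar R R.e * x ^ p ^ R.e) =
      valuation Fbar x ^ p ^ R.e := by
    rw [map_mul, valuation_liftCoeffs_lead, one_mul, map_pow]
  rw [evalR, Finset.sum_range_succ, Valuation.map_add_eq_of_lt_right, hlead]
  rw [hlead]
  refine Valuation.map_sum_lt _ (pow_ne_zero _ (zero_lt_one.trans hx).ne') fun i hi => ?_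
  rw [map_mul, map_pow]
  calc _ ≤ 1 * valuation Fbar x ^ p ^ i := by
        gcongr
        exact valuation_liftCoeffs_le_one R i
    _ < _ := by
        rw [one_mul]
        exact pow_lt_pow_right₀ hx (Nat.pow_lt_pow_right hp (Finset.mem_range.mp hi))

variable [CharP 𝓀[F] p]

theorem valuation_evalE_of_e_eq_zero (hpe : ¬(p = 2 ∧ R.e = 0)) (he : R.e = 0) (x : Fbar) :
    valuation Fbar (evalE p R.e (liftCoeffs F Fbar R) x) = valuation Fbar x := by
  have hchar : CharP 𝓀[Fbar] p := charP_residueField F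
  have hp2 : Nat.Coprime 2 p :=
    (Nat.coprime_primes Nat.prime_two Fact.out).mpr fun h => hpe ⟨h.symm, he⟩
  have h2 : valuation Fbar ((2 : ℕ) : Fbar) = 1 := valuation_natCast_eq_one hp2
  have hl := valuation_liftCoeffs_lead (Fbar := Fbar) R
  rw [he] at hl ⊢
  have : evalE p 0 (liftCoeffs F Fbar R) x = (2 : ℕ) * (liftCoeffs F Fbar R 0 * x) := by
    simp [evalE, evalR]
    ring
  rw [this, map_mul, map_mul, h2, hl, one_mul, one_mul]

theorem valuation_evalE_of_one_lt (hpe : ¬(p = 2 ∧ R.e = 0)) {x : Fbar}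
    (hx : 1 < valuation Fbar x) :
    valuation Fbar (evalE p R.e (liftCoeffs F Fbar R) x) = valuation Fbar x ^ p ^ (2 * R.e) := by
  rcases Nat.eq_zero_or_pos R.e with he | he
  · rw [valuation_evalE_of_e_eq_zero R hpe he, he]
    simp
  have hp := (Fact.out : p.Prime).one_lt
  have hlead : valuation Fbar (evalR p R.e (liftCoeffs F Fbar R) x ^ p ^ R.e) =
      valuation Fbar x ^ p ^ (2 * R.e) := by
    rw [map_pow, valuation_evalR_of_one_lt R hx, ← pow_mul, ← pow_add, two_mul]
  rw [evalE, Valuation.map_add_eq_of_lt_left, hlead]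
  rw [hlead]
  refine Valuation.map_sum_lt _ (pow_ne_zero _ (zero_lt_one.trans hx).ne') fun i hi => ?_
  rw [map_pow, map_mul]
  calc _ ≤ (1 * valuation Fbar x) ^ p ^ (R.e - i) := by
        gcongr
        exact valuation_liftCoeffs_le_one R i
    _ < _ := by
        rw [one_mul]
        exact pow_lt_pow_right₀ hx (Nat.pow_lt_pow_right hp (by omega))

theorem valuation_evalE_of_lt_one (hpe : ¬(p = 2 ∧ R.e = 0)) {x : Fbar}
    (hx : valuation Fbar x < 1) :
    valuation Fbar (evalE p R.e (liftCoeffs F Fbar R) x) = valuation Fbar x := by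
  rcases Nat.eq_zero_or_pos R.e with he | he
  · exact valuation_evalE_of_e_eq_zero R hpe he x
  have hp := (Fact.out : p.Prime).one_lt
  rcases eq_or_ne x 0 with rfl | hx0
  · simp [evalE, evalR, (zero_lt_one.trans hp).ne']
  have hv : 0 < valuation Fbar x := zero_lt_iff.mpr (by simpa using hx0)
  have hpow : ∀ n, 0 < n → valuation Fbar x ^ p ^ n < valuation Fbar x := fun n hn =>
    pow_lt_self_of_lt_one₀ hv hx (Nat.one_lt_pow hn.ne' hp)
  have hlead : valuation Fbar (liftCoeffs F Fbar R R.e * x) = valuation Fbar x := by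
    rw [map_mul, valuation_liftCoeffs_lead, one_mul]
  have hR : valuation Fbar (evalR p R.e (liftCoeffs F Fbar R) x) ≤ valuation Fbar x := by
    refine Valuation.map_sum_le _ fun i _ => ?_
    rw [map_mul, map_pow]
    exact mul_le_of_le_one_of_le (valuation_liftCoeffs_le_one R i)
      (pow_le_of_le_one zero_le hx.le (Nat.pow_pos (by omega)).ne')
  rw [evalE, Finset.sum_range_succ, ← add_assoc]
  simp only [Nat.sub_self, pow_zero, pow_one]
  rw [Valuation.map_add_eq_of_lt_right, hlead]
  rw [hlead]
  refine Valuation.map_add_lt _ ?_ (Valuation.map_sum_lt _ hv.ne' fun i hi => ?_)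
  · rw [map_pow]
    exact (pow_le_pow_left₀ zero_le hR _).trans_lt (hpow _ he)
  · have hi' := Finset.mem_range.mp hi
    rw [map_pow, map_mul]
    refine lt_of_le_of_lt ?_ (hpow (R.e - i) (by omega))
    gcongr
    exact mul_le_of_le_one_left' (valuation_liftCoeffs_le_one R i)

end Lift

end LocalFieldExt

/-! ### Evaluating the congruence conditions -/

namespace LocalFieldExt

section Eval

variable {K : Type*} [Field K] (p e : ℕ) (a : ℕ → K)

open Polynomial

theorem eval_evalR (Q : K[X]) (x : K) :
    (evalR p e (fun i => C (a i)) Q).eval x = evalR p e a (Q.eval x) := by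
  simpa using map_evalR (evalRingHom x) p e (fun i => C (a i)) Q

theorem eval_evalE (Q : K[X]) (x : K) :
    (evalE p e (fun i => C (a i)) Q).eval x = evalE p e a (Q.eval x) := by
  simpa using map_evalE (evalRingHom x) p e (fun i => C (a i)) Q

theorem eval_evalF (P Q : K[X]) (x : K) :
    (evalF p e (fun i => C (a i)) P Q).eval x = evalF p e a (P.eval x) (Q.eval x) := by
  simpa using map_evalF (evalRingHom x) p e (fun i => C (a i)) P Q

theorem mvEval_evalF (P Q : MvPolynomial (Fin 2) K) (x : Fin 2 → K) :
    MvPolynomial.eval x (evalF p e (fun i => MvPolynomial.C (a i)) P Q) =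
      evalF p e a (MvPolynomial.eval x P) (MvPolynomial.eval x Q) := by
  simpa using map_evalF (MvPolynomial.eval x) p e (fun i => MvPolynomial.C (a i)) P Q

theorem evalF_C (x y : K) :
    evalF p e (fun i => (C (a i) : K[X])) (C x) (C y) = C (evalF p e a x y) :=
  (map_evalF (C : K →+* K[X]) p e a x y).symm

end Eval

section Conditions

variable {F : Type*} [Field F] [ValuativeRel F] [TopologicalSpace F] [IsNonarchimedeanLocalField F]
  {Fbar : Type*} [Field Fbar] [Algebra F Fbar] [ValuativeRel Fbar]
  {p : ℕ} {R : AddPoly 𝓀[F]} {β γ : Fbar}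

local notation "Ã" => liftCoeffs F Fbar R

theorem evalE_zero [Fact p.Prime] {K : Type*} [Field K] (e : ℕ) (a : ℕ → K) :
    evalE p e a 0 = 0 := by
  have hp := (Fact.out : p.Prime).ne_zero
  simp [evalE, evalR, hp]

theorem evalF_zero_right [Fact p.Prime] {K : Type*} [Field K] (e : ℕ) (a : ℕ → K) (x : K) :
    evalF p e a x 0 = 0 := by
  have hp := (Fact.out : p.Prime).ne_zero
  simp [evalF, evalR, hp]

theorem valuation_E_add_lt_one (h₁ : CongruenceConditions₁ p R β γ)
    {b : Fbar} (hb : valuation Fbar b ≤ 1) :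
    valuation Fbar (β ^ p ^ R.e *
      (evalE p R.e Ã (β + b) - evalE p R.e Ã β - evalE p R.e Ã b)) < 1 := by
  simpa [eval_evalE] using valuation_eval_lt_one h₁.E_add hb

theorem valuation_E_add_lt_self [Fact p.Prime] (h₁ : CongruenceConditions₁ p R β γ)
    {b : Fbar} (hb : valuation Fbar b ≤ 1) (hb0 : b ≠ 0) :
    valuation Fbar (β ^ p ^ R.e *
      (evalE p R.e Ã (β + b) - evalE p R.e Ã β - evalE p R.e Ã b)) < valuation Fbar b := by
  simpa [eval_evalE] using
    valuation_eval_lt_self h₁.E_add (by simp [eval_evalE, evalE_zero]) hb hb0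

open Polynomial in
theorem valuation_E_add_lt_pow [Fact p.Prime] (h₁ : CongruenceConditions₁ p R β γ)
    {b : Fbar} (hb : 1 < valuation Fbar b) :
    valuation Fbar (β ^ p ^ R.e *
      (evalE p R.e Ã (β + b) - evalE p R.e Ã β - evalE p R.e Ã b)) <
        valuation Fbar b ^ p ^ (2 * R.e) := by
  have hp := (Fact.out : p.Prime).pos
  have hdeg : (C β ^ p ^ R.e *
    (evalE p R.e (fun i => C (Ã i)) (C β + X) - evalE p R.e (fun i => C (Ã i)) (C β)
      - evalE p R.e (fun i => C (Ã i)) X)).natDegree ≤ p ^ (2 * R.e) := by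
    rw [← C_pow]
    refine (natDegree_C_mul_le _ _).trans (((natDegree_sub_le_iff_left ?_).mpr
      ((natDegree_sub_le_iff_left ?_).mpr ?_)))
    · exact natDegree_evalE_le _ _ hp _ natDegree_X_le
    · exact natDegree_evalE_le _ _ hp _ (by simp)
    · exact natDegree_evalE_le _ _ hp _ (natDegree_add_le_of_degree_le (by simp) natDegree_X_le)
  simpa [eval_evalE] using valuation_eval_lt_pow h₁.E_add hdeg hb

theorem valuation_R_add_lt_one (h₁ : CongruenceConditions₁ p R β γ)
    {b : Fbar} (hb : valuation Fbar b ≤ 1) :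
    valuation Fbar (β * (evalR p R.e Ã (β + b) - evalR p R.e Ã β - evalR p R.e Ã b)) < 1 := by
  simpa [eval_evalR] using valuation_eval_lt_one h₁.R_add hb

theorem valuation_f_pow_lt_one (h₁ : CongruenceConditions₁ p R β γ)
    {b : Fbar} (hb : valuation Fbar b ≤ 1) :
    valuation Fbar (evalF p R.e Ã β b ^ p - evalF p R.e Ã β b
      + β ^ p ^ R.e * evalE p R.e Ã b - b * evalR p R.e Ã β - β * evalR p R.e Ã b) < 1 := by
  simpa [eval_evalF, eval_evalE, eval_evalR] using valuation_eval_lt_one h₁.f_pow hb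

open Polynomial in
/-- The condition `γ_pow` with an integral value in place of the second variable. -/
theorem coeffsInMax_γ_pow (h₁ : CongruenceConditions₁ p R β γ)
    {b : Fbar} (hb : valuation Fbar b ≤ 1) :
    CoeffsInMax ((C γ + C (evalF p R.e Ã β b) + X) ^ p - C γ ^ p - C (evalF p R.e Ã β b) ^ p
      - X ^ p) := by
  have h := CoeffsInMax₂.aeval h₁.γ_pow hb
  have h2 := map_evalF ((MvPolynomial.aeval ![(X : Fbar[X]), C b]) :
    MvPolynomial (Fin 2) Fbar →ₐ[Fbar] Fbar[X]).toRingHom p R.e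
    (fun i => MvPolynomial.C (Ã i)) (MvPolynomial.C β) (MvPolynomial.X 1)
  simp only [AlgHom.toRingHom_eq_coe, RingHom.coe_coe, MvPolynomial.aeval_C,
    MvPolynomial.aeval_X, Matrix.cons_val_one, algebraMap_eq] at h2
  simp only [Matrix.cons_val_fin_one, evalF_C] at h2
  simpa [h2] using h

theorem valuation_γ_pow_lt_one (h₁ : CongruenceConditions₁ p R β γ)
    {b c : Fbar} (hb : valuation Fbar b ≤ 1)
    (hc : valuation Fbar c ≤ 1) :
    valuation Fbar ((γ + evalF p R.e Ã β b + c) ^ p - γ ^ p - evalF p R.e Ã β b ^ p - c ^ p)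
      < 1 := by
  simpa using valuation_eval_lt_one (coeffsInMax_γ_pow h₁ hb) hc

open Polynomial in
theorem valuation_γ_pow_lt_pow (h₁ : CongruenceConditions₁ p R β γ)
    {b c : Fbar} (hb : valuation Fbar b ≤ 1)
    (hc : 1 < valuation Fbar c) :
    valuation Fbar ((γ + evalF p R.e Ã β b + c) ^ p - γ ^ p - evalF p R.e Ã β b ^ p - c ^ p)
      < valuation Fbar c ^ p := by
  have hdeg : ((C γ + C (evalF p R.e Ã β b) + X) ^ p - C γ ^ p - C (evalF p R.e Ã β b) ^ p
      - X ^ p : Fbar[X]).natDegree ≤ p := by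
    refine (natDegree_sub_le_iff_left (by simp)).mpr ((natDegree_sub_le_iff_left ?_).mpr
      ((natDegree_sub_le_iff_left ?_).mpr ?_))
    · rw [← C_pow]; simp
    · rw [← C_pow]; simp
    · have h1 : (C γ + C (evalF p R.e Ã β b) + X : Fbar[X]).natDegree ≤ 1 := by
        rw [← C_add]
        exact natDegree_add_le_of_degree_le (by simp) natDegree_X_le
      exact (natDegree_pow_le_of_le p h1).trans (mul_one p).le
  simpa using valuation_eval_lt_pow (coeffsInMax_γ_pow h₁ hb) hdeg hc

theorem valuation_γ_pow_lt_self [Fact p.Prime] (h₁ : CongruenceConditions₁ p R β γ)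
    {c : Fbar} (hc : valuation Fbar c ≤ 1) (hc0 : c ≠ 0) :
    valuation Fbar ((γ + c) ^ p - γ ^ p - c ^ p) < valuation Fbar c := by
  have hp := (Fact.out : p.Prime).ne_zero
  simpa [evalF_zero_right, hp] using valuation_eval_lt_self
    (coeffsInMax_γ_pow h₁ (b := 0) (by simp)) (by simp [evalF_zero_right, hp]) hc hc0

theorem valuation_pow_add_lt_one (h₂ : CongruenceConditions₂ (F := F) p R β)
    {i : ℕ} (hi : i < R.e) {b : Fbar} (hb : valuation Fbar b ≤ 1) :
    valuation Fbar ((β + b) ^ p ^ i - (β ^ p ^ i + b ^ p ^ i)) < 1 := by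
  rcases Nat.eq_zero_or_pos i with rfl | hi0
  · simp
  · have h := valuation_eval_lt_one (h₂.pow_add i hi0 hi) hb
    simp only [Polynomial.eval_sub, Polynomial.eval_pow, Polynomial.eval_add, Polynomial.eval_X,
      Polynomial.eval_C] at h
    convert h using 2
    ring

theorem valuation_f_add_right_lt_one (h₂ : CongruenceConditions₂ (F := F) p R β)
    {x y : Fbar} (hx : valuation Fbar x ≤ 1)
    (hy : valuation Fbar y ≤ 1) :
    valuation Fbar (evalF p R.e Ã β (x + y) - evalF p R.e Ã β x - evalF p R.e Ã β y) < 1 := by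
  simpa [mvEval_evalF] using valuation_mvEval_lt_one h₂.f_add hx hy

end Conditions

end LocalFieldExt

/-! ### The elements `a_σ`, `b_σ`, `c_σ` -/

namespace LocalFieldExt

/-- The data `(α, β, γ)` attached to `R`, a uniformizer `ϖ` and `m`, subject to the congruence
conditions. -/
structure IsAdmissible {F : Type*} [Field F] [ValuativeRel F] [TopologicalSpace F]
    [IsNonarchimedeanLocalField F] {Fbar : Type*} [Field Fbar] [Algebra F Fbar] [ValuativeRel Fbar]
    (p : ℕ) (R : AddPoly 𝓀[F]) (ϖ : 𝒪[F]) (m : ℕ) (α β γ : Fbar) : Prop where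
  not_two_zero : ¬(p = 2 ∧ R.e = 0)
  irreducible : Irreducible ϖ
  m_pos : 0 < m
  coprime : Nat.Coprime m p
  α_pow : α ^ R.d p = algebraMap F Fbar (ϖ : F)
  E_β : evalE p R.e (liftCoeffs F Fbar R) β = (α ^ m)⁻¹
  γ_eq : γ ^ p - γ = β * evalR p R.e (liftCoeffs F Fbar R) β
  cond₁ : CongruenceConditions₁ p R β γ
  cond₂ : CongruenceConditions₂ (F := F) p R β

variable {F : Type*} [Field F] [ValuativeRel F] [TopologicalSpace F] [IsNonarchimedeanLocalField F]
  {Fbar : Type*} [Field Fbar] [Algebra F Fbar] [ValuativeRel Fbar] [ValuativeExtension F Fbar]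
  {p : ℕ} [Fact p.Prime] {R : AddPoly 𝓀[F]} {ϖ : 𝒪[F]} {m : ℕ} {α β γ : Fbar}

local notation "Ã" => liftCoeffs F Fbar R

theorem valuation_pow_sub_self {K : Type*} [Field K] [ValuativeRel K] {n : ℕ} (hn : 1 < n) {x : K}
    (hx : 1 < valuation K x) : valuation K (x ^ n - x) = valuation K x ^ n := by
  rw [Valuation.map_sub_eq_of_lt_left, map_pow]
  rw [map_pow]
  exact lt_self_pow₀ hx hn

theorem coprime_pow_add_one {e : ℕ} (hpe : ¬(p = 2 ∧ e = 0)) : (p ^ e + 1).Coprime p := by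
  have hp := (Fact.out : p.Prime)
  rcases Nat.eq_zero_or_pos e with he | he
  · rw [he, pow_zero]
    exact (Nat.coprime_primes Nat.prime_two hp).mpr fun h => hpe ⟨h.symm, he⟩
  · obtain ⟨n, hn⟩ := Nat.exists_eq_succ_of_ne_zero he.ne'
    rw [hn, pow_succ]
    simp

theorem coprime_d (hpe : ¬(p = 2 ∧ R.e = 0)) : (R.d p).Coprime p :=
  (coprime_pow_add_one hpe).coprime_dvd_left (R.d_dvd p le_rfl R.lead_ne_zero)

theorem map_liftCoeffs (σ : Fbar ≃ₐ[F] Fbar) : (fun i => (σ : Fbar →+* Fbar) (Ã i)) = Ã :=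
  funext fun _ => σ.commutes _

theorem map_evalR_lift (σ : Fbar ≃ₐ[F] Fbar) (x : Fbar) :
    σ (evalR p R.e Ã x) = evalR p R.e Ã (σ x) := by
  have h := map_evalR (σ : Fbar →+* Fbar) p R.e Ã x
  rwa [map_liftCoeffs] at h

theorem map_evalE_lift (σ : Fbar ≃ₐ[F] Fbar) (x : Fbar) :
    σ (evalE p R.e Ã x) = evalE p R.e Ã (σ x) := by
  have h := map_evalE (σ : Fbar →+* Fbar) p R.e Ã x
  rwa [map_liftCoeffs] at h

theorem map_evalF_lift (σ : Fbar ≃ₐ[F] Fbar) (x y : Fbar) :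
    σ (evalF p R.e Ã x y) = evalF p R.e Ã (σ x) (σ y) := by
  have h := map_evalF (σ : Fbar →+* Fbar) p R.e Ã x y
  rwa [map_liftCoeffs] at h

theorem β_add_bSigma (σ : Fbar ≃ₐ[F] Fbar) : β + bSigma m α β σ = aSigma α σ ^ m * σ β := by
  rw [bSigma]; ring

namespace IsAdmissible

section Valuations

variable (H : IsAdmissible p R ϖ m α β γ)
include H

theorem valuation_α_lt_one : valuation Fbar α < 1 := by
  have h := congrArg (valuation Fbar) H.α_pow
  have h1 := (valuation_algebraMap_lt_one_iff F (Fbar := Fbar) _).mpr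
    (uniformizer_lt_one H.irreducible)
  rw [← h, map_pow] at h1
  exact (pow_lt_one_iff_of_nonneg zero_le (R.d_ne_zero p)).mp h1

theorem α_ne_zero : α ≠ 0 := by
  rintro rfl
  have h := H.α_pow
  rw [zero_pow (R.d_ne_zero p), eq_comm, map_eq_zero] at h
  exact H.irreducible.ne_zero (Subtype.ext h)

theorem one_lt_valuation_β : 1 < valuation Fbar β := by
  by_contra! h
  have h1 := evalE_mem_integer p R (x := β) h
  rw [Valuation.mem_integer_iff, H.E_β, map_inv₀, map_pow] at h1
  have h2 : valuation Fbar α ^ m < 1 := pow_lt_one₀ zero_le H.valuation_α_lt_one H.m_pos.ne'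
  have h3 : valuation Fbar α ^ m ≠ 0 := pow_ne_zero _ (by simpa using H.α_ne_zero)
  rw [inv_le_one₀ (zero_lt_iff.mpr h3)] at h1
  exact absurd h2 (not_lt.mpr h1)

theorem valuation_β_pow [CharP 𝓀[F] p] :
    valuation Fbar β ^ p ^ (2 * R.e) = (valuation Fbar α ^ m)⁻¹ := by
  rw [← valuation_evalE_of_one_lt R H.not_two_zero H.one_lt_valuation_β, H.E_β, map_inv₀, map_pow]

theorem one_lt_valuation_γ : 1 < valuation Fbar γ := by
  by_contra! h
  have h1 := congrArg (valuation Fbar) H.γ_eq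
  rw [map_mul, valuation_evalR_of_one_lt R H.one_lt_valuation_β, ← pow_succ'] at h1
  have h2 : valuation Fbar (γ ^ p - γ) ≤ 1 := 𝒪[Fbar].sub_mem (𝒪[Fbar].pow_mem h p) h
  rw [h1] at h2
  exact absurd (one_lt_pow₀ H.one_lt_valuation_β (Nat.succ_ne_zero _)) (not_lt.mpr h2)

theorem valuation_γ_pow :
    valuation Fbar γ ^ p = valuation Fbar β ^ (p ^ R.e + 1) := by
  rw [← valuation_pow_sub_self (Fact.out : p.Prime).one_lt H.one_lt_valuation_γ, H.γ_eq, map_mul,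
    valuation_evalR_of_one_lt R H.one_lt_valuation_β, ← pow_succ']

/-- The solutions `b` of `Ẽ(β + b) = Ẽ(β)` are integral, and satisfy `Ẽ(b) ≡ 0`, even after
multiplication by `β^{p^e}`. -/
theorem valuation_le_one_of_E_add_eq [CharP 𝓀[F] p] {b : Fbar}
    (hb : evalE p R.e Ã (β + b) = evalE p R.e Ã β) :
    valuation Fbar b ≤ 1 ∧ valuation Fbar (β ^ p ^ R.e * evalE p R.e Ã b) < 1 := by
  have hsub : ∀ c : Fbar, c * (evalE p R.e Ã (β + b) - evalE p R.e Ã β - evalE p R.e Ã b) =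
      -(c * evalE p R.e Ã b) := fun c => by rw [hb]; ring
  have hle : valuation Fbar b ≤ 1 := by
    by_contra! hcon
    have h := valuation_E_add_lt_pow H.cond₁ hcon
    rw [hsub, Valuation.map_neg, map_mul, valuation_evalE_of_one_lt R H.not_two_zero hcon,
      map_pow] at h
    exact absurd h (not_lt.mpr (le_mul_of_one_le_left' (one_le_pow₀ H.one_lt_valuation_β.le)))
  refine ⟨hle, ?_⟩
  have h := valuation_E_add_lt_one H.cond₁ hle
  rwa [hsub, Valuation.map_neg] at h

/-- The solutions of `Ẽ(β + b) = Ẽ(β)` are separated by reduction: a nonzero `b` in the maximal ideal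
has `v(Ẽ(b)) = v(b)`, which exceeds the value of `Ẽ(β + b) - Ẽ(β) - Ẽ(b)`. -/
theorem eq_zero_of_E_add_eq [CharP 𝓀[F] p] {b : Fbar}
    (hb : evalE p R.e Ã (β + b) = evalE p R.e Ã β) (hb1 : valuation Fbar b < 1) : b = 0 := by
  by_contra hb0
  have h := valuation_E_add_lt_self H.cond₁ hb1.le hb0
  have hsub : evalE p R.e Ã (β + b) - evalE p R.e Ã β - evalE p R.e Ã b =
      -evalE p R.e Ã b := by rw [hb]; ring
  rw [hsub, map_mul, Valuation.map_neg, map_pow,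
    valuation_evalE_of_lt_one R H.not_two_zero hb1] at h
  exact absurd h (not_lt.mpr (le_mul_of_one_le_left' (one_le_pow₀ H.one_lt_valuation_β.le)))

/-- If `γ + f̃(β,b) + c` solves the Artin–Schreier equation attached to `β + b`, then `c` is
integral, and solves the Artin–Schreier equation attached to `b` modulo the maximal ideal. -/
theorem valuation_le_one_of_artinSchreier {b c : Fbar}
    (hb : valuation Fbar b ≤ 1) (hEb : valuation Fbar (β ^ p ^ R.e * evalE p R.e Ã b) < 1)
    (hc : (γ + evalF p R.e Ã β b + c) ^ p - (γ + evalF p R.e Ã β b + c) =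
      (β + b) * evalR p R.e Ã (β + b)) :
    valuation Fbar c ≤ 1 ∧ valuation Fbar (c ^ p - c - b * evalR p R.e Ã b) < 1 := by
  set f := evalF p R.e Ã β b with hf
  set r := evalR p R.e Ã (β + b) - evalR p R.e Ã β - evalR p R.e Ã b with hr
  set D := (γ + f + c) ^ p - γ ^ p - f ^ p - c ^ p with hD
  set f₂ := f ^ p - f + β ^ p ^ R.e * evalE p R.e Ã b - b * evalR p R.e Ã β -
    β * evalR p R.e Ã b with hf₂
  have hv₁ : valuation Fbar (β * r) < 1 := valuation_R_add_lt_one H.cond₁ hb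
  have hv₂ : valuation Fbar f₂ < 1 := valuation_f_pow_lt_one H.cond₁ hb
  have hv₃ : valuation Fbar (b * r) < 1 := by
    have h1 : valuation Fbar r ≤ valuation Fbar (β * r) := by
      rw [map_mul]
      exact le_mul_of_one_le_left' H.one_lt_valuation_β.le
    rw [map_mul]
    exact (mul_le_of_le_one_left' hb).trans_lt (h1.trans_lt hv₁)
  have key : c ^ p - c - b * evalR p R.e Ã b =
      -D + (β * r + b * r - f₂ + β ^ p ^ R.e * evalE p R.e Ã b) := by
    linear_combination hc - H.γ_eq
  have hrest : valuation Fbar (β * r + b * r - f₂ + β ^ p ^ R.e * evalE p R.e Ã b) < 1 :=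
    Valuation.map_add_lt _ (Valuation.map_sub_lt _ (Valuation.map_add_lt _ hv₁ hv₃) hv₂) hEb
  have hle : valuation Fbar c ≤ 1 := by
    by_contra! hcon
    have hvD : valuation Fbar D < valuation Fbar c ^ p := valuation_γ_pow_lt_pow H.cond₁ hb hcon
    have hp1 : (1 : ValueGroupWithZero Fbar) < valuation Fbar c ^ p :=
      one_lt_pow₀ hcon (Fact.out : p.Prime).ne_zero
    have hbR : valuation Fbar (b * evalR p R.e Ã b) ≤ 1 :=
      𝒪[Fbar].mul_mem hb (evalR_mem_integer p R hb)
    have h1 : c ^ p - c = -D + (β * r + b * r - f₂ + β ^ p ^ R.e * evalE p R.e Ã b) +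
        b * evalR p R.e Ã b := by linear_combination key
    have h2 := valuation_pow_sub_self (Fact.out : p.Prime).one_lt hcon
    rw [h1] at h2
    refine absurd h2 (ne_of_lt (Valuation.map_add_lt _ (Valuation.map_add_lt _ ?_ ?_) ?_))
    · rwa [Valuation.map_neg]
    · exact hrest.trans hp1
    · exact hbR.trans_lt hp1
  refine ⟨hle, ?_⟩
  rw [key]
  refine Valuation.map_add_lt _ ?_ hrest
  rw [Valuation.map_neg]
  exact valuation_γ_pow_lt_one H.cond₁ hb hle

theorem eq_zero_of_artinSchreier {c : Fbar} (hc : (γ + c) ^ p - (γ + c) = γ ^ p - γ)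
    (hc1 : valuation Fbar c < 1) : c = 0 := by
  by_contra hc0
  have h := valuation_γ_pow_lt_self H.cond₁ hc1.le hc0
  have h1 : (γ + c) ^ p - γ ^ p - c ^ p = c - c ^ p := by linear_combination hc
  have hv : 0 < valuation Fbar c := zero_lt_iff.mpr (by simpa using hc0)
  rw [h1, Valuation.map_sub_eq_of_lt_left] at h
  · exact lt_irrefl _ h
  · rw [map_pow]
    exact pow_lt_self_of_lt_one₀ hv hc1 (Fact.out : p.Prime).one_lt

end Valuations

section Sigma

variable (H : IsAdmissible p R ϖ m α β γ) (σ τ : Fbar ≃ₐ[F] Fbar)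
include H

theorem aSigma_pow_d : aSigma α σ ^ R.d p = 1 := by
  rw [aSigma, div_pow, ← map_pow, H.α_pow, σ.commutes, div_self]
  rw [← H.α_pow]
  exact pow_ne_zero _ H.α_ne_zero

theorem aSigma_pow_pow_d : (aSigma α σ ^ m) ^ R.d p = 1 := by
  rw [← pow_mul, mul_comm, pow_mul, H.aSigma_pow_d, one_pow]

theorem aSigma_pow_pow_dm : (aSigma α σ ^ m) ^ R.dm p m = 1 := by
  have h : m * R.dm p m = R.d p * (m / Nat.gcd (R.d p) m) := by
    rw [AddPoly.dm, ← Nat.mul_div_assoc _ (Nat.gcd_dvd_left _ _),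
      ← Nat.mul_div_assoc _ (Nat.gcd_dvd_right _ _), mul_comm]
  rw [← pow_mul, h, pow_mul, H.aSigma_pow_d, one_pow]

theorem aSigma_mem : aSigma α σ ∈ 𝒪[Fbar] := by
  have h := congrArg (valuation Fbar) (H.aSigma_pow_d σ)
  rw [map_pow, map_one] at h
  exact ((pow_eq_one_iff_of_nonneg zero_le (R.d_ne_zero p)).mp h).le

theorem aSigma_mul_α : aSigma α σ * α = σ α := div_mul_cancel₀ _ H.α_ne_zero

theorem E_add_bSigma : evalE p R.e Ã (β + bSigma m α β σ) = evalE p R.e Ã β := by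
  have ha : aSigma α σ ^ m ≠ 0 := fun h => by
    have := H.aSigma_pow_pow_d σ
    rw [h, zero_pow (R.d_ne_zero p)] at this
    exact zero_ne_one this
  rw [β_add_bSigma, evalE_mul_eq (Fact.out : p.Prime).ne_zero (liftCoeffs_lead_ne_zero R)
    (pow_eq_one_of_liftCoeffs_ne_zero (H.aSigma_pow_pow_d σ)), ← map_evalE_lift, H.E_β, map_inv₀,
    map_pow, ← H.aSigma_mul_α σ, mul_pow, mul_inv, mul_inv_cancel_left₀ ha]

theorem bSigma_mem [CharP 𝓀[F] p] : bSigma m α β σ ∈ 𝒪[Fbar] :=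
  (H.valuation_le_one_of_E_add_eq (H.E_add_bSigma σ)).1

theorem artinSchreier_cSigma :
    (γ + evalF p R.e Ã β (bSigma m α β σ) + cSigma p R m α β γ σ) ^ p -
      (γ + evalF p R.e Ã β (bSigma m α β σ) + cSigma p R m α β γ σ) =
      (β + bSigma m α β σ) * evalR p R.e Ã (β + bSigma m α β σ) := by
  have h1 : γ + evalF p R.e Ã β (bSigma m α β σ) + cSigma p R m α β γ σ = σ γ := by
    rw [cSigma]; ring
  rw [h1, β_add_bSigma, mul_comm (aSigma α σ ^ m), mul_assoc,
    mul_comm (σ β) (aSigma α σ ^ m), mul_evalR_mul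
      (pow_eq_one_of_liftCoeffs_ne_zero (H.aSigma_pow_pow_d σ)), ← map_evalR_lift, ← map_mul,
    ← H.γ_eq, map_sub, map_pow]

theorem cSigma_spec [CharP 𝓀[F] p] : valuation Fbar (cSigma p R m α β γ σ) ≤ 1 ∧
    valuation Fbar (cSigma p R m α β γ σ ^ p - cSigma p R m α β γ σ -
      bSigma m α β σ * evalR p R.e Ã (bSigma m α β σ)) < 1 :=
  H.valuation_le_one_of_artinSchreier (H.bSigma_mem σ)
    (H.valuation_le_one_of_E_add_eq (H.E_add_bSigma σ)).2 (H.artinSchreier_cSigma σ)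

theorem cSigma_mem [CharP 𝓀[F] p] : cSigma p R m α β γ σ ∈ 𝒪[Fbar] := (H.cSigma_spec σ).1

theorem aSigma_mul : aSigma α (σ * τ) = aSigma α σ * σ (aSigma α τ) := by
  have h0 : σ α ≠ 0 := by simpa using H.α_ne_zero
  rw [aSigma, aSigma, aSigma, AlgEquiv.mul_apply, map_div₀, mul_comm, div_mul_div_cancel₀ h0]

theorem bSigma_mul : bSigma m α β (σ * τ) =
    bSigma m α β σ + aSigma α σ ^ m * σ (bSigma m α β τ) := by
  simp only [bSigma, H.aSigma_mul, AlgEquiv.mul_apply, map_sub, map_mul, map_pow]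
  ring

end Sigma

end IsAdmissible

/-- Modulo the maximal ideal, `f̃` is additive in its first argument at `β`. -/
theorem valuation_f_add_left_lt_one (h₂ : CongruenceConditions₂ (F := F) p R β) {b y : Fbar}
    (hb : valuation Fbar b ≤ 1) (hy : valuation Fbar y ≤ 1) :
    valuation Fbar (evalF p R.e Ã (β + b) y - evalF p R.e Ã β y - evalF p R.e Ã b y) < 1 := by
  have hmul : ∀ u v : Fbar, valuation Fbar u ≤ 1 → valuation Fbar v < 1 →
      valuation Fbar (u * v) < 1 := fun u v hu hv => by
    rw [map_mul]
    exact mul_lt_one_of_nonneg_of_lt_one_right hu zero_le hv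
  have h1 : evalF p R.e Ã (β + b) y - evalF p R.e Ã β y - evalF p R.e Ã b y =
      -∑ i ∈ Finset.range R.e,
        ((∑ j ∈ Finset.range (R.e - i), (Ã i * y) ^ p ^ j *
          ((β + b) ^ p ^ (i + j) - (β ^ p ^ (i + j) + b ^ p ^ (i + j)))) +
        evalR p R.e Ã y ^ p ^ i * ((β + b) ^ p ^ i - (β ^ p ^ i + b ^ p ^ i))) := by
    simp only [evalF, mul_sub, mul_add, Finset.sum_add_distrib, Finset.sum_sub_distrib, mul_pow,
      pow_add, pow_mul]
    have hc : ∀ z : Fbar, (∑ i ∈ Finset.range R.e, ∑ j ∈ Finset.range (R.e - i),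
        Ã i ^ p ^ j * (z ^ p ^ i) ^ p ^ j * y ^ p ^ j) =
        ∑ i ∈ Finset.range R.e, ∑ j ∈ Finset.range (R.e - i),
        Ã i ^ p ^ j * y ^ p ^ j * (z ^ p ^ i) ^ p ^ j := fun z =>
      Finset.sum_congr rfl fun i _ => Finset.sum_congr rfl fun j _ => by ring
    have hd : ∀ z : Fbar, (∑ i ∈ Finset.range R.e, z ^ p ^ i * evalR p R.e Ã y ^ p ^ i) =
        ∑ i ∈ Finset.range R.e, evalR p R.e Ã y ^ p ^ i * z ^ p ^ i := fun z =>
      Finset.sum_congr rfl fun i _ => by ring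
    rw [hc, hc, hc, hd, hd, hd]
    ring
  rw [h1, Valuation.map_neg]
  refine Valuation.map_sum_lt _ one_ne_zero fun i hi => ?_
  have hi' := Finset.mem_range.mp hi
  refine Valuation.map_add_lt _ (Valuation.map_sum_lt _ one_ne_zero fun j hj => ?_) ?_
  · have hj' := Finset.mem_range.mp hj
    exact hmul _ _ (𝒪[Fbar].pow_mem (𝒪[Fbar].mul_mem (valuation_liftCoeffs_le_one R i) hy) _)
      (valuation_pow_add_lt_one h₂ (by omega) hb)
  · exact hmul _ _ (𝒪[Fbar].pow_mem (evalR_mem_integer p R hy) _)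
      (valuation_pow_add_lt_one h₂ hi' hb)

theorem IsAdmissible.valuation_cSigma_mul_lt_one [CharP 𝓀[F] p] [Algebra.IsAlgebraic F Fbar]
    (H : IsAdmissible p R ϖ m α β γ) (σ τ : Fbar ≃ₐ[F] Fbar) :
    valuation Fbar (cSigma p R m α β γ (σ * τ) - (cSigma p R m α β γ σ +
      σ (cSigma p R m α β γ τ) +
      evalF p R.e Ã (bSigma m α β σ) (aSigma α σ ^ m * σ (bSigma m α β τ)))) < 1 := by
  set y := aSigma α σ ^ m * σ (bSigma m α β τ) with hy
  have hyv : y ∈ 𝒪[Fbar] := 𝒪[Fbar].mul_mem (𝒪[Fbar].pow_mem (H.aSigma_mem σ) m)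
    (algEquiv_mem_integer σ (H.bSigma_mem τ))
  have h1 : σ (evalF p R.e Ã β (bSigma m α β τ)) = evalF p R.e Ã (β + bSigma m α β σ) y := by
    rw [map_evalF_lift, β_add_bSigma, hy, evalF_mul_mul
      (pow_eq_one_of_liftCoeffs_ne_zero (H.aSigma_pow_pow_d σ))]
  have h2 : cSigma p R m α β γ (σ * τ) - (cSigma p R m α β γ σ +
      σ (cSigma p R m α β γ τ) + evalF p R.e Ã (bSigma m α β σ) y) =
      (evalF p R.e Ã (β + bSigma m α β σ) y - evalF p R.e Ã β y -
        evalF p R.e Ã (bSigma m α β σ) y) -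
      (evalF p R.e Ã β (bSigma m α β σ + y) - evalF p R.e Ã β (bSigma m α β σ) -
        evalF p R.e Ã β y) := by
    rw [← h1, hy, ← H.bSigma_mul]
    simp only [cSigma, map_sub, AlgEquiv.mul_apply]
    ring
  rw [h2]
  exact Valuation.map_sub_lt _ (valuation_f_add_left_lt_one H.cond₂ (H.bSigma_mem σ) hyv)
    (valuation_f_add_right_lt_one H.cond₂ (H.bSigma_mem σ) hyv)

end LocalFieldExt

/-! ### The homomorphism from the Galois group to `Q_{R,m}` and its kernel -/

namespace LocalFieldExt

variable {F : Type*} [Field F] [ValuativeRel F] [TopologicalSpace F] [IsNonarchimedeanLocalField F]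
  {Fbar : Type*} [Field Fbar] [Algebra F Fbar] [ValuativeRel Fbar] [ValuativeExtension F Fbar]
  {p : ℕ} [Fact p.Prime] [CharP 𝓀[F] p] {R : AddPoly 𝓀[F]} {ϖ : 𝒪[F]} {m : ℕ} {α β γ : Fbar}

local notation "Ã" => liftCoeffs F Fbar R

namespace IsAdmissible

variable (H : IsAdmissible p R ϖ m α β γ)

/-- The element `(ā_σ^m, b̄_σ, c̄_σ)` of `Q_{R,m}`. -/
noncomputable def toQR (σ : Fbar ≃ₐ[F] Fbar) : QR.sub p R 𝓀[Fbar] m where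
  val :=
    { α := IsLocalRing.residue 𝒪[Fbar] ⟨_, H.aSigma_mem σ⟩ ^ m
      β := IsLocalRing.residue 𝒪[Fbar] ⟨_, H.bSigma_mem σ⟩
      γ := IsLocalRing.residue 𝒪[Fbar] ⟨_, H.cSigma_mem σ⟩
      α_pow := by
        rw [← map_pow, ← map_pow, ← map_one (IsLocalRing.residue 𝒪[Fbar])]
        congr 1
        exact Subtype.ext (H.aSigma_pow_pow_d σ)
      E_β := by
        rw [← residue_evalE, residue_eq_zero_iff]
        have h := (H.valuation_le_one_of_E_add_eq (H.E_add_bSigma σ)).2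
        rw [map_mul, map_pow] at h
        exact (le_mul_of_one_le_left' (one_le_pow₀ H.one_lt_valuation_β.le)).trans_lt h
      γ_eq := by
        rw [← residue_evalR, ← map_pow, ← map_sub, ← map_mul, residue_eq_iff]
        exact (H.cSigma_spec σ).2 }
  property := by
    change (IsLocalRing.residue 𝒪[Fbar] ⟨_, H.aSigma_mem σ⟩ ^ m) ^ R.dm p m = 1
    rw [← map_pow, ← map_pow, ← map_one (IsLocalRing.residue 𝒪[Fbar])]
    congr 1
    exact Subtype.ext (H.aSigma_pow_pow_dm σ)

variable [Algebra.IsAlgebraic F Fbar]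

theorem toQR_mul (σ τ : Fbar ≃ₐ[F] Fbar) :
    H.toQR (σ * τ) = H.toQR σ * QR.galAction m (residueAut σ) (H.toQR τ) := by
  apply Subtype.ext
  have hα : IsLocalRing.residue 𝒪[Fbar] ⟨_, H.aSigma_mem (σ * τ)⟩ =
      IsLocalRing.residue 𝒪[Fbar] ⟨_, H.aSigma_mem σ⟩ *
        residueAut σ (IsLocalRing.residue 𝒪[Fbar] ⟨_, H.aSigma_mem τ⟩) := by
    rw [residueAut_residue, ← map_mul]
    congr 1
    exact Subtype.ext (H.aSigma_mul σ τ)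
  ext
  · change IsLocalRing.residue 𝒪[Fbar] ⟨_, H.aSigma_mem (σ * τ)⟩ ^ m =
      IsLocalRing.residue 𝒪[Fbar] ⟨_, H.aSigma_mem σ⟩ ^ m *
        residueAut σ (IsLocalRing.residue 𝒪[Fbar] ⟨_, H.aSigma_mem τ⟩ ^ m)
    rw [hα, mul_pow, map_pow]
  · change IsLocalRing.residue 𝒪[Fbar] ⟨_, H.bSigma_mem (σ * τ)⟩ =
      IsLocalRing.residue 𝒪[Fbar] ⟨_, H.bSigma_mem σ⟩ +
        IsLocalRing.residue 𝒪[Fbar] ⟨_, H.aSigma_mem σ⟩ ^ m *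
        residueAut σ (IsLocalRing.residue 𝒪[Fbar] ⟨_, H.bSigma_mem τ⟩)
    rw [residueAut_residue, ← map_pow, ← map_mul, ← map_add]
    congr 1
    exact Subtype.ext (H.bSigma_mul σ τ)
  · change IsLocalRing.residue 𝒪[Fbar] ⟨_, H.cSigma_mem (σ * τ)⟩ =
      IsLocalRing.residue 𝒪[Fbar] ⟨_, H.cSigma_mem σ⟩ +
        residueAut σ (IsLocalRing.residue 𝒪[Fbar] ⟨_, H.cSigma_mem τ⟩) +
        evalF p R.e (R.coeffs 𝓀[Fbar]) (IsLocalRing.residue 𝒪[Fbar] ⟨_, H.bSigma_mem σ⟩)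
          (IsLocalRing.residue 𝒪[Fbar] ⟨_, H.aSigma_mem σ⟩ ^ m *
            residueAut σ (IsLocalRing.residue 𝒪[Fbar] ⟨_, H.bSigma_mem τ⟩))
    rw [residueAut_residue, residueAut_residue, ← map_pow, ← map_mul]
    erw [← residue_evalF p R (H.bSigma_mem σ) (𝒪[Fbar].mul_mem (𝒪[Fbar].pow_mem (H.aSigma_mem σ) m)
      (algEquiv_mem_integer σ (H.bSigma_mem τ)))]
    rw [← map_add, ← map_add, residue_eq_iff]
    exact H.valuation_cSigma_mul_lt_one σ τ

/-- The homomorphism `σ ↦ ((ā_σ^m, b̄_σ, c̄_σ), σ̄)`, where `σ̄` is the action of `σ` on the residue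
field. -/
noncomputable def galHom : (Fbar ≃ₐ[F] Fbar) →*
    QR.sub p R 𝓀[Fbar] m ⋊[QR.galAction m] (𝓀[Fbar] ≃ₐ[𝓀[F]] 𝓀[Fbar]) :=
  MonoidHom.mk' (fun σ => ⟨H.toQR σ, residueAut σ⟩) fun σ τ =>
    SemidirectProduct.ext (H.toQR_mul σ τ) (map_mul residueAut σ τ)

variable [IsGalois F Fbar] [IsSepClosed Fbar]
include H

/-- The kernel of `galHom` is `Gal(F̄/L)`: an element of the kernel fixes `F^ur` and `α^m`,
and `b_σ ≡ 0`, `c_σ ≡ 0` force `b_σ = 0` and `c_σ = 0`. -/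
theorem ker_galHom : H.galHom.ker = (fieldL F Fbar m α β γ).fixingSubgroup := by
  have hchar : CharP 𝓀[Fbar] p := charP_residueField F
  have hα0 := H.α_ne_zero
  ext σ
  rw [fieldL, IntermediateField.fixingSubgroup_sup, Subgroup.mem_inf,
    mem_fixingSubgroup_adjoin_iff, ← residueAut_eq_one_iff, MonoidHom.mem_ker]
  constructor
  · intro h
    have hres : residueAut σ = 1 := congrArg SemidirectProduct.right h
    have hq : (H.toQR σ).1 = 1 := congrArg (fun x => x.left.1) h
    have ha : IsLocalRing.residue 𝒪[Fbar] ⟨_, H.aSigma_mem σ⟩ ^ m = 1 := congrArg QR.α hq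
    have hb : IsLocalRing.residue 𝒪[Fbar] ⟨_, H.bSigma_mem σ⟩ = 0 := congrArg QR.β hq
    have hc : IsLocalRing.residue 𝒪[Fbar] ⟨_, H.cSigma_mem σ⟩ = 0 := congrArg QR.γ hq
    have ha' : aSigma α σ ^ m = 1 := by
      rw [← map_pow, ← map_one (IsLocalRing.residue 𝒪[Fbar]), residue_eq_iff] at ha
      refine tameRoots_eq_of_valuation_sub_lt_one (p := p)
        ⟨R.d p, Nat.pos_of_ne_zero (R.d_ne_zero p), coprime_d H.not_two_zero,
          H.aSigma_pow_pow_d σ⟩ ⟨1, one_pos, by simp, by simp⟩ ha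
    have hb' : bSigma m α β σ = 0 :=
      H.eq_zero_of_E_add_eq (H.E_add_bSigma σ) ((residue_eq_zero_iff _).mp hb)
    have hβ : σ β = β := by
      have h1 := β_add_bSigma (m := m) (α := α) (β := β) σ
      rw [hb', add_zero, ha', one_mul] at h1
      exact h1.symm
    have hc' : cSigma p R m α β γ σ = 0 := by
      refine H.eq_zero_of_artinSchreier ?_ ((residue_eq_zero_iff _).mp hc)
      have h1 := H.artinSchreier_cSigma σ
      rw [hb', evalF_zero_right, add_zero, add_zero] at h1
      rw [h1, H.γ_eq]
    have hγ : σ γ = γ := by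
      rw [cSigma, hb', evalF_zero_right, sub_zero, sub_eq_zero] at hc'
      exact hc'
    refine ⟨hres, ?_⟩
    rintro x (rfl | rfl | rfl)
    · rw [map_pow, ← H.aSigma_mul_α, mul_pow, ha', one_mul]
    · exact hβ
    · exact hγ
  · rintro ⟨hres, hx⟩
    have hα : σ (α ^ m) = α ^ m := hx _ (by simp)
    have hβ : σ β = β := hx _ (by simp)
    have hγ : σ γ = γ := hx _ (by simp)
    have ha : aSigma α σ ^ m = 1 := by
      rw [aSigma, div_pow, ← map_pow, hα, div_self (pow_ne_zero _ hα0)]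
    have hb : bSigma m α β σ = 0 := by rw [bSigma, ha, hβ]; ring
    have hc : cSigma p R m α β γ σ = 0 := by rw [cSigma, hb, hγ, evalF_zero_right]; ring
    refine SemidirectProduct.ext (Subtype.ext (QR.ext ?_ ?_ ?_)) hres
    · change IsLocalRing.residue 𝒪[Fbar] ⟨_, H.aSigma_mem σ⟩ ^ m = 1
      rw [← map_pow, ← map_one (IsLocalRing.residue 𝒪[Fbar])]
      congr 1
      exact Subtype.ext ha
    · change IsLocalRing.residue 𝒪[Fbar] ⟨_, H.bSigma_mem σ⟩ = 0
      rw [residue_eq_zero_iff]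
      simp [hb]
    · change IsLocalRing.residue 𝒪[Fbar] ⟨_, H.cSigma_mem σ⟩ = 0
      rw [residue_eq_zero_iff]
      simp [hc]

theorem isGalois_fieldL : IsGalois F (fieldL F Fbar m α β γ) := by
  have h : (fieldL F Fbar m α β γ).fixingSubgroup.Normal := by
    rw [← H.ker_galHom]
    infer_instance
  exact (InfiniteGalois.normal_iff_isGalois _).mp h

end IsAdmissible

end LocalFieldExt

namespace LocalFieldExt

/-! ### Values of linear combinations of powers -/

section Bezout

variable {F : Type*} [Field F] {K : Type*} [Field K] [Algebra F K]
  {Γ : Type*} [LinearOrderedCommGroupWithZero Γ] (v : Valuation K Γ)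

/-- If `v(x) = v(t)^{s/n}` with `s/n` in lowest terms, then a product of powers of `x` and `t` has
value `v(t)^{1/n}`. -/
theorem exists_pow_eq_of_coprime (L : IntermediateField F K) {t x : K} (ht : t ∈ L) (ht0 : t ≠ 0)
    (hx : x ∈ L) (hx0 : x ≠ 0) {n : ℕ} {s : ℤ} (hns : IsCoprime (n : ℤ) s)
    (h : v x ^ n = v t ^ s) : ∃ y ∈ L, y ≠ 0 ∧ v y ^ n = v t := by
  obtain ⟨u, w, huw⟩ := hns
  have hvt : v t ≠ 0 := by simpa using ht0
  refine ⟨t ^ u * x ^ w, mul_mem (zpow_mem ht _) (zpow_mem hx _),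
    mul_ne_zero (zpow_ne_zero _ ht0) (zpow_ne_zero _ hx0), ?_⟩
  rw [map_mul, map_zpow₀, map_zpow₀, mul_pow, ← zpow_natCast, ← zpow_natCast, ← zpow_mul,
    ← zpow_mul, mul_comm w, zpow_mul, zpow_mul (v x), zpow_natCast (v x), h, ← zpow_mul, ← zpow_mul,
    ← zpow_add₀ hvt, mul_comm s w, huw, zpow_one]

/-- If `v(t)^{1/a}` and `v(t)^{1/b}` are values of `L`, with `a` and `b` coprime, then so is
`v(t)^{1/(ab)}`. -/
theorem exists_pow_mul_eq_of_coprime (L : IntermediateField F K) {t x y : K} (ht0 : t ≠ 0)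
    (hx : x ∈ L) (hx0 : x ≠ 0) (hy : y ∈ L) (hy0 : y ≠ 0) {a b : ℕ} (hab : a.Coprime b)
    (hxa : v x ^ a = v t) (hyb : v y ^ b = v t) : ∃ z ∈ L, z ≠ 0 ∧ v z ^ (a * b) = v t := by
  obtain ⟨u, w, huw⟩ := Nat.isCoprime_iff_coprime.mpr hab
  have hvt : v t ≠ 0 := by simpa using ht0
  refine ⟨x ^ w * y ^ u, mul_mem (zpow_mem hx _) (zpow_mem hy _),
    mul_ne_zero (zpow_ne_zero _ hx0) (zpow_ne_zero _ hy0), ?_⟩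
  have h1 : (v x ^ w) ^ (a * b) = v t ^ (w * b) := by
    rw [← hxa, ← zpow_natCast, ← zpow_natCast, ← zpow_mul, ← zpow_mul]
    congr 1; push_cast; ring
  have h2 : (v y ^ u) ^ (a * b) = v t ^ (u * a) := by
    rw [← hyb, ← zpow_natCast, ← zpow_natCast, ← zpow_mul, ← zpow_mul]
    congr 1; push_cast; ring
  rw [map_mul, map_zpow₀, map_zpow₀, mul_pow, h1, h2, ← zpow_add₀ hvt, add_comm, huw, zpow_one]

theorem zpow_injective_of_lt_one {ρ : Γ} (h0 : ρ ≠ 0) (h1 : ρ < 1) :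
    Function.Injective (fun n : ℤ => ρ ^ n) :=
  (zpow_right_strictAnti₀ (zero_lt_iff.mpr h0) h1).injective

/-- If the values of the nonzero elements of `M` are powers of `v(π)^N`, then a nonzero
`M`-linear combination of `1, π, …, π^{N-1}` has the value of one of its terms, as these
have distinct values. -/
theorem exists_valuation_sum_eq (M : IntermediateField F K) {π : K} {N : ℕ} (hπ0 : π ≠ 0)
    (hπ1 : v π < 1) (hM : ∀ x ∈ M, x ≠ 0 → ∃ z : ℤ, v x = (v π ^ N) ^ z)
    (c : Fin N → M) (hc : c ≠ 0) :
    ∃ i, c i ≠ 0 ∧ v (∑ j, (c j : K) * π ^ (j : ℕ)) = v ((c i : K) * π ^ (i : ℕ)) := by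
  classical
  have hvπ : v π ≠ 0 := by simpa using hπ0
  have hterm : ∀ i, c i ≠ 0 → ∃ z : ℤ, v ((c i : K) * π ^ (i : ℕ)) = v π ^ (N * z + i) := by
    intro i hi
    obtain ⟨z, hz⟩ := hM (c i) (c i).2 (by simpa using hi)
    refine ⟨z, ?_⟩
    rw [map_mul, hz, map_pow, zpow_add₀ hvπ, zpow_mul, zpow_natCast, zpow_natCast]
  obtain ⟨i₀, hi₀⟩ := Function.ne_iff.mp hc
  obtain ⟨i, hi, hmax⟩ := (Finset.univ.filter fun i => c i ≠ 0).exists_max_image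
    (fun i => v ((c i : K) * π ^ (i : ℕ))) ⟨i₀, by simpa using hi₀⟩
  have hi' : c i ≠ 0 := by simpa using hi
  refine ⟨i, hi', ?_⟩
  refine Valuation.map_sum_eq_of_lt v (Finset.mem_univ i) fun j hj => ?_
  have hji : j ≠ i := by simpa using hj
  by_cases hcj : c j = 0
  · rw [hcj]
    simpa [hπ0, zero_lt_iff] using hi'
  refine lt_of_le_of_ne (hmax j (by simpa using hcj)) fun heq => hji ?_
  obtain ⟨a, ha⟩ := hterm i hi'
  obtain ⟨b, hb⟩ := hterm j hcj
  rw [ha, hb] at heq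
  -- equal values would give `N a + i = N b + j`, hence `i = j` as both are less than `N`
  have h := zpow_injective_of_lt_one hvπ hπ1 heq
  have h1 := congrArg (· % (N : ℤ)) h
  simp only [Int.mul_add_emod_self_left] at h1
  rw [Int.emod_eq_of_lt (by omega) (by omega), Int.emod_eq_of_lt (by omega) (by omega)] at h1
  exact Fin.ext (by exact_mod_cast h1)

end Bezout

/-! ### The order of `Q_{R,m}` -/

section Card

variable {k : Type*} [Field k] {p : ℕ} [Fact p.Prime] [CharP k p] {𝔽 : Type*} [Field 𝔽]
  [Algebra k 𝔽]

theorem dm_pos (R : AddPoly k) (p m : ℕ) : 0 < R.dm p m :=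
  Nat.div_pos (Nat.le_of_dvd (Nat.pos_of_ne_zero (R.d_ne_zero p)) (Nat.gcd_dvd_left _ _))
    (Nat.gcd_pos_of_pos_left _ (Nat.pos_of_ne_zero (R.d_ne_zero p)))

open Polynomial in
/-- The derivative of `E_R` is `a_e` if `e > 0`, and `2 a_0` if `e = 0`. -/
theorem evalE_polynomial_ne_zero (R : AddPoly k) (hpe : ¬(p = 2 ∧ R.e = 0)) :
    evalE p R.e (fun i => C (R.coeffs 𝔽 i)) X ≠ 0 := by
  have hchar : CharP 𝔽 p := charP_of_injective_algebraMap (algebraMap k 𝔽).injective p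
  have ha : R.coeffs 𝔽 R.e ≠ 0 := by simpa [AddPoly.coeffs] using R.lead_ne_zero
  have hpow : ∀ (f : 𝔽[X]) (n : ℕ), n ≠ 0 → derivative (f ^ p ^ n) = 0 := by
    intro f n hn
    rw [derivative_pow]
    simp [hn]
  intro h
  have hd := congrArg derivative h
  rw [evalE, derivative_add, derivative_sum, Finset.sum_range_succ,
    Finset.sum_eq_zero fun i hi => hpow _ _ (by have := Finset.mem_range.mp hi; omega)] at hd
  rcases Nat.eq_zero_or_pos R.e with he | he
  · have h2 : (2 : 𝔽) ≠ 0 := by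
      intro h2
      have : ((2 : ℕ) : 𝔽) = 0 := by exact_mod_cast h2
      rw [CharP.cast_eq_zero_iff 𝔽 p, Nat.prime_dvd_prime_iff_eq Fact.out Nat.prime_two] at this
      exact hpe ⟨this, he⟩
    rw [he] at ha
    simp [he, evalR] at hd
    rw [← C_add, C_eq_zero, ← two_mul] at hd
    exact mul_ne_zero h2 ha hd
  · rw [hpow _ _ he.ne'] at hd
    simp at hd
    exact ha hd

open Polynomial in
/-- `Q_{R,m}` has at most `d_{R,m} p^{2e+1}` elements: the coordinates are roots of polynomials
of degrees `d_{R,m}`, at most `p^{2e}`, and `p`. -/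
theorem finite_sub_and_card_le (R : AddPoly k) (hpe : ¬(p = 2 ∧ R.e = 0)) (m : ℕ) :
    Finite (QR.sub p R 𝔽 m) ∧ Nat.card (QR.sub p R 𝔽 m) ≤ R.dm p m * p ^ (2 * R.e + 1) := by
  classical
  have hp1 : 1 < p := (Fact.out : p.Prime).one_lt
  let PE : 𝔽[X] := evalE p R.e (fun i => C (R.coeffs 𝔽 i)) X
  let PC : 𝔽 → 𝔽[X] := fun b => X ^ p - (X + C (b * evalR p R.e (R.coeffs 𝔽) b))
  have hPE0 : PE ≠ 0 := evalE_polynomial_ne_zero R hpe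
  have hdeg : ∀ b, (X + C (b * evalR p R.e (R.coeffs 𝔽) b) : 𝔽[X]).degree < (p : ℕ) := fun b => by
    rw [degree_X_add_C]; exact_mod_cast hp1
  have hPC0 : ∀ b, PC b ≠ 0 := fun b => (monic_X_pow_sub (hdeg b)).ne_zero
  let A : Finset 𝔽 := (nthRoots (R.dm p m) (1 : 𝔽)).toFinset
  let B : Finset 𝔽 := PE.roots.toFinset
  let D : 𝔽 → Finset 𝔽 := fun b => (PC b).roots.toFinset
  let S := A ×ˢ B.sigma D
  have hA : A.card ≤ R.dm p m := (Multiset.toFinset_card_le _).trans (card_nthRoots _ _)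
  have hB : B.card ≤ p ^ (2 * R.e) := (Multiset.toFinset_card_le _).trans
    ((card_roots' _).trans (natDegree_evalE_le p R.e (Fact.out : p.Prime).pos _ natDegree_X_le))
  have hD : ∀ b ∈ B, (D b).card ≤ p := fun b _ => (Multiset.toFinset_card_le _).trans
    ((card_roots' _).trans ((natDegree_sub_le _ _).trans
      (max_le (natDegree_X_pow_le p) (natDegree_le_of_degree_le (hdeg b).le))))
  have hS : S.card ≤ R.dm p m * p ^ (2 * R.e + 1) := by
    rw [Finset.card_product, Finset.card_sigma, pow_succ]
    refine Nat.mul_le_mul hA ((Finset.sum_le_card_nsmul _ _ _ hD).trans ?_)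
    rw [smul_eq_mul]
    exact Nat.mul_le_mul_right _ hB
  have hmem : ∀ g : QR.sub p R 𝔽 m, (g.1.α, (⟨g.1.β, g.1.γ⟩ : Σ _ : 𝔽, 𝔽)) ∈ S := by
    rintro ⟨g, hg⟩
    have hg' : g.α ^ R.dm p m = 1 := hg
    simp only [S, A, B, D, Finset.mem_product, Finset.mem_sigma, Multiset.mem_toFinset]
    refine ⟨(mem_nthRoots (dm_pos R p m)).mpr hg', (mem_roots hPE0).mpr ?_,
      (mem_roots (hPC0 _)).mpr ?_⟩
    · have h := map_evalE (evalRingHom g.β) p R.e (fun i => C (R.coeffs 𝔽 i)) X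
      simp only [coe_evalRingHom, eval_C, eval_X] at h
      rw [IsRoot, h, g.E_β]
    · simp only [PC, IsRoot, eval_sub, eval_pow, eval_X, eval_add, eval_C]
      rw [← g.γ_eq]
      ring
  let f : QR.sub p R 𝔽 m → S := fun g => ⟨_, hmem g⟩
  have hf : Function.Injective f := by
    rintro ⟨g, hg⟩ ⟨h, hh⟩ hgh
    have h1 := congrArg Subtype.val hgh
    simp only [f, Prod.mk.injEq, Sigma.mk.injEq, heq_eq_eq] at h1
    exact Subtype.ext (QR.ext h1.1 h1.2.1 h1.2.2)
  refine ⟨Finite.of_injective f hf, (Nat.card_le_card_of_injective f hf).trans ?_⟩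
  rwa [Nat.card_eq_fintype_card, Fintype.card_coe]

end Card

end LocalFieldExt

namespace LocalFieldExt

/-! ### The extension `L/F^ur`: degree, Galois group and ramification -/

variable {F : Type*} [Field F] [ValuativeRel F] [TopologicalSpace F] [IsNonarchimedeanLocalField F]
  {Fbar : Type*} [Field Fbar] [Algebra F Fbar] [ValuativeRel Fbar] [ValuativeExtension F Fbar]
  {p : ℕ} [Fact p.Prime] [CharP 𝓀[F] p] {R : AddPoly 𝓀[F]} {ϖ : 𝒪[F]} {m : ℕ} {α β γ : Fbar}

/-- The values of the nonzero elements of `F^ur` are the powers of the value of a uniformizer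
of `F`. -/
theorem exists_zpow_valuation_eq_of_mem_maxUnramified [IsGalois F Fbar] [IsSepClosed Fbar]
    (hϖ : Irreducible ϖ) {x : Fbar}
    (hx : x ∈ maxUnramified F Fbar) (hx0 : x ≠ 0) :
    ∃ z : ℤ, valuation Fbar x = valuation Fbar (algebraMap F Fbar (ϖ : F)) ^ z := by
  obtain ⟨y, hy⟩ := exists_valuation_eq_of_mem_maxUnramified hx
  have hy0 : y ≠ 0 := by
    rintro rfl
    rw [map_zero, map_zero] at hy
    exact hx0 ((valuation Fbar).zero_iff.mp hy)
  have hint : ∀ y : 𝒪[F], y ≠ 0 → ∃ z : ℤ, valuation Fbar (algebraMap F Fbar (y : F)) =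
      valuation Fbar (algebraMap F Fbar (ϖ : F)) ^ z := by
    intro y hy0
    obtain ⟨n, u, hu⟩ := IsDiscreteValuationRing.eq_unit_mul_pow_irreducible hy0 hϖ
    refine ⟨n, ?_⟩
    have hv1 : valuation F ((u : 𝒪[F]) : F) = 1 :=
      (Valuation.integer.integers (valuation F)).isUnit_iff_valuation_eq_one.mp u.isUnit
    have hv : valuation Fbar (algebraMap F Fbar ((u : 𝒪[F]) : F)) = 1 := by
      refine le_antisymm ((valuation_algebraMap_le_one_iff F _).mpr hv1.le) (not_lt.mp fun h => ?_)
      rw [valuation_algebraMap_lt_one_iff F] at h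
      exact h.ne hv1
    rw [hu, Subring.coe_mul, Subring.coe_pow, map_mul, map_mul, hv, one_mul, map_pow, map_pow,
      zpow_natCast]
  rcases le_total (valuation F y) 1 with h | h
  · rw [hy]
    exact hint ⟨y, h⟩ fun h0 => hy0 (congrArg Subtype.val h0)
  · have h' : valuation F y⁻¹ ≤ 1 := by
      rw [map_inv₀]
      exact inv_le_one_of_one_le₀ h
    obtain ⟨z, hz⟩ := hint ⟨y⁻¹, h'⟩ fun h0 => hy0 (by simpa using congrArg Subtype.val h0)
    refine ⟨-z, ?_⟩
    rw [zpow_neg, ← hz, hy]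
    simp

namespace IsAdmissible

variable (H : IsAdmissible p R ϖ m α β γ)
include H

theorem uniformizer_ne_zero : algebraMap F Fbar (ϖ : F) ≠ 0 := by
  rw [← H.α_pow]
  exact pow_ne_zero _ H.α_ne_zero

theorem α_pow_mem_fieldL : α ^ m ∈ fieldL F Fbar m α β γ :=
  (le_sup_right : _ ≤ fieldL F Fbar m α β γ) (IntermediateField.subset_adjoin F _ (by simp))

theorem γ_mem_fieldL : γ ∈ fieldL F Fbar m α β γ :=
  (le_sup_right : _ ≤ fieldL F Fbar m α β γ) (IntermediateField.subset_adjoin F _ (by simp))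

theorem maxUnramified_le_fieldL : maxUnramified F Fbar ≤ fieldL F Fbar m α β γ := le_sup_left

/-- `L` contains an element `π` with `v(π)^N = v(ϖ)`, `N = d_{R,m} p^{2e+1}`. The powers of `α^m`
and `ϖ` provide the factor `d_{R,m}`, those of `γ` and `ϖ` the factor `p^{2e+1}`. -/
theorem exists_uniformizer_fieldL : ∃ π ∈ fieldL F Fbar m α β γ, π ≠ 0 ∧
    valuation Fbar π ^ (R.dm p m * p ^ (2 * R.e + 1)) =
      valuation Fbar (algebraMap F Fbar (ϖ : F)) := by
  have ht0 := H.uniformizer_ne_zero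
  have ht : algebraMap F Fbar (ϖ : F) ∈ fieldL F Fbar m α β γ :=
    IntermediateField.algebraMap_mem _ _
  have hd := Nat.pos_of_ne_zero (R.d_ne_zero p)
  have hγ0 : γ ≠ 0 := fun h => by
    have := H.one_lt_valuation_γ
    rw [h, map_zero] at this
    exact absurd this (by simp)
  have hdp : (R.d p).Coprime p := coprime_d H.not_two_zero
  have hdm : (R.dm p m).Coprime (p ^ (2 * R.e + 1)) :=
    Nat.Coprime.pow_right _ (hdp.coprime_dvd_left (Nat.div_dvd_of_dvd (Nat.gcd_dvd_left _ _)))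
  have hvα : valuation Fbar α ^ R.d p = valuation Fbar (algebraMap F Fbar (ϖ : F)) := by
    rw [← map_pow, H.α_pow]
  obtain ⟨x, hxL, hx0, hx⟩ : ∃ x ∈ fieldL F Fbar m α β γ, x ≠ 0 ∧
      valuation Fbar x ^ R.dm p m = valuation Fbar (algebraMap F Fbar (ϖ : F)) := by
    refine exists_pow_eq_of_coprime _ _ ht ht0 H.α_pow_mem_fieldL (pow_ne_zero m H.α_ne_zero)
      (s := (m / Nat.gcd (R.d p) m : ℕ)) ?_ ?_
    · exact Nat.isCoprime_iff_coprime.mpr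
        (Nat.coprime_div_gcd_div_gcd (Nat.gcd_pos_of_pos_left _ hd))
    · have h : m * R.dm p m = R.d p * (m / Nat.gcd (R.d p) m) := by
        rw [AddPoly.dm, ← Nat.mul_div_assoc _ (Nat.gcd_dvd_left _ _),
          ← Nat.mul_div_assoc _ (Nat.gcd_dvd_right _ _), mul_comm]
      rw [map_pow, ← pow_mul, h, pow_mul, hvα, zpow_natCast]
  obtain ⟨k, hk⟩ := R.d_dvd p le_rfl R.lead_ne_zero
  have hkp : k.Coprime p := by
    have h1 : (p ^ R.e + 1).Coprime p := coprime_pow_add_one H.not_two_zero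
    exact h1.coprime_dvd_left ⟨R.d p, by rw [hk, mul_comm]⟩
  obtain ⟨y, hyL, hy0, hy⟩ : ∃ y ∈ fieldL F Fbar m α β γ, y ≠ 0 ∧
      valuation Fbar y ^ p ^ (2 * R.e + 1) = valuation Fbar (algebraMap F Fbar (ϖ : F)) := by
    refine exists_pow_eq_of_coprime _ _ ht ht0 H.γ_mem_fieldL hγ0 (s := -(m * k : ℕ)) ?_ ?_
    · rw [IsCoprime.neg_right_iff, Nat.isCoprime_iff_coprime]
      exact Nat.Coprime.pow_left _ (Nat.Coprime.mul_right H.coprime.symm hkp.symm)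
    · have h1 : p ^ (2 * R.e + 1) = p * p ^ (2 * R.e) := pow_succ' _ _
      rw [h1, pow_mul, H.valuation_γ_pow, ← pow_mul, mul_comm, pow_mul, H.valuation_β_pow,
        hk, zpow_neg, zpow_natCast, inv_pow, ← hvα, ← pow_mul, ← pow_mul]
      congr 2
      ring
  exact exists_pow_mul_eq_of_coprime _ _ ht0 hxL hx0 hyL hy0 hdm hx hy

variable [Algebra.IsAlgebraic F Fbar] [IsGalois F Fbar] [IsSepClosed Fbar]

theorem residueAut_restrictScalars (σ : Fbar ≃ₐ[maxUnramified F Fbar] Fbar) :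
    residueAut (σ.restrictScalars F) = 1 := by
  rw [residueAut_eq_one_iff, IntermediateField.mem_fixingSubgroup_iff]
  exact fun x hx => σ.commutes ⟨x, hx⟩

/-- The homomorphism `σ ↦ (ā_σ^m, b̄_σ, c̄_σ)` on `Gal(F̄/F^ur)`, which acts trivially on the residue
field. -/
noncomputable def inertiaHom :
    (Fbar ≃ₐ[maxUnramified F Fbar] Fbar) →* QR.sub p R 𝓀[Fbar] m :=
  MonoidHom.mk' (fun σ => H.toQR (σ.restrictScalars F)) fun σ τ => by
    have h := H.toQR_mul (σ.restrictScalars F) (τ.restrictScalars F)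
    rw [H.residueAut_restrictScalars, map_one] at h
    exact h

theorem ker_inertiaHom : H.inertiaHom.ker =
    (IntermediateField.extendScalars H.maxUnramified_le_fieldL).fixingSubgroup := by
  ext σ
  have h : σ.restrictScalars F ∈ H.galHom.ker ↔
      σ.restrictScalars F ∈ (fieldL F Fbar m α β γ).fixingSubgroup := by rw [H.ker_galHom]
  rw [IntermediateField.mem_fixingSubgroup_iff] at h ⊢
  refine Iff.trans ?_ h
  rw [MonoidHom.mem_ker, MonoidHom.mem_ker]
  exact ⟨fun h1 => SemidirectProduct.ext h1 (H.residueAut_restrictScalars σ),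
    fun h1 => congrArg SemidirectProduct.left h1⟩

/-- By the Galois correspondence for `F̄/F^ur`, the degree of `L/F^ur` is the index of the kernel of
`inertiaHom`. -/
theorem relfinrank_eq_card_range :
    IntermediateField.relfinrank (maxUnramified F Fbar) (fieldL F Fbar m α β γ) =
      Nat.card H.inertiaHom.range := by
  rw [IntermediateField.relfinrank_eq_finrank_of_le H.maxUnramified_le_fieldL,
    IntermediateField.finrank_eq_fixingSubgroup_index, ← H.ker_inertiaHom, Subgroup.index_ker]

theorem valuation_lt_one_of_pow_eq {π : Fbar}
    (h : valuation Fbar π ^ (R.dm p m * p ^ (2 * R.e + 1)) =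
      valuation Fbar (algebraMap F Fbar (ϖ : F))) : valuation Fbar π < 1 := by
  by_contra! hcon
  have h1 := (valuation_algebraMap_lt_one_iff F (Fbar := Fbar) _).mpr
    (uniformizer_lt_one H.irreducible)
  rw [← h] at h1
  exact absurd (one_le_pow₀ hcon) (not_le.mpr h1)

theorem exists_valuation_sum_eq {π : Fbar} (hπ0 : π ≠ 0)
    (hπ : valuation Fbar π ^ (R.dm p m * p ^ (2 * R.e + 1)) =
      valuation Fbar (algebraMap F Fbar (ϖ : F)))
    (c : Fin (R.dm p m * p ^ (2 * R.e + 1)) → maxUnramified F Fbar) (hc : c ≠ 0) :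
    ∃ i, c i ≠ 0 ∧ valuation Fbar (∑ j, (c j : Fbar) * π ^ (j : ℕ)) =
      valuation Fbar ((c i : Fbar) * π ^ (i : ℕ)) := by
  refine LocalFieldExt.exists_valuation_sum_eq _ _ hπ0 (H.valuation_lt_one_of_pow_eq hπ)
    (fun x hx hx0 => ?_) c hc
  rw [hπ]
  exact exists_zpow_valuation_eq_of_mem_maxUnramified H.irreducible hx hx0

/-- The powers `π^i`, `i < N`, are linearly independent over `F^ur`: a nonzero linear combination has
the value of one of its nonzero terms. -/
theorem linearIndependent_pow {π : Fbar} (hπL : π ∈ fieldL F Fbar m α β γ) (hπ0 : π ≠ 0)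
    (hπ : valuation Fbar π ^ (R.dm p m * p ^ (2 * R.e + 1)) =
      valuation Fbar (algebraMap F Fbar (ϖ : F))) :
    LinearIndependent (maxUnramified F Fbar)
      (fun i : Fin (R.dm p m * p ^ (2 * R.e + 1)) => (⟨π ^ (i : ℕ), pow_mem hπL _⟩ :
        IntermediateField.extendScalars H.maxUnramified_le_fieldL)) := by
  rw [Fintype.linearIndependent_iff]
  intro c hc
  by_contra! hcon
  have hc0 : c ≠ 0 := fun h => by simp [h] at hcon
  obtain ⟨i, hi, h⟩ := H.exists_valuation_sum_eq hπ0 hπ c hc0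
  have h0 : ∑ j, (c j : Fbar) * π ^ (j : ℕ) = 0 := by
    have := congrArg (fun x : IntermediateField.extendScalars H.maxUnramified_le_fieldL =>
      (x : Fbar)) hc
    simpa [IntermediateField.smul_def, Algebra.smul_def] using this
  rw [h0, map_zero, eq_comm, map_eq_zero] at h
  exact mul_ne_zero (by simpa using hi) (pow_ne_zero _ hπ0) h

theorem relfinrank_le :
    IntermediateField.relfinrank (maxUnramified F Fbar) (fieldL F Fbar m α β γ) ≤
      R.dm p m * p ^ (2 * R.e + 1) := by
  obtain ⟨hfin, hcard⟩ := finite_sub_and_card_le (𝔽 := 𝓀[Fbar]) R H.not_two_zero m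
  rw [H.relfinrank_eq_card_range]
  exact (Subgroup.card_le_card_group _).trans hcard

theorem relfinrank_ne_zero :
    IntermediateField.relfinrank (maxUnramified F Fbar) (fieldL F Fbar m α β γ) ≠ 0 := by
  obtain ⟨hfin, -⟩ := finite_sub_and_card_le (𝔽 := 𝓀[Fbar]) R H.not_two_zero m
  rw [H.relfinrank_eq_card_range]
  exact Nat.card_pos.ne'

theorem finite_extendScalars : Module.Finite (maxUnramified F Fbar)
    (IntermediateField.extendScalars H.maxUnramified_le_fieldL) := by
  have h := H.relfinrank_ne_zero
  rw [IntermediateField.relfinrank_eq_finrank_of_le H.maxUnramified_le_fieldL] at h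
  exact Module.finite_of_finrank_pos (Nat.pos_of_ne_zero h)

/-- The degree of `L/F^ur` is at least `N`, since an element of value `v(ϖ)^{1/N}` has `N` linearly
independent powers, and at most `N`, since the Galois group embeds into `Q_{R,m}`. -/
theorem relfinrank_eq :
    IntermediateField.relfinrank (maxUnramified F Fbar) (fieldL F Fbar m α β γ) =
      R.dm p m * p ^ (2 * R.e + 1) := by
  refine le_antisymm H.relfinrank_le ?_
  obtain ⟨π, hπL, hπ0, hπ⟩ := H.exists_uniformizer_fieldL
  have := H.finite_extendScalars
  have h := (H.linearIndependent_pow hπL hπ0 hπ).fintype_card_le_finrank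
  rwa [Fintype.card_fin, ← IntermediateField.relfinrank_eq_finrank_of_le
    H.maxUnramified_le_fieldL] at h

/-- The image has `[L : F^ur] = N` elements, and `Q_{R,m}` has at most as many. -/
theorem inertiaHom_surjective : Function.Surjective H.inertiaHom := by
  obtain ⟨hfin, hcard⟩ := finite_sub_and_card_le (𝔽 := 𝓀[Fbar]) R H.not_two_zero m
  rw [← MonoidHom.range_eq_top]
  refine Subgroup.eq_top_of_le_card _ ?_
  rwa [← H.relfinrank_eq_card_range, H.relfinrank_eq]

/-- Every element of `Q_{R,m}` comes from an automorphism acting trivially on the residue field. -/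
theorem exists_toQR_eq (g : QR.sub p R 𝓀[Fbar] m) :
    ∃ σ : Fbar ≃ₐ[F] Fbar, residueAut σ = 1 ∧ H.toQR σ = g := by
  obtain ⟨σ, hσ⟩ := H.inertiaHom_surjective g
  exact ⟨σ.restrictScalars F, H.residueAut_restrictScalars σ, hσ⟩

/-- The value group of `F^ur` has index `N` in that of `L`: the former is generated by `v(π)^N`,
the latter by `v(π)`, as `1, π, …, π^{N-1}` is a basis of `L`. -/
theorem relIndex_valueGroup :
    (valueGroup (maxUnramified F Fbar)).relIndex (valueGroup (fieldL F Fbar m α β γ)) =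
      R.dm p m * p ^ (2 * R.e + 1) := by
  obtain ⟨π, hπL, hπ0, hπ⟩ := H.exists_uniformizer_fieldL
  have := H.finite_extendScalars
  have hN : Nonempty (Fin (R.dm p m * p ^ (2 * R.e + 1))) := ⟨⟨0,
    Nat.mul_pos (dm_pos R p m) (pow_pos (Fact.out : p.Prime).pos _)⟩⟩
  set N := R.dm p m * p ^ (2 * R.e + 1) with hNdef
  have hvπ0 : valuation Fbar π ≠ 0 := by simpa using hπ0
  let ρ : (ValueGroupWithZero Fbar)ˣ := Units.mk0 _ hvπ0
  have hinj : Function.Injective (zpowersHom (ValueGroupWithZero Fbar)ˣ ρ) := by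
    intro a b hab
    have h := congrArg Units.val hab
    simp only [zpowersHom_apply, Units.val_zpow_eq_zpow_val, ρ, Units.val_mk0] at h
    exact Multiplicative.toAdd.injective
      (zpow_injective_of_lt_one hvπ0 (H.valuation_lt_one_of_pow_eq hπ) h)
  have hK : valueGroup (maxUnramified F Fbar) =
      (Subgroup.zpowers (Multiplicative.ofAdd (N : ℤ))).map (zpowersHom _ ρ) := by
    rw [MonoidHom.map_zpowers]
    ext u
    rw [Subgroup.mem_zpowers_iff]
    constructor
    · rintro ⟨x, rfl⟩
      have hx0 : ((x : maxUnramified F Fbar) : Fbar) ≠ 0 := by simp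
      obtain ⟨z, hz⟩ := exists_zpow_valuation_eq_of_mem_maxUnramified H.irreducible
        (x : maxUnramified F Fbar).2 hx0
      refine ⟨z, Units.ext ?_⟩
      simp only [zpowersHom_apply, toAdd_ofAdd, zpow_natCast, Units.val_zpow_eq_zpow_val,
        Units.val_pow_eq_pow_val, ρ, Units.val_mk0]
      rw [hπ]
      exact hz.symm
    · rintro ⟨z, rfl⟩
      have ht : algebraMap F (maxUnramified F Fbar) (ϖ : F) ≠ 0 := fun h =>
        H.uniformizer_ne_zero (by
          rw [IsScalarTower.algebraMap_apply F (maxUnramified F Fbar) Fbar, h, map_zero])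
      refine ⟨Units.mk0 _ ht ^ z, Units.ext ?_⟩
      simp only [zpowersHom_apply, toAdd_ofAdd, zpow_natCast, Units.val_zpow_eq_zpow_val,
        Units.val_pow_eq_pow_val, ρ, Units.val_mk0, map_zpow]
      rw [hπ]
      rfl
  have hL : valueGroup (fieldL F Fbar m α β γ) =
      (⊤ : Subgroup (Multiplicative ℤ)).map (zpowersHom _ ρ) := by
    ext u
    constructor
    · rintro ⟨x, rfl⟩
      have hx0 : ((x : fieldL F Fbar m α β γ) : Fbar) ≠ 0 := by simp
      let b := basisOfLinearIndependentOfCardEqFinrank (H.linearIndependent_pow hπL hπ0 hπ) (by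
        rw [Fintype.card_fin, ← IntermediateField.relfinrank_eq_finrank_of_le
          H.maxUnramified_le_fieldL, H.relfinrank_eq])
      let y : IntermediateField.extendScalars H.maxUnramified_le_fieldL :=
        ⟨_, (x : fieldL F Fbar m α β γ).2⟩
      have hsum : ∑ j, (b.repr y j : Fbar) * π ^ (j : ℕ) =
          ((x : fieldL F Fbar m α β γ) : Fbar) := by
        have := congrArg (fun x : IntermediateField.extendScalars H.maxUnramified_le_fieldL =>
          (x : Fbar)) (b.sum_repr y)
        simpa [b, y, IntermediateField.smul_def, Algebra.smul_def] using this
      obtain ⟨i, hi, h⟩ := H.exists_valuation_sum_eq hπ0 hπ (b.repr y) (fun h0 => hx0 (by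
        rw [← hsum, h0]; simp))
      obtain ⟨z, hz⟩ := exists_zpow_valuation_eq_of_mem_maxUnramified H.irreducible
        (b.repr y i).2 (by simpa using hi)
      refine ⟨Multiplicative.ofAdd (N * z + i), trivial, Units.ext ?_⟩
      simp only [zpowersHom_apply, toAdd_ofAdd, Units.val_zpow_eq_zpow_val, ρ, Units.val_mk0]
      refine Eq.trans ?_ (congrArg (valuation Fbar) hsum)
      rw [h, map_mul, hz, ← hπ, map_pow, zpow_add₀ hvπ0, zpow_mul, zpow_natCast, zpow_natCast]
    · rintro ⟨z, -, rfl⟩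
      have hπ' : (⟨π, hπL⟩ : fieldL F Fbar m α β γ) ≠ 0 := fun h => hπ0 (congrArg Subtype.val h)
      refine ⟨Units.mk0 _ hπ' ^ z.toAdd, Units.ext ?_⟩
      simp only [zpowersHom_apply, Units.val_zpow_eq_zpow_val, ρ, Units.val_mk0, map_zpow]
      rfl
  rw [hK, hL, Subgroup.relIndex_map_map_of_injective _ _ hinj, Subgroup.relIndex_top_right]
  exact (Int.index_zmultiples (N : ℤ)).trans (Int.natAbs_natCast N)

theorem isTotallyRamifiedExt :
    IsTotallyRamifiedExt (maxUnramified F Fbar) (fieldL F Fbar m α β γ) :=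
  ⟨H.maxUnramified_le_fieldL, H.relfinrank_ne_zero, by
    rw [H.relIndex_valueGroup, H.relfinrank_eq]⟩

end IsAdmissible

end LocalFieldExt

namespace LocalFieldExt

/-! ### The Weil group -/

section Frobenius

theorem frob_pow_apply (k 𝔽 : Type*) [Field k] [Finite k] [Field 𝔽] [Algebra k 𝔽]
    [Algebra.IsAlgebraic k 𝔽] (n : ℕ) (x : 𝔽) : (frob k 𝔽 ^ n) x = x ^ Nat.card k ^ n := by
  induction n with
  | zero => simp
  | succ n ih => rw [pow_succ', AlgEquiv.mul_apply, ih, frob_apply, ← pow_mul, ← pow_succ]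

theorem intAction_apply {k 𝔽 : Type*} [Field k] [Finite k] [Field 𝔽] [Algebra k 𝔽]
    [Algebra.IsAlgebraic k 𝔽] (p : ℕ) [Fact p.Prime] [CharP k p] (R : AddPoly k) (m : ℕ)
    (n : Multiplicative ℤ) :
    QR.intAction 𝔽 p R m n = QR.galAction m (frob k 𝔽 ^ (-n.toAdd)) := by
  rw [zpow_neg, ← inv_zpow]
  rfl

variable (F : Type*) [Field F] [ValuativeRel F] [TopologicalSpace F] [IsNonarchimedeanLocalField F]
  (Fbar : Type*) [Field Fbar] [Algebra F Fbar] [ValuativeRel Fbar] [ValuativeExtension F Fbar]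
  [Algebra.IsAlgebraic F Fbar] [IsSepClosed Fbar]

/-- The Frobenius automorphism of the residue field of `F̄` has infinite order: its `n`-th power
moves the reduction of a primitive root of unity of order `q^n + 1`. -/
theorem frob_zpow_injective :
    Function.Injective fun n : ℤ => frob 𝓀[F] 𝓀[Fbar] ^ n := by
  rw [injective_zpow_iff_not_isOfFinOrder, isOfFinOrder_iff_pow_eq_one]
  rintro ⟨n, hn, h⟩
  obtain ⟨p, hp⟩ := CharP.exists 𝓀[F]
  have : Fact p.Prime := ⟨CharP.char_is_prime 𝓀[F] p⟩
  have hchar : CharP 𝓀[Fbar] p := charP_residueField F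
  have hq : 1 < Nat.card 𝓀[F] ^ n := Nat.one_lt_pow hn.ne' Finite.one_lt_card
  have hpq : p ∣ Nat.card 𝓀[F] ^ n := by
    refine dvd_pow ?_ hn.ne'
    let := Fintype.ofFinite 𝓀[F]
    rw [← CharP.cast_eq_zero_iff 𝓀[F] p, Nat.card_eq_fintype_card, Nat.cast_card_eq_zero]
  set Q := Nat.card 𝓀[F] ^ n with hQ
  have hN : (Q + 1).Coprime p := by
    obtain ⟨c, hc⟩ := hpq
    rw [hc]
    simp
  have hNF : NeZero ((Q + 1 : ℕ) : Fbar) := ⟨fun h0 => by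
    have := valuation_natCast_eq_one (K := Fbar) hN
    rw [h0, map_zero] at this
    exact zero_ne_one this⟩
  obtain ⟨ζ, hζ⟩ := HasEnoughRootsOfUnity.exists_primitiveRoot Fbar (Q + 1)
  have hζt : ζ ∈ tameRoots p Fbar := ⟨Q + 1, Nat.succ_pos _, hN, hζ.pow_eq_one⟩
  have hζQ : ζ ^ Q ∈ tameRoots p Fbar := ⟨Q + 1, Nat.succ_pos _, hN, by
    rw [← pow_mul, mul_comm, pow_mul, hζ.pow_eq_one, one_pow]⟩
  have hζ1 : ζ ∈ 𝒪[Fbar] := (valuation_eq_one_of_mem_tameRoots hζt).le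
  have h1 := DFunLike.congr_fun h (IsLocalRing.residue 𝒪[Fbar] ⟨ζ, hζ1⟩)
  rw [frob_pow_apply, AlgEquiv.one_apply, ← map_pow, residue_eq_iff] at h1
  have h2 : ζ ^ Q = ζ := tameRoots_eq_of_valuation_sub_lt_one hζQ hζt h1
  have h3 : ζ ^ (Q - 1) = 1 := by
    have hζ0 : ζ ≠ 0 := hζ.ne_zero (Nat.succ_ne_zero _)
    apply mul_right_cancel₀ hζ0
    rw [← pow_succ, Nat.sub_add_cancel hq.le, h2, one_mul]
  have := Nat.le_of_dvd (by omega) (hζ.dvd_of_pow_eq_one _ h3)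
  omega

end Frobenius

variable {F : Type*} [Field F] [ValuativeRel F] [TopologicalSpace F] [IsNonarchimedeanLocalField F]
  {Fbar : Type*} [Field Fbar] [Algebra F Fbar] [ValuativeRel Fbar] [ValuativeExtension F Fbar]
  [Algebra.IsAlgebraic F Fbar]

theorem actsAsFrob_iff (σ : Fbar ≃ₐ[F] Fbar) (n : ℤ) :
    ActsAsFrob Fbar σ n ↔ residueAut σ = frob 𝓀[F] 𝓀[Fbar] ^ (-n) := by
  constructor
  · intro h
    ext z
    obtain ⟨⟨x, hx⟩, rfl⟩ := IsLocalRing.residue_surjective z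
    obtain ⟨h1, h2⟩ := h x hx
    exact h2
  · intro h x hx
    exact ⟨algEquiv_mem_integer σ hx, (residueAut_residue σ x hx).symm.trans (by rw [h]; rfl)⟩

/-- Whether `σ` acts on residue classes as a power of Frobenius can be seen on a subextension
containing `F^ur`, as its residue field is that of `F̄`. -/
theorem actsAsFrob_restrict_iff [IsGalois F Fbar] [IsSepClosed Fbar] {L : IntermediateField F Fbar}
    (hL : maxUnramified F Fbar ≤ L) {τ : L ≃ₐ[F] L} {σ : Fbar ≃ₐ[F] Fbar}
    (hσ : ∀ x : L, σ (x : Fbar) = (τ x : Fbar)) (n : ℤ) :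
    ActsAsFrob Fbar τ n ↔ residueAut σ = frob 𝓀[F] 𝓀[Fbar] ^ (-n) := by
  constructor
  · intro h
    ext z
    obtain ⟨ζ, hζ, hζu, rfl⟩ := exists_mem_maxUnramified_residue_eq (F := F) z
    obtain ⟨h1, h2⟩ := h ⟨ζ, hL hζu⟩ hζ
    rw [residueAut_residue]
    refine Eq.trans ?_ h2
    congr 1
    exact Subtype.ext (hσ ⟨ζ, hL hζu⟩)
  · intro h x hx
    have h1 : σ (x : Fbar) ∈ 𝒪[Fbar] := algEquiv_mem_integer σ hx
    refine ⟨by rw [hσ x] at h1; exact h1, ?_⟩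
    rw [← h]
    refine Eq.trans ?_ (residueAut_residue σ (x : Fbar) hx).symm
    congr 1
    exact Subtype.ext (hσ x).symm

variable {p : ℕ} [Fact p.Prime] [CharP 𝓀[F] p] {R : AddPoly 𝓀[F]} {ϖ : 𝒪[F]} {m : ℕ} {α β γ : Fbar}

namespace IsAdmissible

variable [IsGalois F Fbar] [IsSepClosed Fbar] (H : IsAdmissible p R ϖ m α β γ)
include H

theorem galHom_eq_iff (σ σ' : Fbar ≃ₐ[F] Fbar) :
    H.galHom σ = H.galHom σ' ↔ ∀ x : fieldL F Fbar m α β γ, σ (x : Fbar) = σ' x := by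
  rw [← inv_mul_eq_one, ← map_inv, ← map_mul, ← MonoidHom.mem_ker, H.ker_galHom,
    IntermediateField.mem_fixingSubgroup_iff]
  have h : ∀ x : Fbar, (σ⁻¹ * σ') x = x ↔ σ x = σ' x := fun x => by
    rw [AlgEquiv.mul_apply, eq_comm (a := σ x)]
    exact σ.symm_apply_eq
  simp only [h, Subtype.forall]

omit H in
theorem exists_extension (τ : fieldL F Fbar m α β γ ≃ₐ[F] fieldL F Fbar m α β γ) :
    ∃ σ : Fbar ≃ₐ[F] Fbar, ∀ x : fieldL F Fbar m α β γ, σ (x : Fbar) = (τ x : Fbar) :=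
  ⟨τ.liftNormal Fbar, fun x => τ.liftNormal_commutes Fbar x⟩

/-- The image of `τ` does not depend on the extension of `τ` to `F̄`. -/
theorem exists_weilGroup_image (τ : weilGroup Fbar (F := F) (fieldL F Fbar m α β γ)) :
    ∃ g : (QR.sub p R 𝓀[Fbar] m) ⋊[QR.intAction 𝓀[Fbar] p R m] Multiplicative ℤ,
      ∀ σ : Fbar ≃ₐ[F] Fbar, (∀ x : fieldL F Fbar m α β γ, σ (x : Fbar) = (τ.1 x : Fbar)) →
        g.left = H.toQR σ ∧ residueAut σ = frob 𝓀[F] 𝓀[Fbar] ^ (-g.right.toAdd) := by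
  obtain ⟨τ, n, hn⟩ := τ
  obtain ⟨σ₀, hσ₀⟩ := exists_extension τ
  refine ⟨⟨H.toQR σ₀, Multiplicative.ofAdd n⟩, fun σ hσ => ⟨?_, ?_⟩⟩
  · exact congrArg SemidirectProduct.left ((H.galHom_eq_iff σ₀ σ).mpr fun x =>
      (hσ₀ x).trans (hσ x).symm)
  · exact (actsAsFrob_restrict_iff H.maxUnramified_le_fieldL hσ n).mp hn

/-- A lift of the required power of Frobenius can be corrected by an element of the inertia group,
which attains every value in `Q_{R,m}`. -/
theorem exists_mem_weilGroup
    (g : (QR.sub p R 𝓀[Fbar] m) ⋊[QR.intAction 𝓀[Fbar] p R m] Multiplicative ℤ) :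
    ∃ (τ : weilGroup Fbar (F := F) (fieldL F Fbar m α β γ)) (σ : Fbar ≃ₐ[F] Fbar),
      (∀ x : fieldL F Fbar m α β γ, σ (x : Fbar) = (τ.1 x : Fbar)) ∧
        g.left = H.toQR σ ∧ residueAut σ = frob 𝓀[F] 𝓀[Fbar] ^ (-g.right.toAdd) := by
  have := H.isGalois_fieldL
  obtain ⟨σ₀, hσ₀⟩ := residueAut_surjective (F := F) (Fbar := Fbar)
    (frob 𝓀[F] 𝓀[Fbar] ^ (-g.right.toAdd))
  obtain ⟨ρ, hρ1, hρ⟩ := H.exists_toQR_eq (g.left * (H.toQR σ₀)⁻¹)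
  have hres : residueAut (ρ * σ₀) = frob 𝓀[F] 𝓀[Fbar] ^ (-g.right.toAdd) := by
    rw [map_mul, hρ1, one_mul, hσ₀]
  have hext : ∀ x : fieldL F Fbar m α β γ, (ρ * σ₀) (x : Fbar) =
      ((ρ * σ₀).restrictNormal (fieldL F Fbar m α β γ) x : Fbar) := fun x =>
    ((ρ * σ₀).restrictNormal_commutes (fieldL F Fbar m α β γ) x).symm
  refine ⟨⟨(ρ * σ₀).restrictNormal _, g.right.toAdd,
    (actsAsFrob_restrict_iff H.maxUnramified_le_fieldL hext _).mpr hres⟩, ρ * σ₀, hext, ?_, hres⟩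
  rw [H.toQR_mul, hρ1, map_one, hρ, MulAut.one_apply, inv_mul_cancel_right]

/-- The isomorphism between `W(L/F)` and `Q_{R,m} ⋊ ℤ`, described by extensions to `F̄`. -/
theorem exists_weilGroup_mulEquiv :
    ∃ Θ : weilGroup Fbar (F := F) (fieldL F Fbar m α β γ) ≃*
        (QR.sub p R 𝓀[Fbar] m) ⋊[QR.intAction 𝓀[Fbar] p R m] Multiplicative ℤ,
      ∀ (τ : weilGroup Fbar (F := F) (fieldL F Fbar m α β γ)) (σ : Fbar ≃ₐ[F] Fbar),
        (∀ x : fieldL F Fbar m α β γ, σ (x : Fbar) = (τ.1 x : Fbar)) →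
        (Θ τ).left = H.toQR σ ∧ residueAut σ = frob 𝓀[F] 𝓀[Fbar] ^ (-(Θ τ).right.toAdd) := by
  choose θ hθ using H.exists_weilGroup_image
  have hfrob : ∀ a b : Multiplicative ℤ, frob 𝓀[F] 𝓀[Fbar] ^ (-a.toAdd) =
      frob 𝓀[F] 𝓀[Fbar] ^ (-b.toAdd) → a = b := fun a b hab =>
    Multiplicative.toAdd.injective (neg_injective (frob_zpow_injective F Fbar hab))
  have hmul : ∀ τ τ', θ (τ * τ') = θ τ * θ τ' := by
    intro τ τ'
    obtain ⟨σ, hσ⟩ := exists_extension τ.1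
    obtain ⟨σ', hσ'⟩ := exists_extension τ'.1
    obtain ⟨h1, h2⟩ := hθ τ σ hσ
    obtain ⟨h1', h2'⟩ := hθ τ' σ' hσ'
    obtain ⟨h3, h4⟩ := hθ (τ * τ') (σ * σ') fun x => by
      rw [AlgEquiv.mul_apply, hσ', hσ]
      rfl
    refine SemidirectProduct.ext ?_ (hfrob _ _ ?_)
    · rw [h3, H.toQR_mul, SemidirectProduct.mul_left, h1, h1', h2, intAction_apply]
    · rw [← h4, map_mul, h2, h2', SemidirectProduct.mul_right, toAdd_mul, neg_add, zpow_add]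
  have hinj : Function.Injective θ := by
    intro τ τ' h
    obtain ⟨σ, hσ⟩ := exists_extension τ.1
    obtain ⟨σ', hσ'⟩ := exists_extension τ'.1
    obtain ⟨h1, h2⟩ := hθ τ σ hσ
    obtain ⟨h1', h2'⟩ := hθ τ' σ' hσ'
    have hq : H.toQR σ = H.toQR σ' := by rw [← h1, ← h1', h]
    have hr : residueAut σ = residueAut σ' := by rw [h2, h2', h]
    have hg : H.galHom σ = H.galHom σ' := SemidirectProduct.ext hq hr
    refine Subtype.ext (AlgEquiv.ext fun x => Subtype.ext ?_)
    rw [← hσ, ← hσ']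
    exact (H.galHom_eq_iff σ σ').mp hg x
  have hsurj : Function.Surjective θ := by
    intro g
    obtain ⟨τ, σ, hσ, h1, h2⟩ := H.exists_mem_weilGroup g
    obtain ⟨h1', h2'⟩ := hθ τ σ hσ
    exact ⟨τ, SemidirectProduct.ext (h1'.trans h1.symm) (hfrob _ _ (h2'.symm.trans h2))⟩
  exact ⟨MulEquiv.ofBijective (MonoidHom.mk' θ hmul) ⟨hinj, hsurj⟩, hθ⟩

end IsAdmissible

end LocalFieldExt

theorem lemma3p8
    {F : Type*} [Field F] [ValuativeRel F] [TopologicalSpace F] [IsNonarchimedeanLocalField F]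
    {Fbar : Type*} [Field Fbar] [Algebra F Fbar] [IsSepClosure F Fbar]
    [ValuativeRel Fbar] [ValuativeExtension F Fbar]
    (p : ℕ) [Fact p.Prime] [CharP 𝓀[F] p]
    (R : AddPoly 𝓀[F]) (hpe : ¬(p = 2 ∧ R.e = 0))
    (ϖ : 𝒪[F]) (hϖ : Irreducible ϖ)
    (m : ℕ) (hm : 0 < m) (hmp : Nat.Coprime m p)
    (α β γ : Fbar)
    (hα : α ^ R.d p = algebraMap F Fbar (ϖ : F))
    (hβ : evalE p R.e (liftCoeffs F Fbar R) β = (α ^ m)⁻¹)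
    (hγ : γ ^ p - γ = β * evalR p R.e (liftCoeffs F Fbar R) β)
    (h₁ : CongruenceConditions₁ p R β γ)
    (h₂ : CongruenceConditions₂ (F := F) p R β) :
    IsGalois F (fieldL F Fbar m α β γ) ∧
    (∃ Θ : weilGroup Fbar (F := F) (fieldL F Fbar m α β γ) ≃*
        (QR.sub p R 𝓀[Fbar] m) ⋊[QR.intAction 𝓀[Fbar] p R m] Multiplicative ℤ,
      ∀ (τ : weilGroup Fbar (F := F) (fieldL F Fbar m α β γ)) (σ : Fbar ≃ₐ[F] Fbar),
        (∀ x : fieldL F Fbar m α β γ, σ (x : Fbar) = (τ.1 x : Fbar)) →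
        ActsAsFrob Fbar σ (Multiplicative.toAdd (Θ τ).right) ∧
        ∃ (ha : aSigma α σ ∈ 𝒪[Fbar]) (hb : bSigma m α β σ ∈ 𝒪[Fbar])
          (hc : cSigma p R m α β γ σ ∈ 𝒪[Fbar]),
          ((Θ τ).left : QR p R 𝓀[Fbar]).α = IsLocalRing.residue 𝒪[Fbar] ⟨_, ha⟩ ^ m ∧
          ((Θ τ).left : QR p R 𝓀[Fbar]).β = IsLocalRing.residue 𝒪[Fbar] ⟨_, hb⟩ ∧
          ((Θ τ).left : QR p R 𝓀[Fbar]).γ = IsLocalRing.residue 𝒪[Fbar] ⟨_, hc⟩) ∧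
    IsTotallyRamifiedExt (maxUnramified F Fbar) (fieldL F Fbar m α β γ) ∧
    IntermediateField.relfinrank (maxUnramified F Fbar) (fieldL F Fbar m α β γ) =
      R.dm p m * p ^ (2 * R.e + 1) := by
  have : IsSepClosed Fbar := IsSepClosure.sep_closed F
  have : Algebra.IsSeparable F Fbar := IsSepClosure.separable
  have : IsGalois F Fbar := inferInstance
  have H : LocalFieldExt.IsAdmissible p R ϖ m α β γ :=
    ⟨hpe, hϖ, hm, hmp, hα, hβ, hγ, h₁, h₂⟩
  refine ⟨H.isGalois_fieldL, ?_, H.isTotallyRamifiedExt, H.relfinrank_eq⟩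
  obtain ⟨Θ, hΘ⟩ := H.exists_weilGroup_mulEquiv
  refine ⟨Θ, fun τ σ hσ => ?_⟩
  obtain ⟨hleft, hres⟩ := hΘ τ σ hσ
  exact ⟨(LocalFieldExt.actsAsFrob_iff σ _).mpr hres, H.aSigma_mem σ, H.bSigma_mem σ,
    H.cSigma_mem σ, by rw [hleft]; rfl, by rw [hleft]; rfl, by rw [hleft]; rfl⟩
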